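/- Let $p$ be a prime with $p\equiv 1 \pmod 6$, let $\omega$ be a primitive third root of unity of $\mathbb{F}_p$, let $k=\pm1$ and $i\in\{1,2\}$, and consider the elements of $\mathrm{PSL}(3,p)$ represented by \[ \sigma_1=\begin{pmatrix}1&0&0\\0&\omega^i&0\\0&0&\omega^{2i}\end{pmatrix},\quad \sigma_2=\begin{pmatrix}-1&0&-k\\0&-\omega^{2i}&-k\omega^{2i}\\0&0&\omega^i\end{pmatrix},\quad \sigma_3=\begin{pmatrix}1&k&0\\0&k&1\\0&-1&0\end{pmatrix},\quad \sigma_4=\begin{pmatrix}0&1&0\\0&0&1\\1&0&0\end{pmatrix}. \] Then $\sigma_1,\dots,\sigma_4$ generate $G=\mathrm{PSL}(3,p)$, and they generate a chiral polytope of rank five with automorphism group $G$, in the following sense. (1) $(G,(\sigma_1,\dots,\sigma_4))$ is the $C^+$-group of a chiral polytope. That is, with $\tau_{a,b}=\sigma_a\sigma_{a+1}\cdots\sigma_b$ for $1\le a\le b\le 4$: every $\tau_{a,b}$ with $a<b$ is an involution; for all $I,J\subseteq\{0,1,2,3,4\}$ one has $G_I\cap G_J=G_{I\cup J}$, where $G_I=\langle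 \tau_{a,b} : a-1\notin I,\ b\notin I\rangle$; and no automorphism of $G$ sends $\sigma_1$ to $\sigma_1^{-1}$ and fixes $\tau_{1,2},\tau_{1,3},\tau_{1,4}$. (2) There are an abstract polytope $\mathcal P$ of rank $5$ that is chiral (its automorphism group $\Gamma(\mathcal P)$ has exactly two orbits on flags, and adjacent flags lie in distinct orbits), an isomorphism $G\cong\Gamma(\mathcal P)$, and a base flag $\Phi$ of $\mathcal P$, such that $\sigma_1,\dots,\sigma_4$ correspond to the distinguished generators with respect to $\Phi$: for each $a\in\{1,2,3,4\}$, $\sigma_a$ (acting on the left) maps $\Phi$ to $(\Phi^{a-1})^{a}$, where $\Psi^{j}$ denotes the flag that differs from the flag $\Psi$ exactly in the face of rank $j$. Here an abstract polytope of rank $n$ is a poset with a least and a greatest element, all of whose flags (maximal chains) have exactly $n+2$ elements, which is strongly flag-connected (any two flags $\Phi,\Psi$ are joined by a sequence of flags containing $\Phi\cap\Psi$, consecutive ones differing in exactly one element), and which satisfies the diamond condition (if two comparable faces have ranks differing by $2$, there are exactly two faces strictly between them). The Schläfli type, i.e. the tuple of the orders of $\sigma_1,\sigma_2,\sigma_3,\sigma_4$,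 is $\{3,6,6,3\}$ if $k=1$ and $\{3,6,3,3\}$ if $k=-1$. -/

import Mathlib

namespace ChiralPolytopes

/-! ### Abstract polytopes

In a poset with least face `⊥` all of whose flags have the same finite size, `Order.height F` is
the number of elements strictly below `F` in any flag through `F`, so a face `F` has rank
`Order.height F - 1` (in particular `⊥` has rank `-1`). -/

/-- The flags `Φ` and `Ψ` are `j`-adjacent: they are distinct, and they have the same faces
in every rank other than `j`. -/
def FlagAdjAt {P : Type*} [PartialOrder P] (j : ℕ) (Φ Ψ : Flag P) : Prop :=
  Φ ≠ Ψ ∧ ∀ F : P, Order.height F ≠ ((j + 1 : ℕ) : ℕ∞) → (F ∈ Φ ↔ F ∈ Ψ)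

/-- Two flags are adjacent if they differ in exactly one face. -/
def FlagAdj {P : Type*} [PartialOrder P] (Φ Ψ : Flag P) : Prop :=
  ∃ j : ℕ, FlagAdjAt j Φ Ψ

/-- The poset `P`, with its least and greatest face, is an abstract polytope of rank `n`. -/
structure IsAbstractPolytope (P : Type*) [PartialOrder P] [BoundedOrder P] (n : ℕ) : Prop where
  /-- Every flag (maximal chain) has exactly `n + 2` faces, including the two improper ones. -/
  flag_card : ∀ Φ : Flag P, (Φ : Set P).ncard = n + 2
  /-- Strong flag-connectedness: any two flags `Φ`, `Ψ` are joined by a sequence of successively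
  adjacent flags, all of them containing `Φ ∩ Ψ`. -/
  connected : ∀ Φ Ψ : Flag P,
    Relation.ReflTransGen
      (fun A B : Flag P => FlagAdj A B ∧ (Φ : Set P) ∩ (Ψ : Set P) ⊆ (B : Set P)) Φ Ψ
  /-- The diamond condition: if the ranks of `F < K` differ by two, then there are exactly two
  faces strictly between them. -/
  diamond : ∀ F H K : P, F ⋖ H → H ⋖ K → {X : P | F < X ∧ X < K}.ncard = 2

/-- Two flags are in the same orbit of the automorphism group `P ≃o P`. -/
def SameFlagOrbit {P : Type*} [PartialOrder P] (Φ Ψ : Flag P) : Prop :=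
  ∃ γ : P ≃o P, Flag.map γ Φ = Ψ

/-- `P` is chiral: its automorphism group has exactly two orbits on the flags, and adjacent flags
are always in distinct orbits. -/
def IsChiral (P : Type*) [PartialOrder P] : Prop :=
  (∃ Φ Ψ : Flag P, ¬ SameFlagOrbit Φ Ψ ∧
    ∀ X : Flag P, SameFlagOrbit Φ X ∨ SameFlagOrbit Ψ X) ∧
  ∀ Φ Ψ : Flag P, FlagAdj Φ Ψ → ¬ SameFlagOrbit Φ Ψ

/-- The tuple `σ` (read as `σ₁, …, σₘ`) of elements of `G` generates a chiral polytope of rank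
`m + 1`: there are a chiral polytope `P` of rank `m + 1`, an identification `e` of `G` with the
full automorphism group of `P`, and a base flag `Φ` such that the `σᵢ` are the distinguished
rotations of `P` with respect to `Φ`. That is, `σᵢ` (which is `σ (i - 1)` in the code) sends `Φ` to
the `i`-adjacent flag of the `(i-1)`-adjacent flag of `Φ`. -/
def GeneratesChiralPolytope {G : Type*} [Group G] {m : ℕ} (σ : Fin m → G) : Prop :=
  ∃ (P : Type) (_ : PartialOrder P) (_ : BoundedOrder P),
    IsAbstractPolytope P (m + 1) ∧ IsChiral P ∧
    ∃ (e : G ≃* (P ≃o P)) (Φ : Flag P), ∀ i : Fin m, ∃ Ψ : Flag P,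
      FlagAdjAt (i : ℕ) Φ Ψ ∧ FlagAdjAt ((i : ℕ) + 1) Ψ (Flag.map (e (σ i)) Φ)

/-! ### `C⁺`-groups -/

/-- With `σ` read as `σ₁, …, σₘ`, `rot σ a b` is the product `σ_{a+1} σ_{a+2} ⋯ σ_b`,
that is, `τ_{a+1,b}`. -/
def rot {G : Type*} [Group G] {m : ℕ} (σ : Fin m → G) (a b : ℕ) : G :=
  (((List.ofFn σ).take b).drop a).prod

/-- The subgroup generated by the `τ_{i,j} = σ_i ⋯ σ_j` with `1 ≤ i ≤ j ≤ m` and `i - 1, j ∉ I`,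
where `I ⊆ {0, …, m}` is a set of ranks. -/
def rotSubgroup {G : Type*} [Group G] {m : ℕ} (σ : Fin m → G) (I : Set (Fin (m + 1))) :
    Subgroup G :=
  Subgroup.closure {g : G | ∃ a b : Fin (m + 1), a < b ∧ a ∉ I ∧ b ∉ I ∧ g = rot σ a b}

/-- `G` with the tuple `σ = (σ₁, …, σₘ)` is the `C⁺`-group of a chiral polytope. -/
structure IsChiralCPlusGroup {G : Type*} [Group G] {m : ℕ} (σ : Fin m → G) : Prop where
  /-- The `σᵢ` generate `G`. -/
  generates : Subgroup.closure (Set.range σ) = ⊤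
  /-- String property: `σ_i σ_{i+1} ⋯ σ_j` is an involution for `i < j`. -/
  string : ∀ a b : ℕ, a + 1 < b → b ≤ m → orderOf (rot σ a b) = 2
  /-- Intersection property. -/
  intersection : ∀ I J : Set (Fin (m + 1)),
    rotSubgroup σ I ⊓ rotSubgroup σ J = rotSubgroup σ (I ∪ J)
  /-- No automorphism of `G` inverts `σ₁` and fixes all `τ_{1,j}`, `2 ≤ j ≤ m`. -/
  chiral : ¬ ∃ φ : G ≃* G, φ (rot σ 0 1) = (rot σ 0 1)⁻¹ ∧
    ∀ b : ℕ, 2 ≤ b → b ≤ m → φ (rot σ 0 b) = rot σ 0 b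

/-- The Schläfli type: the tuple of the orders of the `σᵢ`. -/
noncomputable def schlafliType {G : Type*} [Group G] {m : ℕ} (σ : Fin m → G) : Fin m → ℕ :=
  fun i => orderOf (σ i)

/-! ### The matrices -/

open Matrix

/-- The matrix `σ₁`. -/
def sl1 {R : Type*} [CommRing R] (ω : R) (hω : ω ^ 3 = 1) (i : ℕ) :
    SpecialLinearGroup (Fin 3) R :=
  ⟨!![1, 0, 0; 0, ω ^ i, 0; 0, 0, ω ^ (2 * i)], by
    have h : ω ^ i * ω ^ (2 * i) = 1 := by
      rw [← pow_add, show i + 2 * i = 3 * i by ring, pow_mul, hω, one_pow]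
    simp [det_fin_three, h]⟩

/-- The matrix `σ₂`. -/
def sl2 {R : Type*} [CommRing R] (ω : R) (hω : ω ^ 3 = 1) (k : R) (i : ℕ) :
    SpecialLinearGroup (Fin 3) R :=
  ⟨!![-1, 0, -k; 0, -ω ^ (2 * i), -k * ω ^ (2 * i); 0, 0, ω ^ i], by
    have h : ω ^ (2 * i) * ω ^ i = 1 := by
      rw [← pow_add, show 2 * i + i = 3 * i by ring, pow_mul, hω, one_pow]
    simp [det_fin_three, h]⟩

/-- The matrix `σ₃`. -/
def sl3 {R : Type*} [CommRing R] (k : R) : SpecialLinearGroup (Fin 3) R :=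
  ⟨!![1, k, 0; 0, k, 1; 0, -1, 0], by simp [det_fin_three]⟩

/-- The matrix `σ₄`. -/
def sl4 (R : Type*) [CommRing R] : SpecialLinearGroup (Fin 3) R :=
  ⟨!![0, 1, 0; 0, 0, 1; 1, 0, 0], by simp [det_fin_three]⟩

/-- The images `(σ₁, σ₂, σ₃, σ₄)` of the four matrices in `PSL(3, R)`. -/
def sigma {R : Type*} [CommRing R] (ω : R) (hω : ω ^ 3 = 1) (k : R) (i : ℕ) :
    Fin 4 → ProjectiveSpecialLinearGroup (Fin 3) R :=
  ![QuotientGroup.mk (sl1 ω hω i), QuotientGroup.mk (sl2 ω hω k i),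
    QuotientGroup.mk (sl3 k), QuotientGroup.mk (sl4 R)]

end ChiralPolytopes

namespace ChiralPolytopes

/-! ### Flag systems -/

/-! The polytope is rebuilt from its flags. If the polytope exists, its flags form two copies of
`G`: the images gΦ of the base flag and the images gΦ⁰ of its 0-adjacent flag. With t_k = σ₁⋯σ_k,
the k-adjacent flag of gΦ is g t_k⁻¹ Φ⁰. Taken as a definition on `G × Bool`, this gives involutions
r_k, and r_i, r_j commute for non-consecutive i < j exactly because t_i⁻¹ t_j = σ_{i+1}⋯σ_j is an
involution. A face of rank a is then a class of flags joined by steps r_k with k ≠ a.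

Everything needed of this poset (its flags are the given ones, strong connectedness, the diamond
condition) follows from one property, `ChainIntersection`: two flags joined both by steps of rank at
least l and by steps of rank less than j are joined by steps of rank in [l, j). It also yields the
intersection property of the subgroups G_I. An automorphism of the poset permutes the flags
equivariantly. Either it is left multiplication by an element of `G`, or it yields an automorphism
of `G` inverting every t_k; since t_k is an involution for k ≥ 2, this is what the chirality
condition forbids.

In rank five `ChainIntersection` reduces to six intersections of subgroups generated by consecutive
σ's. Put w = ω^i; replacing ω by w makes i = 1. The subgroup ⟨σ₁, σ₂, σ₃⟩ fixes the line of e₁ = (1,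
0, 0), and ⟨σ₁, σ₂⟩ also that of e₂ = (0, 1, 0). For k = 1 the subgroup ⟨σ₂, σ₃, σ₄⟩ fixes the line
of (1, w, w²), and ⟨σ₃, σ₄⟩ also that of (1, w², w). For k = -1 it preserves the quadratic form
`quad w` up to cube roots of unity, and ⟨σ₃, σ₄⟩ satisfies the relations of the alternating group
A₄. An element of an intersection is normalized by scalars and powers of σ₂ or σ₃, after which it is
the identity or lies in an explicit unipotent group contained in ⟨σ₂, σ₃⟩.

For chirality, a forbidden automorphism would, after conjugation by t₂, invert σ₂ and σ₃. A word in
σ₂, σ₃ has a unipotent value u with σ₂uσ₂⁻¹ = u^N, where N represents w (for k = 1) or -w² (for k =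
-1), and the same word in the inverses has the same property with value u'. Applying the
automorphism gives also σ₂⁻¹u'σ₂ = u'^N, hence u'^(N²) = u', which is false because N² ≠ 1 in the
field.

Generation uses transvections: the commutator of σ₁ and σ₁σ₂ is unipotent, conjugation by σ₁
separates its two coordinates, and σ₄ permutes the coordinate axes cyclically. Over a prime field
one nonzero element of a root group generates it; this is the hypothesis `hF`. -/

/-- A set `X` (of flags) with involutions `r 0, …, r (n - 1)`, such that `r i` and `r j` commute
whenever `i` and `j` are not consecutive. -/
structure FlagSystem (X : Type*) (n : ℕ) where
  /-- The involutions; `r k x` is thought of as the `k`-adjacent flag of `x`. -/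
  r : Fin n → X → X
  invol : ∀ k x, r k (r k x) = x
  comm : ∀ i j : Fin n, (i : ℕ) + 1 < j → ∀ x, r i (r j x) = r j (r i x)

namespace FlagSystem

variable {X : Type*} {n : ℕ} (M : FlagSystem X n)

/-- `x` can be joined to `y` by steps `r k` with `k ∈ K`. -/
def Conn (K : Set (Fin n)) : X → X → Prop :=
  Relation.ReflTransGen fun x y => ∃ k ∈ K, y = M.r k x

variable {M} {K L : Set (Fin n)} {x y z : X}

theorem Conn.refl (x : X) : M.Conn K x x := Relation.ReflTransGen.refl

theorem Conn.trans (h : M.Conn K x y) (h' : M.Conn K y z) : M.Conn K x z :=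
  Relation.ReflTransGen.trans h h'

theorem Conn.step {k : Fin n} (hk : k ∈ K) (x : X) : M.Conn K x (M.r k x) :=
  Relation.ReflTransGen.single ⟨k, hk, rfl⟩

theorem Conn.symm (h : M.Conn K x y) : M.Conn K y x := by
  induction h with
  | refl => exact Conn.refl _
  | tail _ hs ih =>
    obtain ⟨k, hk, rfl⟩ := hs
    refine Conn.trans ?_ ih
    simpa only [M.invol] using Conn.step (M := M) hk (M.r k _)

theorem Conn.mono (hKL : K ⊆ L) (h : M.Conn K x y) : M.Conn L x y :=
  Relation.ReflTransGen.mono (fun _ _ ⟨k, hk, e⟩ => ⟨k, hKL hk, e⟩) _ _ h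

theorem Conn.eq_of_empty (h : M.Conn ∅ x y) : x = y := by
  induction h with
  | refl => rfl
  | tail _ hs _ => obtain ⟨k, hk, _⟩ := hs; exact hk.elim

theorem Conn.eq_or_of_singleton {k : Fin n} (h : M.Conn {k} x y) : y = x ∨ y = M.r k x := by
  induction h with
  | refl => exact Or.inl rfl
  | tail _ hs ih =>
    obtain ⟨j, rfl, rfl⟩ := hs
    rcases ih with rfl | rfl
    · exact Or.inr rfl
    · exact Or.inl (M.invol _ _)

theorem comm_of_far {i j : Fin n} (h : (i : ℕ) + 1 < j ∨ (j : ℕ) + 1 < i) (x : X) :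
    M.r i (M.r j x) = M.r j (M.r i x) := by
  rcases h with h | h
  · exact M.comm i j h x
  · exact (M.comm j i h x).symm

theorem Conn.map_of_far {k : Fin n} (hk : ∀ j ∈ K, (j : ℕ) + 1 < k ∨ (k : ℕ) + 1 < j)
    (h : M.Conn K x y) : M.Conn K (M.r k x) (M.r k y) := by
  induction h with
  | refl => exact Conn.refl _
  | tail _ hs ih =>
    obtain ⟨j, hj, rfl⟩ := hs
    rw [comm_of_far (hk j hj).symm]
    exact ih.trans (Conn.step hj _)

/-- If `K` and `L` have no equal or consecutive elements, then a path with steps in `K ∪ L` can be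
rearranged so that the steps in `K` come first. -/
theorem Conn.split (hKL : ∀ k ∈ K, ∀ l ∈ L, (l : ℕ) + 1 < k ∨ (k : ℕ) + 1 < l)
    (h : M.Conn (K ∪ L) x y) : ∃ z, M.Conn K x z ∧ M.Conn L z y := by
  induction h with
  | refl => exact ⟨x, Conn.refl _, Conn.refl _⟩
  | tail _ hs ih =>
    obtain ⟨k, hk, rfl⟩ := hs
    obtain ⟨z, hxz, hzy⟩ := ih
    rcases hk with hk | hk
    · exact ⟨M.r k z, hxz.trans (Conn.step hk _), hzy.map_of_far (hKL k hk)⟩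
    · exact ⟨z, hxz, hzy.trans (Conn.step hk _)⟩

theorem Conn.split_lt_gt (i : ℕ) (h : M.Conn {k | (k : ℕ) ≠ i} x y) :
    ∃ z, M.Conn {k | (k : ℕ) < i} x z ∧ M.Conn {k | i < (k : ℕ)} z y := by
  refine Conn.split (fun k hk l hl => ?_) (h.mono fun k hk => ?_)
  · simp only [Set.mem_ofPred_eq] at hk hl
    omega
  · simp only [Set.mem_ofPred_eq] at hk
    exact lt_or_gt_of_ne hk

theorem Conn.split_gt_lt (i : ℕ) (h : M.Conn {k | (k : ℕ) ≠ i} x y) :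
    ∃ z, M.Conn {k | i < (k : ℕ)} x z ∧ M.Conn {k | (k : ℕ) < i} z y := by
  obtain ⟨z, h1, h2⟩ := h.symm.split_lt_gt i
  exact ⟨z, h2.symm, h1.symm⟩

/-- An equivariant self-map preserves connectedness. -/
theorem Conn.map {f : X → X} (hf : ∀ k x, f (M.r k x) = M.r k (f x)) (h : M.Conn K x y) :
    M.Conn K (f x) (f y) := by
  induction h with
  | refl => exact Conn.refl _
  | tail _ hs ih =>
    obtain ⟨k, hk, rfl⟩ := hs
    rw [hf]
    exact ih.trans (Conn.step hk _)

/-- Equivariant maps that agree at one flag agree on its connected component. -/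
theorem Conn.eq_of_equivariant {f g : X → X} (hf : ∀ k x, f (M.r k x) = M.r k (f x))
    (hg : ∀ k x, g (M.r k x) = M.r k (g x)) (h : M.Conn K x y) (hx : f x = g x) :
    f y = g y := by
  induction h with
  | refl => exact hx
  | tail _ hs ih =>
    obtain ⟨k, _, rfl⟩ := hs
    rw [hf, hg, ih]

/-! ### Intersection properties for paths of flags. -/

variable (M) in
/-- The intersection property for a final and an initial segment of ranks. -/
def ChainIntersection : Prop :=
  ∀ (l j : ℕ), l ≤ j → ∀ x y : X, M.Conn {k | l ≤ (k : ℕ)} x y → M.Conn {k | (k : ℕ) < j} x y →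
    M.Conn {k | l ≤ (k : ℕ) ∧ (k : ℕ) < j} x y

theorem ChainIntersection.aux (hM : M.ChainIntersection) (I : Set (Fin n)) (d : ℕ) :
    ∀ l, n ≤ l + d → ∀ x, M.Conn {k | l ≤ (k : ℕ)} x y →
      (∀ i ∈ I, l ≤ (i : ℕ) → M.Conn {i}ᶜ x y) → M.Conn Iᶜ x y := by
  induction d using Nat.strong_induction_on with
  | _ d ih =>
    intro l hl x hxy hI
    -- For the least j ≥ l in `I`, the path avoiding j is rearranged into steps below j followed by
    -- steps above j. The first half can also be walked with steps of rank at least l, so it needs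
    -- only ranks in [l, j), all outside `I`. The second half is treated by induction from j + 1.
    by_cases hne : ∃ i : ℕ, ∃ h : i < n, (⟨i, h⟩ : Fin n) ∈ I ∧ l ≤ i
    · classical
      obtain ⟨hj, hjI, hlj⟩ := Nat.find_spec hne
      have hmin : ∀ m : Fin n, l ≤ (m : ℕ) → (m : ℕ) < Nat.find hne → m ∈ Iᶜ :=
        fun m hlm hm hmI => Nat.find_min hne hm ⟨m.2, hmI, hlm⟩
      generalize Nat.find hne = j at *
      have h1 := hI ⟨j, hj⟩ hjI hlj
      have h2 : M.Conn {k | (k : ℕ) ≠ j} x y := h1.mono (by intro k hk e; exact hk (Fin.ext e))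
      obtain ⟨z, hxz, hzy⟩ := h2.split_lt_gt j
      have hxz' : M.Conn {k | l ≤ (k : ℕ)} x z :=
        hxy.trans (hzy.symm.mono fun k (hk : j < (k : ℕ)) => (by simp; omega))
      have hxz2 := hM l j hlj x z hxz' hxz
      refine (hxz2.mono fun k hk => hmin k hk.1 hk.2).trans ?_
      refine ih (n - (j + 1)) (by omega) (j + 1) (by omega) z (hzy.mono fun k hk => hk) ?_
      intro i hi hji
      refine Conn.trans (hxz.symm.mono ?_) (hI i hi (by omega))
      rintro k (hk : (k : ℕ) < j) rfl
      omega
    · push Not at hne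
      exact hxy.mono fun k hk hkI => absurd hk (not_le.2 (hne k k.2 hkI))

/-- The general intersection property follows from the one for initial and final segments. -/
theorem ChainIntersection.inter (hM : M.ChainIntersection) (htr : ∀ x y, M.Conn Set.univ x y)
    (I : Set (Fin n)) (hI : ∀ i ∈ I, M.Conn {i}ᶜ x y) : M.Conn Iᶜ x y :=
  hM.aux I n 0 (by omega) x ((htr x y).mono fun k _ => Nat.zero_le _) fun i hi _ => hI i hi

/-! ### The poset of faces -/

variable (M) in
/-- Representatives `(a, x)` of faces: the face of `x` of rank `a - 1`. -/
def Rep (_M : FlagSystem X n) : Type _ := Fin (n + 2) × X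

/-- The indices of the involutions that preserve the face of rank `a - 1`. -/
def fixing (n a : ℕ) : Set (Fin n) := {k | (k : ℕ) + 1 ≠ a}

/-- Two flags through a common face can be spliced there: `z` takes its lower part from `x` and its
upper part from `y`. Steps above and below the common face commute, so the path can be rearranged to
make all the upper changes first. -/
theorem Conn.interpolate {b : ℕ} (h : M.Conn (fixing n b) x y) :
    ∃ z, (∀ a ≤ b, M.Conn (fixing n a) x z) ∧ ∀ a, b ≤ a → M.Conn (fixing n a) z y := by
  rcases b with _ | b
  · refine ⟨y, fun a ha => ?_, fun a _ => Conn.refl _⟩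
    obtain rfl : a = 0 := by omega
    exact h
  have h' : M.Conn {k | (k : ℕ) ≠ b} x y := h.mono (by intro k hk e; exact hk (by omega))
  obtain ⟨z, h1, h2⟩ := h'.split_gt_lt b
  refine ⟨z, fun a ha => h1.mono fun k hk => ?_, fun a ha => h2.mono fun k hk => ?_⟩ <;>
  · simp only [Set.mem_ofPred_eq, fixing] at hk ⊢
    omega

/-- The witness `z` is a flag containing both faces. Transitivity is splicing two such flags at the
middle face. -/
instance : Preorder M.Rep where
  le p q := p.1 ≤ q.1 ∧ ∃ z, M.Conn (fixing n p.1) p.2 z ∧ M.Conn (fixing n q.1) z q.2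
  le_refl p := ⟨le_rfl, p.2, Conn.refl _, Conn.refl _⟩
  le_trans p q s h h' := by
    obtain ⟨hpq, u, hu1, hu2⟩ := h
    obtain ⟨hqs, v, hv1, hv2⟩ := h'
    obtain ⟨z, hz1, hz2⟩ := (hu2.trans hv1).interpolate
    exact ⟨hpq.trans hqs, z, hu1.trans (hz1 _ hpq), (hz2 _ hqs).trans hv2⟩

variable (M) in
/-- The poset of faces of a flag system. -/
def Face : Type _ := Antisymmetrization M.Rep (· ≤ ·)

instance : PartialOrder M.Face := inferInstanceAs (PartialOrder (Antisymmetrization M.Rep (· ≤ ·)))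

variable (M) in
/-- The face of the flag `x` of rank `a - 1`. -/
def face (a : Fin (n + 2)) (x : X) : M.Face :=
  toAntisymmetrization (· ≤ ·) ((a, x) : M.Rep)

theorem face_le {a b : Fin (n + 2)} : M.face a x ≤ M.face b y ↔
    a ≤ b ∧ ∃ z, M.Conn (fixing n a) x z ∧ M.Conn (fixing n b) z y := Iff.rfl

theorem face_eq {a b : Fin (n + 2)} : M.face a x = M.face b y ↔
    a = b ∧ M.Conn (fixing n a) x y := by
  constructor
  · intro h
    have h1 := face_le.1 h.le
    have h2 := face_le.1 h.ge
    obtain rfl := le_antisymm h1.1 h2.1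
    obtain ⟨_, z, hz1, hz2⟩ := h1
    exact ⟨rfl, hz1.trans hz2⟩
  · rintro ⟨rfl, h⟩
    exact le_antisymm (face_le.2 ⟨le_rfl, x, Conn.refl _, h⟩)
      (face_le.2 ⟨le_rfl, x, h.symm, Conn.refl _⟩)

theorem face_eq_self {a : Fin (n + 2)} :
    M.face a x = M.face a y ↔ M.Conn (fixing n a) x y := by
  simp [face_eq]

theorem face_mono (x : X) {a b : Fin (n + 2)} (h : a ≤ b) : M.face a x ≤ M.face b x :=
  face_le.2 ⟨h, x, Conn.refl _, Conn.refl _⟩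

theorem face_strictMono (x : X) : StrictMono fun a => M.face a x := fun _ _ h =>
  lt_of_le_of_ne (face_mono x h.le) fun e => h.ne (face_eq.1 e).1

theorem exists_face (F : M.Face) : ∃ a x, F = M.face a x := by
  induction F using Quotient.inductionOn' with
  | h p => exact ⟨p.1, p.2, rfl⟩

variable (M) in
/-- One plus the rank of a face. -/
def rk : M.Face → Fin (n + 2) :=
  Quotient.lift (s := AntisymmRel.setoid M.Rep (· ≤ ·)) (fun p => p.1)
    fun _ _ h => le_antisymm h.1.1 h.2.1

@[simp] theorem rk_face (a : Fin (n + 2)) (x : X) : M.rk (M.face a x) = a := rfl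

theorem rk_strictMono : StrictMono M.rk := by
  intro F H h
  obtain ⟨a, x, rfl⟩ := exists_face F
  obtain ⟨b, y, rfl⟩ := exists_face H
  refine lt_of_le_of_ne (face_le.1 h.le).1 fun e => h.not_ge ?_
  simp only [rk_face] at e
  subst e
  obtain ⟨_, z, h1, h2⟩ := face_le.1 h.le
  exact (face_eq_self.2 (h1.trans h2)).ge

theorem height_face (a : Fin (n + 2)) (x : X) : Order.height (M.face a x) = (a : ℕ) := by
  apply le_antisymm
  · have hm : StrictMono fun F : M.Face => (M.rk F : ℕ) := fun F H h => rk_strictMono h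
    simpa using Order.height_le_height_apply_of_strictMono _ hm (M.face a x)
  · obtain ⟨a, ha⟩ := a
    induction a with
    | zero => simp
    | succ a ih =>
      have h := Order.height_add_one_le (face_strictMono (M := M) x
        (show (⟨a, by omega⟩ : Fin (n + 2)) < ⟨a + 1, ha⟩ from Nat.lt_succ_self a))
      refine le_trans ?_ h
      push_cast
      gcongr
      exact ih (by omega)

theorem face_zero (htr : ∀ x y, M.Conn Set.univ x y) (x y : X) : M.face 0 x = M.face 0 y :=
  face_eq_self.2 ((htr x y).mono fun k _ => by simp [fixing])

theorem face_last (htr : ∀ x y, M.Conn Set.univ x y) (x y : X) :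
    M.face (Fin.last _) x = M.face (Fin.last _) y :=
  face_eq_self.2 ((htr x y).mono fun k _ => by simp [fixing]; omega)

/-- The improper faces. -/
@[reducible] def boundedOrder (htr : ∀ x y, M.Conn Set.univ x y) (x₀ : X) :
    BoundedOrder M.Face where
  bot := M.face 0 x₀
  bot_le F := by
    obtain ⟨a, x, rfl⟩ := exists_face F
    rw [face_zero htr x₀ x]
    exact face_mono x (Fin.zero_le _)
  top := M.face (Fin.last _) x₀
  le_top F := by
    obtain ⟨a, x, rfl⟩ := exists_face F
    rw [face_last htr x₀ x]
    exact face_mono x (Fin.le_last _)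

/-! ### Flags -/

variable (M) in
/-- The flag of the poset of faces given by `x`. -/
def flag (x : X) : Flag M.Face where
  carrier := Set.range fun a => M.face a x
  Chain' := by
    rintro _ ⟨a, rfl⟩ _ ⟨b, rfl⟩ _
    exact (le_total a b).imp (face_mono x) (face_mono x)
  max_chain' s hs hsub := by
    refine hsub.antisymm fun F hF => ?_
    obtain ⟨a, y, rfl⟩ := exists_face F
    refine ⟨a, ?_⟩
    by_contra hne
    rcases hs.total hF (hsub ⟨a, rfl⟩) with h | h
    · exact absurd (rk_strictMono (lt_of_le_of_ne h (Ne.symm hne))) (by simp)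
    · exact absurd (rk_strictMono (lt_of_le_of_ne h hne)) (by simp)

theorem mem_flag {F : M.Face} : F ∈ M.flag x ↔ M.face (M.rk F) x = F := by
  constructor
  · rintro ⟨a, rfl⟩
    rfl
  · intro h
    exact ⟨_, h⟩

theorem face_mem_flag {a : Fin (n + 2)} :
    M.face a y ∈ M.flag x ↔ M.Conn (fixing n a) x y := by
  rw [mem_flag, rk_face, face_eq_self]

/-- A maximal chain is not yet known to meet every rank, so the induction is on a bound `c` for the
rank and carries the highest face `G` of `Φ` below that bound. When `Φ` has a face of the next rank,
a flag through it and `G` is spliced at `G` with the flag already found. -/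
theorem exists_face_eq_of_flag (htr : ∀ x y, M.Conn Set.univ x y) (Φ : Flag M.Face)
    {G₀ : M.Face} (hG₀ : G₀ ∈ Φ) (hrk : M.rk G₀ = 0) (c : ℕ) : ∃ x, ∃ G ∈ Φ, (M.rk G : ℕ) ≤ c ∧
      ∀ F ∈ Φ, (M.rk F : ℕ) ≤ c → M.rk F ≤ M.rk G ∧ M.face (M.rk F) x = F := by
  induction c with
  | zero =>
    obtain ⟨a, x, rfl⟩ := exists_face G₀
    rw [rk_face] at hrk
    subst hrk
    refine ⟨x, _, hG₀, by simp, fun F _ hc => ?_⟩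
    obtain ⟨b, y, rfl⟩ := exists_face F
    obtain rfl : b = 0 := Fin.ext (by simpa using hc)
    exact ⟨le_rfl, face_zero htr _ _⟩
  | succ c ih =>
    obtain ⟨x, G, hG, hGc, h⟩ := ih
    by_cases hF : ∃ F ∈ Φ, (M.rk F : ℕ) = c + 1
    · obtain ⟨F, hF, hc⟩ := hF
      have huniq : ∀ F' ∈ Φ, (M.rk F' : ℕ) = c + 1 → F' = F := by
        intro F' hF' hc'
        by_contra hne
        rcases Φ.le_or_le hF' hF with h | h
        · have := rk_strictMono (lt_of_le_of_ne h hne)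
          omega
        · have := rk_strictMono (lt_of_le_of_ne h (Ne.symm hne))
          omega
      have hGF : G ≤ F := by
        refine (Φ.le_or_le hG hF).resolve_right fun hle => ?_
        have := rk_strictMono.monotone hle
        omega
      have hxG := (h G hG hGc).2
      obtain ⟨a, y, rfl⟩ := exists_face F
      rw [← hxG] at hGF
      obtain ⟨hab, w, hw1, hw2⟩ := face_le.1 hGF
      obtain ⟨z, hz1, hz2⟩ := hw1.interpolate
      have hza : M.face a z = M.face a y := face_eq_self.2 ((hz2 _ hab).trans hw2)
      refine ⟨z, _, hF, hc.le, fun F' hF' hc' => ?_⟩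
      rcases hc'.lt_or_eq with hlt | heq
      · have h' := h F' hF' (by omega)
        refine ⟨h'.1.trans hab, ?_⟩
        rw [← (face_eq_self.2 (hz1 _ h'.1)), h'.2]
      · rw [huniq F' hF' heq]
        exact ⟨le_rfl, hza⟩
    · push Not at hF
      exact ⟨x, G, hG, by omega, fun F hFΦ hc => h F hFΦ (by have := hF F hFΦ; omega)⟩

/-- Every flag of the poset of faces is the flag of some `x`. -/
theorem exists_flag (htr : ∀ x y, M.Conn Set.univ x y) (x₀ : X) (Φ : Flag M.Face) :
    ∃ x, Φ = M.flag x := by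
  let := boundedOrder htr x₀
  obtain ⟨x, _, -, -, h⟩ := exists_face_eq_of_flag htr Φ (G₀ := ⊥) Φ.bot_mem rfl (n + 2)
  refine ⟨x, Flag.ext (Φ.max_chain' (M.flag x).Chain' fun F hF => ?_)⟩
  exact mem_flag.2 (h F hF (M.rk F).is_lt.le).2

/-- This is where the intersection property enters the geometry: sharing one face means being joined
by steps that fix it, and the separate paths for the several faces merge into one path that fixes
all of them. -/
theorem conn_of_face_eq (hM : M.ChainIntersection) (htr : ∀ x y, M.Conn Set.univ x y)
    (A : Set ℕ) (h : ∀ a : Fin (n + 2), (a : ℕ) ∈ A → M.face a x = M.face a y) :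
    M.Conn {k : Fin n | (k : ℕ) + 1 ∉ A} x y := by
  refine hM.inter htr {k : Fin n | (k : ℕ) + 1 ∈ A} fun k hk => ?_
  refine (face_eq_self.1 (h ⟨k + 1, by omega⟩ hk)).mono fun j hj e => ?_
  cases e
  exact hj rfl

theorem flag_injective (hM : M.ChainIntersection) (htr : ∀ x y, M.Conn Set.univ x y) :
    Function.Injective M.flag := by
  intro x y h
  refine Conn.eq_of_empty (M := M) ((conn_of_face_eq hM htr Set.univ fun a _ => ?_).mono ?_)
  · have : M.face a x ∈ M.flag y := h ▸ face_mem_flag.2 (Conn.refl x)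
    exact (face_eq_self.2 (face_mem_flag.1 this)).symm
  · intro k hk
    exact hk trivial

/-! ### Adjacency of flags, strong connectedness and the diamond condition. -/

theorem flagAdjAt_step (hM : M.ChainIntersection) (htr : ∀ x y, M.Conn Set.univ x y)
    (hfix : ∀ k x, M.r k x ≠ x) (k : Fin n) (x : X) :
    FlagAdjAt (k : ℕ) (M.flag x) (M.flag (M.r k x)) := by
  refine ⟨fun h => hfix k x (flag_injective hM htr h).symm, fun F hF => ?_⟩
  obtain ⟨a, y, rfl⟩ := exists_face F
  rw [height_face] at hF
  have hk : k ∈ fixing n a := fun e => hF (by rw [e])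
  rw [face_mem_flag, face_mem_flag]
  exact ⟨fun h => (Conn.step hk x).symm.trans h, fun h => (Conn.step hk x).trans h⟩

theorem flagAdjAt_iff (hM : M.ChainIntersection) (htr : ∀ x y, M.Conn Set.univ x y)
    (hfix : ∀ k x, M.r k x ≠ x) {j : ℕ} :
    FlagAdjAt j (M.flag x) (M.flag y) ↔ ∃ k : Fin n, (k : ℕ) = j ∧ y = M.r k x := by
  constructor
  · rintro ⟨hne, h⟩
    have hconn : M.Conn {k : Fin n | (k : ℕ) + 1 ∉ ({j + 1}ᶜ : Set ℕ)} x y := by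
      refine conn_of_face_eq hM htr _ fun a ha => ?_
      have hmem := (h (M.face a x) (by rw [height_face]; exact fun e => ha (by exact_mod_cast e))).1
        (face_mem_flag.2 (Conn.refl x))
      exact (face_eq_self.2 (face_mem_flag.1 hmem)).symm
    by_cases hj : j < n
    · have h1 : M.Conn {⟨j, hj⟩} x y := hconn.mono fun k hk => by
        simp only [Set.mem_ofPred_eq, Set.mem_compl_iff, Set.mem_singleton_iff, not_not,
          add_left_inj] at hk
        exact Fin.ext hk
      rcases h1.eq_or_of_singleton with rfl | rfl
      · exact absurd rfl hne
      · exact ⟨⟨j, hj⟩, rfl, rfl⟩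
    · have h1 : M.Conn ∅ x y := hconn.mono fun k hk => by
        simp only [Set.mem_ofPred_eq, Set.mem_compl_iff, Set.mem_singleton_iff, not_not,
          add_left_inj] at hk
        omega
      exact absurd (by rw [h1.eq_of_empty]) hne
  · rintro ⟨k, rfl, rfl⟩
    exact flagAdjAt_step hM htr hfix k x

theorem flagAdj_iff (hM : M.ChainIntersection) (htr : ∀ x y, M.Conn Set.univ x y)
    (hfix : ∀ k x, M.r k x ≠ x) :
    FlagAdj (M.flag x) (M.flag y) ↔ ∃ k : Fin n, y = M.r k x := by
  simp only [FlagAdj, flagAdjAt_iff hM htr hfix]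
  exact ⟨fun ⟨_, k, _, h⟩ => ⟨k, h⟩, fun ⟨k, h⟩ => ⟨k, k, rfl, h⟩⟩

theorem ncard_flag (x : X) : ((M.flag x : Flag M.Face) : Set M.Face).ncard = n + 2 := by
  have : ((M.flag x : Flag M.Face) : Set M.Face) = (fun a => M.face a x) '' Set.univ :=
    Set.image_univ.symm
  rw [this, Set.ncard_image_of_injective _ (face_strictMono x).injective, Set.ncard_univ]
  simp

/-- With `A` the set of ranks in which the two flags agree, the path supplied by `conn_of_face_eq`
never changes a shared face. -/
theorem strongly_connected (hM : M.ChainIntersection) (htr : ∀ x y, M.Conn Set.univ x y)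
    (hfix : ∀ k x, M.r k x ≠ x) (x y : X) :
    Relation.ReflTransGen (fun A B : Flag M.Face => FlagAdj A B ∧
      (M.flag x : Set M.Face) ∩ (M.flag y : Set M.Face) ⊆ (B : Set M.Face))
      (M.flag x) (M.flag y) := by
  set A : Set ℕ := {a | ∃ h : a < n + 2, M.face ⟨a, h⟩ x = M.face ⟨a, h⟩ y} with hA
  have hconn := conn_of_face_eq hM htr A (x := x) (y := y) fun a ⟨_, ha⟩ => ha
  have key : ∀ z, M.Conn {k : Fin n | (k : ℕ) + 1 ∉ A} x z →
      (M.flag x : Set M.Face) ∩ (M.flag y : Set M.Face) ⊆ (M.flag z : Set M.Face) := by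
    rintro z hz F ⟨hFx, hFy⟩
    obtain ⟨a, w, rfl⟩ := exists_face F
    have hx := face_mem_flag.1 hFx
    have hy := face_mem_flag.1 hFy
    refine face_mem_flag.2 (Conn.trans (hz.symm.mono ?_) hx)
    intro k hk e
    refine hk ?_
    rw [e]
    exact ⟨a.2, face_eq_self.2 (hx.trans hy.symm)⟩
  clear_value A
  have : ∀ z, M.Conn {k : Fin n | (k : ℕ) + 1 ∉ A} x z →
      Relation.ReflTransGen (fun A B : Flag M.Face => FlagAdj A B ∧
        (M.flag x : Set M.Face) ∩ (M.flag y : Set M.Face) ⊆ (B : Set M.Face))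
        (M.flag x) (M.flag z) := by
    intro z hz
    induction hz with
    | refl => exact Relation.ReflTransGen.refl
    | tail hz hs ih =>
      refine ih.tail ?_
      have := key _ (hz.tail hs)
      obtain ⟨k, -, rfl⟩ := hs
      exact ⟨(flagAdj_iff hM htr hfix).2 ⟨k, rfl⟩, this⟩
  exact this y hconn

/-- A flag that shares the two outer faces with `x` is reached by steps that change neither. Such
steps are either of the middle rank or far from it; the middle ones can be made first, and only they
affect the middle face. -/
theorem ncard_between (hM : M.ChainIntersection) (htr : ∀ x y, M.Conn Set.univ x y)
    (hfix : ∀ k x, M.r k x ≠ x) (x₀ : X) (F H K : M.Face) (hFH : F ⋖ H) (hHK : H ⋖ K) :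
    {Z : M.Face | F < Z ∧ Z < K}.ncard = 2 := by
  have hchain : IsChain (· ≤ ·) ({F, H, K} : Set M.Face) := by
    have h1 := hFH.lt.le
    have h2 := hHK.lt.le
    have h3 := h1.trans h2
    rintro a (rfl | rfl | rfl) b (rfl | rfl | rfl) _ <;> simp [h1, h2, h3]
  obtain ⟨Φ, hΦ⟩ := hchain.exists_subset_flag
  obtain ⟨x, rfl⟩ := exists_flag htr x₀ Φ
  obtain ⟨a, rfl⟩ : F ∈ M.flag x := hΦ (by simp)
  obtain ⟨b, rfl⟩ : H ∈ M.flag x := hΦ (by simp)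
  obtain ⟨c, rfl⟩ : K ∈ M.flag x := hΦ (by simp)
  have hab : (b : ℕ) = a + 1 := by
    have h1 : (a : ℕ) < b := rk_strictMono hFH.lt
    by_contra hne
    exact hFH.2 (face_strictMono x (a := a) (b := ⟨a + 1, by omega⟩) (by simp [Fin.lt_def]))
      (face_strictMono x (by simp [Fin.lt_def]; omega))
  have hbc : (c : ℕ) = b + 1 := by
    have h1 : (b : ℕ) < c := rk_strictMono hHK.lt
    by_contra hne
    exact hHK.2 (face_strictMono x (a := b) (b := ⟨b + 1, by omega⟩) (by simp [Fin.lt_def]))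
      (face_strictMono x (by simp [Fin.lt_def]; omega))
  -- The involution with index k changes the face with index k + 1, so k = a is the one that changes
  -- the middle face b = a + 1.
  set k : Fin n := ⟨a, by omega⟩ with hk
  have hka : k ∈ fixing n a := by simp [fixing, hk]
  have hkc : k ∈ fixing n c := by simp [fixing, hk]; omega
  have hfa : M.face a (M.r k x) = M.face a x := face_eq_self.2 (Conn.step hka x).symm
  have hfc : M.face c (M.r k x) = M.face c x := face_eq_self.2 (Conn.step hkc x).symm
  have hset : {Z : M.Face | M.face a x < Z ∧ Z < M.face c x} =
      {M.face b x, M.face b (M.r k x)} := by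
    ext Z
    constructor
    · rintro ⟨h1, h2⟩
      have hchain : IsChain (· ≤ ·) ({M.face a x, Z, M.face c x} : Set M.Face) := by
        have h3 := h1.le.trans h2.le
        rintro _ (rfl | rfl | rfl) _ (rfl | rfl | rfl) _ <;> simp [h1.le, h2.le, h3]
      obtain ⟨Φ, hΦ⟩ := hchain.exists_subset_flag
      obtain ⟨y, rfl⟩ := exists_flag htr x₀ Φ
      have ha : M.face a x ∈ M.flag y := hΦ (by simp)
      have hc : M.face c x ∈ M.flag y := hΦ (by simp)
      obtain ⟨d, rfl⟩ : Z ∈ M.flag y := hΦ (by simp)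
      have hd1 : (a : ℕ) < d := rk_strictMono h1
      have hd2 : (d : ℕ) < c := rk_strictMono h2
      obtain rfl : d = b := Fin.ext (by omega)
      have hconn : M.Conn {j : Fin n | (j : ℕ) + 1 ∉ ({(a : ℕ), (c : ℕ)} : Set ℕ)} x y := by
        refine conn_of_face_eq hM htr _ fun e he => ?_
        rcases he with he | he
        · rw [Fin.ext he]
          exact face_eq_self.2 (face_mem_flag.1 ha).symm
        · rw [Fin.ext he]
          exact face_eq_self.2 (face_mem_flag.1 hc).symm
      have hsplit : ∃ z, M.Conn {k} x z ∧
          M.Conn {j : Fin n | (j : ℕ) + 1 < k ∨ (k : ℕ) + 1 < j} z y := by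
        refine Conn.split (by rintro _ rfl l hl; exact hl) (hconn.mono fun j hj => ?_)
        simp only [Set.mem_ofPred_eq, Set.mem_insert_iff, Set.mem_singleton_iff, not_or] at hj
        by_cases hjk : j = k
        · exact Or.inl hjk
        · refine Or.inr ?_
          have : (j : ℕ) ≠ a := fun e => hjk (Fin.ext e)
          simp only [Set.mem_ofPred_eq, hk]
          omega
      obtain ⟨z, hxz, hzy⟩ := hsplit
      have hz : M.face d y = M.face d z := face_eq_self.2 (hzy.symm.mono fun j hj => by
        simp only [Set.mem_ofPred_eq, fixing, hk] at hj ⊢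
        omega)
      show M.face d y ∈ _
      rw [hz]
      rcases hxz.eq_or_of_singleton with rfl | rfl <;> simp
    · rintro (rfl | rfl)
      · exact ⟨hFH.lt, hHK.lt⟩
      · exact ⟨hfa ▸ face_strictMono (M.r k x) (rk_strictMono hFH.lt),
          hfc ▸ face_strictMono (M.r k x) (rk_strictMono hHK.lt)⟩
  rw [hset, Set.ncard_pair]
  intro heq
  refine hfix k x (Conn.eq_of_empty (M := M) ((conn_of_face_eq hM htr Set.univ
    fun e _ => ?_).mono (by intro j hj; exact hj trivial))).symm
  by_cases he : e = b
  · rw [he, heq]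
  · refine face_eq_self.2 (Conn.step ?_ x)
    intro hke
    exact he (Fin.ext (by simp only [hk] at hke; omega))

/-- The poset of faces of a connected, fixed-point free flag system with the intersection property
is an abstract polytope. -/
theorem isAbstractPolytope (hM : M.ChainIntersection) (htr : ∀ x y, M.Conn Set.univ x y)
    (hfix : ∀ k x, M.r k x ≠ x) (x₀ : X) :
    letI := boundedOrder htr x₀
    IsAbstractPolytope M.Face n := by
  let := boundedOrder htr x₀
  refine ⟨fun Φ => ?_, fun Φ Ψ => ?_, ncard_between hM htr hfix x₀⟩
  · obtain ⟨x, rfl⟩ := exists_flag htr x₀ Φ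
    exact ncard_flag x
  · obtain ⟨x, rfl⟩ := exists_flag htr x₀ Φ
    obtain ⟨y, rfl⟩ := exists_flag htr x₀ Ψ
    exact strongly_connected hM htr hfix x y

end FlagSystem
end ChiralPolytopes

namespace ChiralPolytopes

/-! ### Flags of a group generated by rotations -/

namespace FlagSystem

variable {X : Type*} {n : ℕ} {M : FlagSystem X n}

/-! ### Automorphisms -/

/-- An equivariant map on the flags induces a map on the representatives of faces. -/
def repHom (f : X → X) (hf : ∀ k x, f (M.r k x) = M.r k (f x)) : M.Rep →o M.Rep where
  toFun p := show M.Rep from (p.1, f p.2)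
  monotone' _ _ h := ⟨h.1, f h.2.choose, h.2.choose_spec.1.map hf, h.2.choose_spec.2.map hf⟩

/-- An equivariant map on the flags induces an endomorphism of the poset of faces. -/
def faceHom (f : X → X) (hf : ∀ k x, f (M.r k x) = M.r k (f x)) : M.Face →o M.Face :=
  (repHom f hf).antisymmetrization

theorem faceHom_face (f : X → X) (hf : ∀ k x, f (M.r k x) = M.r k (f x))
    (a : Fin (n + 2)) (x : X) : faceHom f hf (M.face a x) = M.face a (f x) := rfl

/-- An equivariant permutation of the flags induces an automorphism of the poset of faces. -/
def faceEquiv (f : Equiv.Perm X) (hf : ∀ k x, f (M.r k x) = M.r k (f x)) : M.Face ≃o M.Face :=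
  OrderIso.ofHomInv (faceHom f hf)
    (faceHom f.symm fun k x => by rw [Equiv.symm_apply_eq, hf, Equiv.apply_symm_apply])
    (by
      ext F
      obtain ⟨a, x, rfl⟩ := exists_face F
      simp [faceHom_face])
    (by
      ext F
      obtain ⟨a, x, rfl⟩ := exists_face F
      simp [faceHom_face])

theorem faceEquiv_face (f : Equiv.Perm X) (hf : ∀ k x, f (M.r k x) = M.r k (f x))
    (a : Fin (n + 2)) (x : X) : faceEquiv f hf (M.face a x) = M.face a (f x) := rfl

theorem map_faceEquiv_flag (f : Equiv.Perm X) (hf : ∀ k x, f (M.r k x) = M.r k (f x)) (x : X) :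
    Flag.map (faceEquiv f hf) (M.flag x) = M.flag (f x) := by
  refine Flag.ext ?_
  rw [Flag.coe_map]
  change _ '' Set.range _ = Set.range _
  rw [← Set.range_comp]
  rfl

theorem flagAdjAt_map {P : Type*} [PartialOrder P] (γ : P ≃o P) {j : ℕ} {Φ Ψ : Flag P}
    (h : FlagAdjAt j Φ Ψ) : FlagAdjAt j (Flag.map γ Φ) (Flag.map γ Ψ) := by
  refine ⟨fun e => h.1 ((Flag.map γ).injective e), fun F hF => ?_⟩
  obtain ⟨F, rfl⟩ := γ.surjective F
  rw [Order.height_orderIso] at hF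
  have := h.2 F hF
  have key : ∀ Θ : Flag P, γ F ∈ Flag.map γ Θ ↔ F ∈ Θ := fun Θ => by
    rw [← Flag.mem_coe_iff, Flag.coe_map, γ.injective.mem_set_image, Flag.mem_coe_iff]
  rw [key, key, this]

/-- Every automorphism of the poset of faces comes from an equivariant map on the flags. -/
theorem exists_equivariant (hM : M.ChainIntersection) (htr : ∀ x y, M.Conn Set.univ x y)
    (hfix : ∀ k x, M.r k x ≠ x) (γ : M.Face ≃o M.Face) : ∃ f : X → X,
      (∀ x, Flag.map γ (M.flag x) = M.flag (f x)) ∧ ∀ k x, f (M.r k x) = M.r k (f x) := by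
  choose f hf using fun x => exists_flag htr x (Flag.map γ (M.flag x))
  refine ⟨f, hf, fun k x => ?_⟩
  have h := flagAdjAt_map γ (flagAdjAt_step hM htr hfix k x)
  rw [hf, hf, flagAdjAt_iff hM htr hfix] at h
  obtain ⟨k', hk, h⟩ := h
  rw [h, Fin.ext hk]

theorem eq_of_map_flag_eq {γ δ : M.Face ≃o M.Face}
    (h : ∀ x, Flag.map γ (M.flag x) = Flag.map δ (M.flag x)) : γ = δ := by
  ext F
  obtain ⟨a, x, rfl⟩ := exists_face F
  have hmem : γ (M.face a x) ∈ Flag.map δ (M.flag x) := by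
    rw [← h, ← Flag.mem_coe_iff, Flag.coe_map]
    exact ⟨_, face_mem_flag.2 (Conn.refl x), rfl⟩
  rw [← Flag.mem_coe_iff, Flag.coe_map] at hmem
  obtain ⟨_, ⟨b, rfl⟩, hb⟩ := hmem
  have h1 := congrArg Order.height hb
  rw [Order.height_orderIso, Order.height_orderIso, height_face, height_face] at h1
  have hab : b = a := Fin.ext (by exact_mod_cast h1)
  rw [← hb, hab]

end FlagSystem

/-! ### The flag system of a group with a tuple of generators -/

section rot

variable {G : Type*} [Group G] {m : ℕ} (σ : Fin m → G)

@[simp] theorem rot_zero_zero : rot σ 0 0 = 1 := by simp [rot]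

theorem rot_eq {a b : ℕ} (h : a ≤ b) : rot σ a b = (rot σ 0 a)⁻¹ * rot σ 0 b := by
  rw [eq_inv_mul_iff_mul_eq]
  simp only [rot, List.drop_zero]
  rw [← List.prod_append]
  congr 1
  conv_rhs => rw [← List.take_append_drop a ((List.ofFn σ).take b)]
  rw [List.take_take, min_eq_left h]

theorem rot_succ (i : Fin m) : rot σ 0 (i + 1) = rot σ 0 i * σ i := by
  simp [rot, List.take_add_one]

theorem rot_step (i : Fin m) : (rot σ 0 i)⁻¹ * rot σ 0 (i + 1) = σ i := by
  rw [rot_succ, inv_mul_cancel_left]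

/-- The subgroup generated by those `σ i` whose ranks `i`, `i + 1` are in the interval `[l, j)`. -/
def segment (l j : ℕ) : Subgroup G := Subgroup.closure {g | ∃ i : Fin m, l ≤ i ∧ i + 1 < j ∧ g = σ i}

theorem mem_segment {l j : ℕ} {i : Fin m} (h : l ≤ i) (h' : (i : ℕ) + 1 < j) :
    σ i ∈ segment σ l j :=
  Subgroup.subset_closure ⟨i, h, h', rfl⟩

variable {σ} in
theorem segment_le {l j : ℕ} {H : Subgroup G}
    (h : ∀ i : Fin m, l ≤ i → (i : ℕ) + 1 < j → σ i ∈ H) : segment σ l j ≤ H := by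
  rw [segment, Subgroup.closure_le]
  rintro _ ⟨i, h1, h2, rfl⟩
  exact h i h1 h2

theorem rot_mem_segment {l j a b : ℕ} (ha : l ≤ a) (hab : a ≤ b) (hb : b < j) (hbm : b ≤ m) :
    (rot σ 0 a)⁻¹ * rot σ 0 b ∈ segment σ l j := by
  induction b, hab using Nat.le_induction with
  | base => simp
  | succ b hab ih =>
    have h := mul_mem (ih (by omega) (by omega))
      (mem_segment σ (i := ⟨b, by omega⟩) (show l ≤ b by omega) hb)
    have e := rot_succ σ ⟨b, by omega⟩
    rw [e]
    simpa [mul_assoc] using h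

theorem rot_mem_segment' {l j a b : ℕ} (ha : l ≤ a) (hb : l ≤ b) (haj : a < j) (hbj : b < j)
    (ham : a ≤ m) (hbm : b ≤ m) : (rot σ 0 a)⁻¹ * rot σ 0 b ∈ segment σ l j := by
  rcases le_total a b with h | h
  · exact rot_mem_segment σ ha h hbj hbm
  · have := inv_mem (rot_mem_segment σ hb h haj ham)
    simpa using this

/-- The string condition in terms of the products `σ₁ ⋯ σⱼ`. -/
def StringRel : Prop := ∀ a b : ℕ, a + 1 < b → b ≤ m →
  (rot σ 0 a)⁻¹ * rot σ 0 b * ((rot σ 0 a)⁻¹ * rot σ 0 b) = 1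

variable {σ} in
theorem StringRel.symm (h : StringRel σ) {a b : ℕ} (hab : a + 1 < b) (hb : b ≤ m) :
    (rot σ 0 a)⁻¹ * rot σ 0 b = (rot σ 0 b)⁻¹ * rot σ 0 a := by
  have := eq_inv_of_mul_eq_one_left (h a b hab hb)
  simpa using this

variable {σ} in
theorem StringRel.symm' (h : StringRel σ) {a b : ℕ} (hab : a + 1 < b) (hb : b ≤ m) :
    rot σ 0 a * (rot σ 0 b)⁻¹ = rot σ 0 b * (rot σ 0 a)⁻¹ := by
  have := h.symm hab hb
  rw [inv_mul_eq_iff_eq_mul] at this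
  rw [mul_inv_eq_iff_eq_mul]
  calc rot σ 0 a = rot σ 0 a * ((rot σ 0 b)⁻¹ * rot σ 0 a) * (rot σ 0 a)⁻¹ * rot σ 0 b := by group
    _ = _ := by rw [← this]

variable {σ} in
theorem StringRel.inv_eq (h : StringRel σ) {b : ℕ} (hb : 1 < b) (hbm : b ≤ m) :
    (rot σ 0 b)⁻¹ = rot σ 0 b := by
  simpa using (h.symm (a := 0) hb hbm).symm

end rot

open FlagSystem

variable {G : Type*} [Group G] {m : ℕ} {σ : Fin m → G}

/-- The flag system of a group with generators: the flag `(g, false)` is the image under `g` of the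
base flag, and `(g, true)` is the image under `g` of the flag that is `0`-adjacent to it. -/
def groupFlags (hσ : StringRel σ) : FlagSystem (G × Bool) (m + 1) where
  r k x := (x.1 * bif x.2 then rot σ 0 k else (rot σ 0 k)⁻¹, !x.2)
  invol := by rintro k ⟨g, _ | _⟩ <;> simp
  comm i j hij := by
    have h1 := hσ.symm hij (by omega)
    have h2 := hσ.symm' hij (by omega)
    rintro ⟨g, _ | _⟩ <;> simp [mul_assoc, h1, h2]

variable (hσ : StringRel σ)

@[simp] theorem groupFlags_r_false (k : Fin (m + 1)) (g : G) :
    (groupFlags hσ).r k (g, false) = (g * (rot σ 0 k)⁻¹, true) := rfl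

@[simp] theorem groupFlags_r_true (k : Fin (m + 1)) (g : G) :
    (groupFlags hσ).r k (g, true) = (g * rot σ 0 k, false) := rfl

theorem groupFlags_r_snd (k : Fin (m + 1)) (x : G × Bool) :
    ((groupFlags hσ).r k x).2 = !x.2 := rfl

theorem groupFlags_r_ne (k : Fin (m + 1)) (x : G × Bool) : (groupFlags hσ).r k x ≠ x := fun h => by
  have := congrArg Prod.snd h
  rw [groupFlags_r_snd] at this
  simp at this

/-- Two successive steps i, j from an even flag multiply on the right by t_i⁻¹ t_j, where t_k is
`rot σ 0 k`. At an odd flag the induction must record what any next step would give, hence the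
quantifier over `K` in the second half. -/
theorem groupFlags_mem_of_conn {K : Set (Fin (m + 1))} {H : Subgroup G}
    (hH : ∀ i ∈ K, ∀ j ∈ K, (rot σ 0 i)⁻¹ * rot σ 0 j ∈ H) {g : G} {y : G × Bool}
    (h : (groupFlags hσ).Conn K (g, false) y) :
    (y.2 = false → g⁻¹ * y.1 ∈ H) ∧ (y.2 = true → ∀ k ∈ K, g⁻¹ * y.1 * rot σ 0 k ∈ H) := by
  induction h with
  | refl => simp
  | @tail y z _ hs ih =>
    obtain ⟨k, hk, rfl⟩ := hs
    obtain ⟨y, _ | _⟩ := y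
    · simp only [forall_const, reduceCtorEq, false_implies, and_true, groupFlags_r_false, true_and]
        at ih ⊢
      intro j hj
      have := mul_mem ih (hH k hk j hj)
      simpa [mul_assoc] using this
    · simp only [forall_const, reduceCtorEq, false_implies, and_true, groupFlags_r_true, true_and]
        at ih ⊢
      have := ih k hk
      simpa [mul_assoc] using this

theorem groupFlags_conn_of_mem {K : Set (Fin (m + 1))} {S : Set G}
    (hS : ∀ g ∈ S, ∃ i ∈ K, ∃ j ∈ K, g = (rot σ 0 i)⁻¹ * rot σ 0 j) {h : G}
    (hh : h ∈ Subgroup.closure S) (g : G) :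
    (groupFlags hσ).Conn K (g, false) (g * h, false) := by
  induction hh using Subgroup.closure_induction generalizing g with
  | mem x hx =>
    obtain ⟨i, hi, j, hj, rfl⟩ := hS x hx
    have h1 := (Conn.step (M := groupFlags hσ) hi (g, false)).trans (Conn.step hj _)
    simpa [mul_assoc] using h1
  | one => simpa using Conn.refl (M := groupFlags hσ) (g, false)
  | mul x y _ _ hx hy =>
    rw [← mul_assoc]
    exact (hx g).trans (hy _)
  | inv x _ hx => simpa using (hx (g * x⁻¹)).symm

/-- This dictionary turns the intersection property for paths into the one for subgroups: G_I
consists of the elements that carry the base flag to a flag reachable without changing a face whose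
rank is in `I`. -/
theorem groupFlags_conn_iff_rotSubgroup (I : Set (Fin (m + 1))) (g : G) :
    (groupFlags hσ).Conn Iᶜ (1, false) (g, false) ↔ g ∈ rotSubgroup σ I := by
  constructor
  · intro h
    have := (groupFlags_mem_of_conn hσ (H := rotSubgroup σ I) ?_ h).1 rfl
    · simpa using this
    · have key : ∀ i ∉ I, ∀ j ∉ I, i < j → (rot σ 0 i)⁻¹ * rot σ 0 j ∈ rotSubgroup σ I :=
        fun i hi j hj hij => Subgroup.subset_closure ⟨i, j, hij, hi, hj, (rot_eq σ hij.le).symm⟩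
      intro i hi j hj
      rcases lt_trichotomy i j with h | rfl | h
      · exact key i hi j hj h
      · simp
      · simpa using inv_mem (key j hj i hi h)
  · intro h
    have := groupFlags_conn_of_mem hσ (K := Iᶜ) ?_ h 1
    · simpa using this
    · rintro _ ⟨a, b, hab, ha, hb, rfl⟩
      exact ⟨a, ha, b, hb, rot_eq σ hab.le⟩

theorem groupFlags_transitive (hgen : Subgroup.closure (Set.range σ) = ⊤) (x y : G × Bool) :
    (groupFlags hσ).Conn Set.univ x y := by
  have h1 : ∀ g h : G, (groupFlags hσ).Conn Set.univ (g, false) (h, false) := fun g h => by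
    have := groupFlags_conn_of_mem hσ (K := Set.univ) (S := Set.range σ) (h := g⁻¹ * h) ?_
      (by rw [hgen]; trivial) g
    · simpa using this
    · rintro _ ⟨i, rfl⟩
      exact ⟨i.castSucc, trivial, i.succ, trivial, by simpa using (rot_step σ i).symm⟩
  have h2 : ∀ x, ∃ g, (groupFlags hσ).Conn Set.univ x (g, false) := by
    rintro ⟨g, _ | _⟩
    · exact ⟨g, Conn.refl _⟩
    · exact ⟨_, Conn.step (k := 0) (Set.mem_univ _) _⟩
  obtain ⟨g, hg⟩ := h2 x
  obtain ⟨h, hh⟩ := h2 y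
  exact hg.trans ((h1 g h).trans hh.symm)

/-- The intersection property of the subgroups follows from that of the flags. -/
theorem rotSubgroup_inf (hM : (groupFlags hσ).ChainIntersection)
    (hgen : Subgroup.closure (Set.range σ) = ⊤) (I J : Set (Fin (m + 1))) :
    rotSubgroup σ I ⊓ rotSubgroup σ J = rotSubgroup σ (I ∪ J) := by
  apply le_antisymm
  · intro g hg
    obtain ⟨hI, hJ⟩ := Subgroup.mem_inf.1 hg
    rw [← groupFlags_conn_iff_rotSubgroup hσ] at hI hJ
    rw [← groupFlags_conn_iff_rotSubgroup hσ]
    refine hM.inter (groupFlags_transitive hσ hgen) _ ?_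
    rintro i (hi | hi)
    · refine hI.mono ?_
      rintro k hk rfl
      exact hk hi
    · refine hJ.mono ?_
      rintro k hk rfl
      exact hk hi
  · refine le_inf (Subgroup.closure_mono ?_) (Subgroup.closure_mono ?_)
    · rintro _ ⟨a, b, hab, ha, hb, rfl⟩
      exact ⟨a, b, hab, fun h => ha (Or.inl h), fun h => hb (Or.inl h), rfl⟩
    · rintro _ ⟨a, b, hab, ha, hb, rfl⟩
      exact ⟨a, b, hab, fun h => ha (Or.inr h), fun h => hb (Or.inr h), rfl⟩

/-! ### The action of the group on flags and faces. -/

theorem groupFlags_smul (g : G) (k : Fin (m + 1)) (x : G × Bool) :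
    (g * ((groupFlags hσ).r k x).1, ((groupFlags hσ).r k x).2) =
      (groupFlags hσ).r k (g * x.1, x.2) := by
  obtain ⟨x, _ | _⟩ := x <;> simp [mul_assoc]

/-- Left multiplication on the flags. -/
def leftMul (g : G) : Equiv.Perm (G × Bool) := (Equiv.mulLeft g).prodCongr (Equiv.refl _)

theorem leftMul_apply (g : G) (x : G × Bool) : leftMul g x = (g * x.1, x.2) := rfl

theorem leftMul_r (g : G) (k : Fin (m + 1)) (x : G × Bool) :
    leftMul g ((groupFlags hσ).r k x) = (groupFlags hσ).r k (leftMul g x) :=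
  groupFlags_smul hσ g k x

/-- `G` acts on the poset of faces. -/
def groupFlagsAut : G →* ((groupFlags hσ).Face ≃o (groupFlags hσ).Face) where
  toFun g := faceEquiv (leftMul g) (leftMul_r hσ g)
  map_one' := by
    ext F
    obtain ⟨a, x, rfl⟩ := exists_face F
    rw [faceEquiv_face, leftMul_apply, one_mul]
    rfl
  map_mul' g h := by
    ext F
    obtain ⟨a, x, rfl⟩ := exists_face F
    rw [RelIso.mul_apply, faceEquiv_face, faceEquiv_face, faceEquiv_face]
    simp only [leftMul_apply, mul_assoc]

theorem map_groupFlagsAut (g : G) (x : G × Bool) :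
    Flag.map (groupFlagsAut hσ g) ((groupFlags hσ).flag x) =
      (groupFlags hσ).flag (g * x.1, x.2) :=
  map_faceEquiv_flag _ _ x

/-- An equivariant bijection of the flags that sends the base flag to its `0`-adjacent flag gives
an automorphism of `G` that inverts all `σ₁ ⋯ σⱼ`. -/
theorem exists_mulEquiv_of_equivariant (hgen : Subgroup.closure (Set.range σ) = ⊤)
    {f : G × Bool → G × Bool} (hf : ∀ k x, f ((groupFlags hσ).r k x) = (groupFlags hσ).r k (f x))
    (hbij : Function.Bijective f) (h1 : f (1, false) = (1, true)) :
    ∃ φ : G ≃* G, ∀ b ≤ m, φ (rot σ 0 b) = (rot σ 0 b)⁻¹ := by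
  have htr := groupFlags_transitive hσ hgen
  have hparity : ∀ x, (f x).2 = !x.2 := fun x => by
    have h := htr (1, false) x
    induction h with
    | refl => simp [h1]
    | tail _ hs ih =>
      obtain ⟨k, _, rfl⟩ := hs
      rw [hf, groupFlags_r_snd, groupFlags_r_snd, ih]
  have hfval : ∀ g, f (g, false) = ((f (g, false)).1, true) := fun g =>
    Prod.ext rfl (hparity _)
  -- Both sides are equivariant in `x` and agree at the base flag, hence everywhere by
  -- connectedness. This makes the first coordinate of f(g, false) multiplicative in `g`.
  have hsmul : ∀ g x, f (g * x.1, x.2) = ((f (g, false)).1 * (f x).1, (f x).2) := fun g x => by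
    refine Conn.eq_of_equivariant (M := groupFlags hσ)
      (f := fun x : G × Bool => f (g * x.1, x.2))
      (g := fun x : G × Bool => ((f (g, false)).1 * (f x).1, (f x).2)) ?_ ?_
      (htr (1, false) x) ?_
    · intro k x
      rw [groupFlags_smul, hf]
    · intro k x
      rw [hf, groupFlags_smul]
    · simp only [mul_one, h1]
      exact hfval g
  let φ : G →* G := MonoidHom.mk' (fun g => (f (g, false)).1) fun g h =>
    congrArg Prod.fst (hsmul g (h, false))
  have hφ : Function.Bijective φ := by
    constructor
    · intro g h hgh
      have : f (g, false) = f (h, false) := by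
        rw [hfval g, hfval h]
        exact Prod.ext hgh rfl
      exact congrArg Prod.fst (hbij.1 this)
    · intro h
      obtain ⟨⟨g, e⟩, hg⟩ := hbij.2 (h, true)
      have he := hparity (g, e)
      rw [hg] at he
      obtain rfl : e = false := by simpa using he
      exact ⟨g, congrArg Prod.fst hg⟩
  refine ⟨MulEquiv.ofBijective φ hφ, fun b hb => ?_⟩
  have e0 : f (1, true) = (1, false) := by
    have := hf 0 (1, false)
    rw [h1] at this
    simpa using this
  -- The step of index b leads from (1, true) to (t_b, false), and from its image (1, false) to
  -- (t_b⁻¹, true).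
  have := hf ⟨b, by omega⟩ (1, true)
  rw [e0] at this
  change (f (rot σ 0 b, false)).1 = _
  simpa using congrArg Prod.fst this

/-- A group with the string relations, the intersection property and no automorphism inverting
`σ₁` and fixing the `σ₁ ⋯ σⱼ` generates a chiral polytope. -/
theorem generatesChiralPolytope {G : Type} [Group G] {σ : Fin m → G} (hσ : StringRel σ)
    (hM : (groupFlags hσ).ChainIntersection)
    (hgen : Subgroup.closure (Set.range σ) = ⊤)
    (hchir : ¬ ∃ φ : G ≃* G, φ (rot σ 0 1) = (rot σ 0 1)⁻¹ ∧
      ∀ b : ℕ, 2 ≤ b → b ≤ m → φ (rot σ 0 b) = rot σ 0 b) (hm : 0 < m) :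
    GeneratesChiralPolytope σ := by
  have htr := groupFlags_transitive hσ hgen
  have hfix := groupFlags_r_ne hσ
  have hsurj : Function.Surjective (groupFlagsAut hσ) := by
    intro γ
    obtain ⟨f, hf, hfr⟩ := exists_equivariant hM htr hfix γ
    obtain ⟨g, hg⟩ : ∃ g, g = (f (1, false)).1 := ⟨_, rfl⟩
    rcases hpar : (f (1, false)).2 with _ | _
    · refine ⟨g, eq_of_map_flag_eq fun x => ?_⟩
      rw [map_groupFlagsAut, hf]
      congr 1
      refine Conn.eq_of_equivariant (M := groupFlags hσ) (f := fun x : G × Bool => (g * x.1, x.2))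
        (fun k x => groupFlags_smul hσ g k x) hfr (htr (1, false) x) ?_
      exact Prod.ext (by simp [hg]) hpar.symm
    · exfalso
      have hbij : Function.Bijective f := by
        constructor
        · intro x y hxy
          refine flag_injective hM htr ((Flag.map γ).injective ?_)
          rw [hf, hf, hxy]
        · intro y
          obtain ⟨x, hx⟩ := exists_flag htr y (Flag.map γ.symm ((groupFlags hσ).flag y))
          refine ⟨x, flag_injective hM htr ?_⟩
          rw [← hf, ← hx, ← Flag.symm_map, Equiv.apply_symm_apply]
      -- Composing with a translation by the group moves the image of the base flag to (1, true)
      -- exactly.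
      let e : G × Bool ≃ G × Bool := leftMul g⁻¹
      obtain ⟨φ, hφ⟩ := exists_mulEquiv_of_equivariant hσ hgen (f := e ∘ f)
        (fun k x => by
          rw [Function.comp_apply, hfr]
          exact leftMul_r hσ g⁻¹ k (f x))
        (e.bijective.comp hbij)
        (Prod.ext (by simp [e, leftMul_apply, hg]) hpar)
      refine hchir ⟨φ, hφ 1 (by omega), fun b hb hbm => ?_⟩
      rw [hφ b hbm, hσ.inv_eq hb hbm]
  have hinj : Function.Injective (groupFlagsAut hσ) := by
    intro g h hgh
    have := map_groupFlagsAut hσ g (1, false)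
    rw [hgh, map_groupFlagsAut] at this
    simpa using (congrArg Prod.fst (flag_injective hM htr this)).symm
  have horbit : ∀ x y, SameFlagOrbit ((groupFlags hσ).flag x) ((groupFlags hσ).flag y) ↔
      x.2 = y.2 := by
    intro x y
    constructor
    · rintro ⟨γ, hγ⟩
      obtain ⟨g, rfl⟩ := hsurj γ
      rw [map_groupFlagsAut] at hγ
      have h := flag_injective hM htr hγ
      rw [← h]
    · intro h
      refine ⟨groupFlagsAut hσ (y.1 * x.1⁻¹), ?_⟩
      rw [map_groupFlagsAut]
      congr 1
      exact Prod.ext (by simp) h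
  refine ⟨(groupFlags hσ).Face, inferInstance, boundedOrder htr (1, false),
    isAbstractPolytope hM htr hfix _, ⟨⟨(groupFlags hσ).flag (1, false),
      (groupFlags hσ).flag (1, true), ?_, ?_⟩, ?_⟩,
    MulEquiv.ofBijective (groupFlagsAut hσ) ⟨hinj, hsurj⟩, (groupFlags hσ).flag (1, false), ?_⟩
  · simp [horbit]
  · intro Φ
    obtain ⟨⟨g, _ | _⟩, rfl⟩ := exists_flag htr (1, false) Φ <;> simp [horbit]
  · intro Φ Ψ
    obtain ⟨x, rfl⟩ := exists_flag htr (1, false) Φ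
    obtain ⟨y, rfl⟩ := exists_flag htr (1, false) Ψ
    rw [flagAdj_iff hM htr hfix, horbit]
    rintro ⟨k, rfl⟩
    simp [groupFlags_r_snd]
  · intro i
    refine ⟨_, flagAdjAt_step hM htr hfix i.castSucc _, ?_⟩
    have := flagAdjAt_step hM htr hfix i.succ ((groupFlags hσ).r i.castSucc (1, false))
    rw [Fin.val_succ] at this
    convert this using 1
    refine (map_groupFlagsAut hσ (σ i) (1, false)).trans ?_
    simp [rot_step]

/-! ### The intersection property from conditions on segments -/

theorem groupFlags_mem_segment_of_conn {l j : ℕ} {g : G} {y : G × Bool}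
    (h : (groupFlags hσ).Conn {k | l ≤ (k : ℕ) ∧ (k : ℕ) < j} (g, false) y) :
    (y.2 = false → g⁻¹ * y.1 ∈ segment σ l j) ∧
      (y.2 = true → ∀ k, l ≤ k → k < j → k ≤ m → g⁻¹ * y.1 * rot σ 0 k ∈ segment σ l j) := by
  have := groupFlags_mem_of_conn hσ (H := segment σ l j) (fun i hi k hk =>
    rot_mem_segment' σ hi.1 hk.1 hi.2 hk.2 (by omega) (by omega)) h
  exact ⟨this.1, fun hy k hk hkj hkm => this.2 hy ⟨k, by omega⟩ ⟨hk, hkj⟩⟩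

theorem groupFlags_conn_of_mem_segment {l j : ℕ} {g h : G} (hh : g⁻¹ * h ∈ segment σ l j) :
    (groupFlags hσ).Conn {k | l ≤ (k : ℕ) ∧ (k : ℕ) < j} (g, false) (h, false) := by
  have := groupFlags_conn_of_mem hσ (K := {k | l ≤ (k : ℕ) ∧ (k : ℕ) < j}) ?_ hh g
  · simpa using this
  · rintro _ ⟨i, hl, hj, rfl⟩
    refine ⟨i.castSucc, ⟨hl, ?_⟩, i.succ, ⟨?_, ?_⟩, by simpa using (rot_step σ i).symm⟩
    · simp only [Fin.val_castSucc]
      omega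
    · simp only [Fin.val_succ]
      omega
    · simpa using hj

/-- The intersection property for flags in terms of conditions on the subgroups generated by
consecutive generators. -/
theorem groupFlags_chainIntersection
    (hA : ∀ l j, 1 ≤ l → l ≤ j → j ≤ m →
      segment σ l (m + 1) ⊓ segment σ 0 j ≤ segment σ l j)
    (hB : ∀ j, 1 ≤ j → j ≤ m → ∀ u ∈ segment σ 0 j, u * rot σ 0 j ∉ segment σ j (m + 1))
    (hC : ∀ j, 1 ≤ j → j ≤ m → ∀ u ∈ segment σ 0 j,
      (rot σ 0 j)⁻¹ * u * rot σ 0 j ∈ segment σ j (m + 1) → u = 1) :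
    (groupFlags hσ).ChainIntersection := by
  intro l j hlj x y hs hp
  rcases Nat.eq_zero_or_pos l with rfl | hl
  · exact hp.mono (by intro k hk; exact ⟨Nat.zero_le _, hk⟩)
  rcases Nat.lt_or_ge m j with hj | hj
  · exact hs.mono (by intro k hk; exact ⟨hk, by have := k.2; omega⟩)
  have hs' : (groupFlags hσ).Conn {k | l ≤ (k : ℕ) ∧ (k : ℕ) < m + 1} x y :=
    hs.mono (by intro k hk; exact ⟨hk, k.2⟩)
  have hp' : (groupFlags hσ).Conn {k | 0 ≤ (k : ℕ) ∧ (k : ℕ) < j} x y :=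
    hp.mono (by intro k hk; exact ⟨Nat.zero_le _, hk⟩)
  have heven : ∀ g h : G,
      (groupFlags hσ).Conn {k | l ≤ (k : ℕ) ∧ (k : ℕ) < m + 1} (g, false) (h, false) →
      (groupFlags hσ).Conn {k | 0 ≤ (k : ℕ) ∧ (k : ℕ) < j} (g, false) (h, false) →
      (groupFlags hσ).Conn {k | l ≤ (k : ℕ) ∧ (k : ℕ) < j} (g, false) (h, false) :=
    fun g h h1 h2 => groupFlags_conn_of_mem_segment hσ (hA l j hl hlj hj
      ⟨(groupFlags_mem_segment_of_conn hσ h1).1 rfl, (groupFlags_mem_segment_of_conn hσ h2).1 rfl⟩)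
  clear hs hp
  rcases hlj.lt_or_eq with hlt | rfl
  -- The interval [l, j) is nonempty, so a step of rank l turns odd flags into even ones without
  -- leaving any of the three components; `hA` then suffices. For l = j no step is available, and
  -- flags of different or odd parity need `hB` and `hC`.
  · set k : Fin (m + 1) := ⟨l, by omega⟩ with hk
    have step : ∀ z, ∃ g, (groupFlags hσ).Conn {k | l ≤ (k : ℕ) ∧ (k : ℕ) < j} z (g, false) := by
      rintro ⟨g, _ | _⟩
      · exact ⟨g, Conn.refl _⟩
      · refine ⟨_, Conn.step (k := k) ?_ _⟩
        exact ⟨le_rfl, hlt⟩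
    obtain ⟨g, hg⟩ := step x
    obtain ⟨h, hh⟩ := step y
    have hl' : ∀ {u v}, (groupFlags hσ).Conn {k | l ≤ (k : ℕ) ∧ (k : ℕ) < j} u v →
        (groupFlags hσ).Conn {k | l ≤ (k : ℕ) ∧ (k : ℕ) < m + 1} u v :=
      fun h => h.mono fun k hk => ⟨hk.1, k.2⟩
    have hj' : ∀ {u v}, (groupFlags hσ).Conn {k | l ≤ (k : ℕ) ∧ (k : ℕ) < j} u v →
        (groupFlags hσ).Conn {k | 0 ≤ (k : ℕ) ∧ (k : ℕ) < j} u v :=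
      fun h => h.mono fun k hk => ⟨Nat.zero_le _, hk.2⟩
    exact hg.trans ((heven g h ((hl' hg).symm.trans (hs'.trans (hl' hh)))
      ((hj' hg).symm.trans (hp'.trans (hj' hh)))).trans hh.symm)
  · have hodd : ∀ g h : G,
        (groupFlags hσ).Conn {k | l ≤ (k : ℕ) ∧ (k : ℕ) < m + 1} (g, false) (h, true) →
        (groupFlags hσ).Conn {k | 0 ≤ (k : ℕ) ∧ (k : ℕ) < l} (g, false) (h, true) → False := by
      intro g h h1 h2
      have e1 := (groupFlags_mem_segment_of_conn hσ h1).2 rfl l le_rfl (by omega) hj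
      have e2 := (groupFlags_mem_segment_of_conn hσ h2).2 rfl 0 le_rfl (by omega) (by omega)
      rw [rot_zero_zero, mul_one] at e2
      exact hB l hl hj _ e2 e1
    obtain ⟨g, _ | _⟩ := x <;> obtain ⟨h, _ | _⟩ := y
    · exact heven g h hs' hp'
    · exact (hodd g h hs' hp').elim
    · exact (hodd h g hs'.symm hp'.symm).elim
    · have step : ∀ {K : Set (Fin (m + 1))} {k : Fin (m + 1)}, k ∈ K →
          (groupFlags hσ).Conn K (g, true) (h, true) →
          (groupFlags hσ).Conn K (g * rot σ 0 k, false) (h * rot σ 0 k, false) :=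
        fun {K k} hk hc => (Conn.step (M := groupFlags hσ) hk (g, true)).symm.trans
          (hc.trans (Conn.step hk _))
      have h1 := (groupFlags_mem_segment_of_conn hσ (step (k := ⟨l, by omega⟩)
        ⟨le_rfl, by simpa using hj⟩ hs')).1 rfl
      have h2 := (groupFlags_mem_segment_of_conn hσ (step (k := 0)
        ⟨le_rfl, by simpa using hl⟩ hp')).1 rfl
      simp only [Fin.val_zero, rot_zero_zero, mul_one] at h2
      have := hC l hl hj _ h2 (by simpa [mul_assoc] using h1)
      rw [inv_mul_eq_one] at this
      rw [this]
      exact Conn.refl _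

end ChiralPolytopes

namespace ChiralPolytopes

/-! ### The intersection property in rank five -/

variable {G : Type*} [Group G] {m : ℕ} {σ : Fin m → G}

theorem segment_mono {l l' j j' : ℕ} (hl : l' ≤ l) (hj : j ≤ j') :
    segment σ l j ≤ segment σ l' j' :=
  segment_le fun _ h1 h2 => mem_segment σ (hl.trans h1) (h2.trans_le hj)

theorem segment_eq_bot {l j : ℕ} (h : j ≤ l + 1) : segment σ l j = ⊥ :=
  eq_bot_iff.2 (segment_le fun _ h1 h2 => by omega)

theorem segment_eq_zpowers (i : Fin m) : segment σ i (i + 2) = Subgroup.zpowers (σ i) := by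
  rw [Subgroup.zpowers_eq_closure, segment]
  congr 1
  ext g
  constructor
  · rintro ⟨k, h1, h2, rfl⟩
    obtain rfl : k = i := Fin.ext (by omega)
    rfl
  · rintro rfl
    exact ⟨i, le_rfl, by omega, rfl⟩

/-- For i ≥ 2 the elements t_i, t_{i+1} and t_j are involutions, so t_j (t_i⁻¹ t_{i+1}) t_j⁻¹ =
(t_j⁻¹ t_i)(t_{i+1}⁻¹ t_j), a product of two elements of the segment. -/
theorem StringRel.conj_mem_segment (hσ : StringRel σ) {j : ℕ} (hj : 2 ≤ j) (hjm : j ≤ m) {g : G}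
    (hg : g ∈ segment σ j (m + 1)) :
    rot σ 0 j * g * (rot σ 0 j)⁻¹ ∈ segment σ j (m + 1) := by
  have : segment σ j (m + 1) ≤
      (segment σ j (m + 1)).comap (MulAut.conj (rot σ 0 j)).toMonoidHom := by
    refine segment_le fun i hi hi' => ?_
    change rot σ 0 j * σ i * (rot σ 0 j)⁻¹ ∈ segment σ j (m + 1)
    rw [← rot_step σ i]
    have e1 := hσ.inv_eq (b := j) (by omega) hjm
    have e2 := hσ.inv_eq (b := i) (by omega) (by omega)
    have e3 := hσ.inv_eq (b := i + 1) (by omega) (by omega)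
    have h := mul_mem (rot_mem_segment' σ le_rfl hi (show j < m + 1 by omega)
      (show (i : ℕ) < m + 1 by omega) hjm (by omega))
      (rot_mem_segment' σ (hi.trans (Nat.le_succ _)) le_rfl
      (show (i : ℕ) + 1 < m + 1 by omega) (show j < m + 1 by omega) (by omega) hjm)
    rw [e1, e3] at h
    rw [e2, e1]
    simpa [mul_assoc] using h
  exact this hg

/-- In rank five, the intersection property follows from five conditions on pairs of subgroups
generated by consecutive generators. -/
theorem chainIntersection_of_rank_five {σ : Fin 4 → G} (hσ : StringRel σ)
    (hne : ∀ i, σ i ≠ 1)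
    (h0 : segment σ 1 5 ⊓ segment σ 0 2 = ⊥)
    (h1 : segment σ 1 5 ⊓ segment σ 0 3 ≤ segment σ 1 3)
    (h2 : segment σ 1 5 ⊓ segment σ 0 4 ≤ segment σ 1 4)
    (h3 : segment σ 2 5 ⊓ segment σ 0 4 ≤ segment σ 2 4)
    (h4 : segment σ 3 5 ⊓ segment σ 0 4 = ⊥)
    (h5 : segment σ 1 3 ⊓ segment σ 2 4 = ⊥) :
    (groupFlags hσ).ChainIntersection := by
  have t1 : rot σ 0 1 = σ 0 := by simpa using rot_succ σ 0
  have t2 : rot σ 0 2 = σ 0 * σ 1 := by simpa [t1] using rot_succ σ 1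
  have t3 : rot σ 0 3 = σ 0 * σ 1 * σ 2 := by simpa [t2] using rot_succ σ 2
  have t4 : rot σ 0 4 = σ 0 * σ 1 * σ 2 * σ 3 := by simpa [t3] using rot_succ σ 3
  have m0 : ∀ j, 2 ≤ j → σ 0 ∈ segment σ 0 j := fun j hj =>
    mem_segment σ (i := (0 : Fin 4)) (by simp) (by simp; omega)
  have m1 : ∀ l j, l ≤ 1 → 3 ≤ j → σ 1 ∈ segment σ l j := fun l j hl hj =>
    mem_segment σ (i := (1 : Fin 4)) (by simpa using hl) (by simp; omega)
  have m2 : ∀ l j, l ≤ 2 → 4 ≤ j → σ 2 ∈ segment σ l j := fun l j hl hj =>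
    mem_segment σ (i := (2 : Fin 4)) (by simpa using hl) (by simp; omega)
  have m3 : ∀ l j, l ≤ 3 → 5 ≤ j → σ 3 ∈ segment σ l j := fun l j hl hj =>
    mem_segment σ (i := (3 : Fin 4)) (by simpa using hl) (by simp; omega)
  have mono : ∀ {l l' j j' : ℕ}, l' ≤ l → j ≤ j' → segment σ l j ≤ segment σ l' j' :=
    fun hl hj => segment_mono hl hj
  have e0 : ∀ u ∈ segment σ 0 2, u ∈ segment σ 1 5 → u = 1 := fun u hu hu' =>
    Subgroup.mem_bot.1 (h0 ▸ Subgroup.mem_inf.2 ⟨hu', hu⟩)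
  have e4 : ∀ u ∈ segment σ 0 4, u ∈ segment σ 3 5 → u = 1 := fun u hu hu' =>
    Subgroup.mem_bot.1 (h4 ▸ Subgroup.mem_inf.2 ⟨hu', hu⟩)
  have e5 : ∀ u ∈ segment σ 1 3, u ∈ segment σ 2 4 → u = 1 := fun u hu hu' =>
    Subgroup.mem_bot.1 (h5 ▸ Subgroup.mem_inf.2 ⟨hu, hu'⟩)
  -- An element of ⟨σ₁, σ₂⟩ ∩ ⟨σ₃, σ₄⟩ lies in ⟨σ₂⟩ by `h1` and in ⟨σ₃⟩ by `h3`, and these meet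
  -- trivially.
  have e23 : ∀ u ∈ segment σ 0 3, u ∈ segment σ 2 5 → u = 1 := fun u hu hu' =>
    e5 u (h1 ⟨mono (by omega) le_rfl hu', hu⟩) (h3 ⟨hu', mono le_rfl (by omega) hu⟩)
  have bot : ∀ {l j : ℕ} {u : G}, j ≤ l + 1 → u ∈ segment σ l j → u = 1 := fun h hu =>
    Subgroup.mem_bot.1 (segment_eq_bot (σ := σ) h ▸ hu)
  refine groupFlags_chainIntersection hσ ?_ ?_ ?_
  · rintro l j hl hlj hj u ⟨hu, hu'⟩
    rw [SetLike.mem_coe] at hu hu'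
    have key : ∀ {s : Subgroup G}, u = 1 → u ∈ s := fun h => h ▸ one_mem _
    obtain rfl | rfl | rfl | rfl : j = 1 ∨ j = 2 ∨ j = 3 ∨ j = 4 := by omega
    · exact key (bot (by omega) hu')
    · exact key (e0 u hu' (mono hl le_rfl hu))
    · obtain rfl | hl := hl.eq_or_lt
      · exact h1 ⟨hu, hu'⟩
      · exact key (e23 u hu' (mono (by omega) le_rfl hu))
    · obtain rfl | rfl | hl : l = 1 ∨ l = 2 ∨ 3 ≤ l := by omega
      · exact h2 ⟨hu, hu'⟩
      · exact h3 ⟨hu, hu'⟩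
      · exact key (e4 u hu' (mono hl le_rfl hu))
  · intro j hj hj' u hu h
    obtain rfl | rfl | rfl | rfl : j = 1 ∨ j = 2 ∨ j = 3 ∨ j = 4 := by omega
    · rw [bot (by omega) hu, one_mul, t1] at h
      exact hne 0 (e0 _ (m0 2 le_rfl) h)
    · rw [t2, ← mul_assoc] at h
      have h' := (Subgroup.mul_mem_cancel_right _ (m1 1 5 le_rfl (by omega))).1
        (mono (l' := 1) (by omega) le_rfl h)
      rw [e0 _ (mul_mem hu (m0 2 le_rfl)) h', one_mul] at h
      exact hne 1 (e23 _ (m1 0 3 (by omega) le_rfl) h)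
    · have hmem : u * rot σ 0 3 ∈ segment σ 0 4 := by
        rw [t3]
        exact mul_mem (mono le_rfl (by omega) hu) (mul_mem (mul_mem (m0 4 (by omega))
          (m1 0 4 (by omega) (by omega))) (m2 0 4 (by omega) le_rfl))
      have h' := e4 _ hmem h
      rw [t3, ← mul_assoc] at h'
      have h'' : σ 2 ∈ segment σ 0 3 := by
        rw [eq_inv_of_mul_eq_one_right h']
        exact inv_mem (mul_mem hu (mul_mem (m0 3 (by omega)) (m1 0 3 (by omega) le_rfl)))
      exact hne 2 (e23 _ h'' (m2 2 5 le_rfl (by omega)))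
    · have h' := bot (by omega) h
      rw [t4, ← mul_assoc] at h'
      have h'' : σ 3 ∈ segment σ 0 4 := by
        rw [eq_inv_of_mul_eq_one_right h']
        exact inv_mem (mul_mem hu (mul_mem (mul_mem (m0 4 (by omega)) (m1 0 4 (by omega) (by omega)))
          (m2 0 4 (by omega) le_rfl)))
      exact hne 3 (e4 _ h'' (m3 3 5 le_rfl le_rfl))
  · intro j hj hj' u hu h
    have hconj : 2 ≤ j → u ∈ segment σ j 5 := fun h2 => by
      simpa [mul_assoc] using hσ.conj_mem_segment h2 hj' h
    obtain rfl | rfl | rfl | rfl : j = 1 ∨ j = 2 ∨ j = 3 ∨ j = 4 := by omega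
    · exact bot (by omega) hu
    · exact e0 u hu (mono (by omega) le_rfl (hconj le_rfl))
    · exact e4 u (mono le_rfl (by omega) hu) (hconj (by omega))
    · exact bot (by omega) (hconj (by omega))

end ChiralPolytopes

namespace ChiralPolytopes

/-! ### The matrices and their orders -/

open Matrix

section matrices

variable {F : Type*} [Field F]

/-- The quotient map from `SL(3, F)` to `PSL(3, F)`. -/
abbrev toPSL : SpecialLinearGroup (Fin 3) F →* ProjectiveSpecialLinearGroup (Fin 3) F :=
  QuotientGroup.mk' _

theorem toPSL_surjective : Function.Surjective (toPSL (F := F)) := QuotientGroup.mk'_surjective _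

/-- A scalar matrix of determinant one. -/
def scalarSL (z : F) (hz : z ^ 3 = 1) : SpecialLinearGroup (Fin 3) F :=
  ⟨!![z, 0, 0; 0, z, 0; 0, 0, z], by simp [det_fin_three]; linear_combination hz⟩

theorem coe_scalarSL (z : F) (hz : z ^ 3 = 1) :
    (scalarSL z hz : Matrix (Fin 3) (Fin 3) F) = !![z, 0, 0; 0, z, 0; 0, 0, z] := rfl

theorem toPSL_eq_one_iff {A : SpecialLinearGroup (Fin 3) F} :
    toPSL A = 1 ↔ ∃ (z : F) (hz : z ^ 3 = 1), A = scalarSL z hz := by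
  rw [QuotientGroup.mk'_apply, QuotientGroup.eq_one_iff,
    Matrix.SpecialLinearGroup.mem_center_iff]
  refine exists_congr fun z => ?_
  have : scalar (Fin 3) z = !![z, 0, 0; 0, z, 0; 0, 0, z] := by
    ext i j
    fin_cases i <;> fin_cases j <;> simp
  rw [this]
  simp only [Fintype.card_fin]
  exact ⟨fun h => ⟨h.1, Subtype.ext h.2.symm⟩, fun ⟨h, h'⟩ => ⟨h, h' ▸ rfl⟩⟩

theorem toPSL_scalarSL (z : F) (hz : z ^ 3 = 1) : toPSL (scalarSL z hz) = 1 :=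
  toPSL_eq_one_iff.2 ⟨z, hz, rfl⟩

theorem toPSL_eq_iff {A B : SpecialLinearGroup (Fin 3) F} :
    toPSL A = toPSL B ↔ ∃ (z : F) (hz : z ^ 3 = 1), A = scalarSL z hz * B := by
  rw [← mul_inv_eq_one, ← map_inv, ← map_mul, toPSL_eq_one_iff]
  simp only [mul_inv_eq_iff_eq_mul]

theorem exists_of_toPSL_eq {A B : SpecialLinearGroup (Fin 3) F} (h : toPSL A = toPSL B) :
    ∃ z : F, z ^ 3 = 1 ∧ ∀ i j, A i j = z * B i j := by
  obtain ⟨z, hz, rfl⟩ := toPSL_eq_iff.1 h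
  refine ⟨z, hz, fun i j => ?_⟩
  rw [Matrix.SpecialLinearGroup.coe_mul, coe_scalarSL]
  fin_cases i <;> simp [Matrix.mul_apply, Fin.sum_univ_three]

variable (w : F) (hw : w ^ 3 = 1) (k : F)

theorem coe_sl1 : (sl1 w hw 1 : Matrix (Fin 3) (Fin 3) F) =
    !![1, 0, 0; 0, w, 0; 0, 0, w ^ 2] := by simp [sl1]

theorem coe_sl2 : (sl2 w hw k 1 : Matrix (Fin 3) (Fin 3) F) =
    !![-1, 0, -k; 0, -w ^ 2, -k * w ^ 2; 0, 0, w] := by simp [sl2]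

theorem coe_sl3 : (sl3 k : Matrix (Fin 3) (Fin 3) F) = !![1, k, 0; 0, k, 1; 0, -1, 0] := rfl

theorem coe_sl4 : (sl4 F : Matrix (Fin 3) (Fin 3) F) = !![0, 1, 0; 0, 0, 1; 1, 0, 0] := rfl

theorem sigma_eq (i : ℕ) (h : (w ^ i) ^ 3 = 1) : sigma w hw k i = sigma (w ^ i) h k 1 := by
  have h1 : sl1 w hw i = sl1 (w ^ i) h 1 := by
    refine Subtype.ext ?_
    rw [coe_sl1]
    simp only [sl1]
    rw [← pow_mul, mul_comm i 2]
  have h2 : sl2 w hw k i = sl2 (w ^ i) h k 1 := by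
    refine Subtype.ext ?_
    rw [coe_sl2]
    simp only [sl2]
    rw [← pow_mul, mul_comm i 2]
  rw [sigma, sigma, h1, h2]

theorem sigma_zero : sigma w hw k 1 0 = toPSL (sl1 w hw 1) := rfl
theorem sigma_one : sigma w hw k 1 1 = toPSL (sl2 w hw k 1) := rfl
theorem sigma_two : sigma w hw k 1 2 = toPSL (sl3 k) := rfl
theorem sigma_three : sigma w hw k 1 3 = toPSL (sl4 F) := rfl

variable {w k}

/-! ### Products of consecutive generators and the string property. -/

theorem sl1_mul_sl2 : (sl1 w hw 1 * sl2 w hw k 1 : Matrix.SpecialLinearGroup (Fin 3) F) =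
    (!![-1, 0, -k; 0, -1, -k; 0, 0, 1] : Matrix (Fin 3) (Fin 3) F) := by
  rw [Matrix.SpecialLinearGroup.coe_mul, coe_sl1, coe_sl2]
  ext i j
  fin_cases i <;> fin_cases j <;> simp [Matrix.mul_apply, Fin.sum_univ_three] <;> grind

theorem sl2_mul_sl3 : (sl2 w hw k 1 * sl3 k : Matrix.SpecialLinearGroup (Fin 3) F) =
    (!![-1, 0, 0; 0, 0, -w ^ 2; 0, -w, 0] : Matrix (Fin 3) (Fin 3) F) := by
  rw [Matrix.SpecialLinearGroup.coe_mul, coe_sl2, coe_sl3]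
  ext i j
  fin_cases i <;> fin_cases j <;> simp [Matrix.mul_apply, Fin.sum_univ_three] <;> ring

theorem sl3_mul_sl4 : (sl3 k * sl4 F : Matrix.SpecialLinearGroup (Fin 3) F) =
    (!![0, 1, k; 1, 0, k; 0, 0, -1] : Matrix (Fin 3) (Fin 3) F) := by
  rw [Matrix.SpecialLinearGroup.coe_mul, coe_sl3, coe_sl4]
  ext i j
  fin_cases i <;> fin_cases j <;> simp [Matrix.mul_apply, Fin.sum_univ_three]

theorem sl1_mul_sl2_mul_sl3 :
    (sl1 w hw 1 * sl2 w hw k 1 * sl3 k : Matrix.SpecialLinearGroup (Fin 3) F) =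
    (!![-1, 0, 0; 0, 0, -1; 0, -1, 0] : Matrix (Fin 3) (Fin 3) F) := by
  rw [Matrix.SpecialLinearGroup.coe_mul, sl1_mul_sl2, coe_sl3]
  ext i j
  fin_cases i <;> fin_cases j <;> simp [Matrix.mul_apply, Fin.sum_univ_three]

theorem sl2_mul_sl3_mul_sl4 :
    (sl2 w hw k 1 * sl3 k * sl4 F : Matrix.SpecialLinearGroup (Fin 3) F) =
    (!![0, -1, 0; -w ^ 2, 0, 0; 0, 0, -w] : Matrix (Fin 3) (Fin 3) F) := by
  rw [Matrix.SpecialLinearGroup.coe_mul, sl2_mul_sl3, coe_sl4]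
  ext i j
  fin_cases i <;> fin_cases j <;> simp [Matrix.mul_apply, Fin.sum_univ_three]

theorem sl1_mul_sl2_mul_sl3_mul_sl4 :
    (sl1 w hw 1 * sl2 w hw k 1 * sl3 k * sl4 F : Matrix.SpecialLinearGroup (Fin 3) F) =
    (!![0, -1, 0; -1, 0, 0; 0, 0, -1] : Matrix (Fin 3) (Fin 3) F) := by
  rw [Matrix.SpecialLinearGroup.coe_mul, sl1_mul_sl2_mul_sl3, coe_sl4]
  ext i j
  fin_cases i <;> fin_cases j <;> simp [Matrix.mul_apply, Fin.sum_univ_three]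

theorem toPSL_ne_one {A : SpecialLinearGroup (Fin 3) F} {i j : Fin 3} (hij : i ≠ j)
    (h : A i j ≠ 0) : toPSL A ≠ 1 := by
  intro h1
  rw [← map_one toPSL] at h1
  obtain ⟨z, _, hz⟩ := exists_of_toPSL_eq h1
  exact h (by rw [hz]; simp [hij])

theorem toPSL_eq_one {A : SpecialLinearGroup (Fin 3) F} (z : F) (hz : z ^ 3 = 1)
    (h : (A : Matrix (Fin 3) (Fin 3) F) = !![z, 0, 0; 0, z, 0; 0, 0, z]) : toPSL A = 1 :=
  toPSL_eq_one_iff.2 ⟨z, hz, Subtype.ext h⟩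

theorem orderOf_toPSL_eq_two {A : SpecialLinearGroup (Fin 3) F} {i j : Fin 3} (hij : i ≠ j)
    (h : A i j ≠ 0) (z : F) (hz : z ^ 3 = 1)
    (h2 : (A : Matrix (Fin 3) (Fin 3) F) * A = !![z, 0, 0; 0, z, 0; 0, 0, z]) :
    orderOf (toPSL A) = 2 := by
  refine orderOf_eq_prime ?_ (toPSL_ne_one hij h)
  rw [← map_pow, sq]
  exact toPSL_eq_one z hz (by rw [Matrix.SpecialLinearGroup.coe_mul, h2])

theorem rot_of_rank_five {G : Type*} [Group G] (σ : Fin 4 → G) :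
    rot σ 0 1 = σ 0 ∧ rot σ 0 2 = σ 0 * σ 1 ∧ rot σ 1 3 = σ 1 * σ 2 ∧ rot σ 2 4 = σ 2 * σ 3 ∧
    rot σ 0 3 = σ 0 * σ 1 * σ 2 ∧ rot σ 1 4 = σ 1 * σ 2 * σ 3 ∧
    rot σ 0 4 = σ 0 * σ 1 * σ 2 * σ 3 := by
  simp [rot, List.ofFn_succ, mul_assoc, show (1 : Fin 3).succ = 2 from rfl,
    show (2 : Fin 3).succ = 3 from rfl]

theorem sigma_string (hk : k ^ 2 = 1) (a b : ℕ) (hab : a + 1 < b) (hb : b ≤ 4) :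
    orderOf (rot (sigma w hw k 1) a b) = 2 := by
  obtain ⟨-, h02, h13, h24, h03, h14, h04⟩ := rot_of_rank_five (sigma w hw k 1)
  simp only [sigma_zero, sigma_one, sigma_two, sigma_three, ← map_mul] at h02 h13 h24 h03 h14 h04
  have hw0 : w ≠ 0 := by
    rintro rfl
    simp at hw
  have hk0 : k ≠ 0 := by
    rintro rfl
    simp at hk
  have hcases : (a = 0 ∧ b = 2) ∨ (a = 1 ∧ b = 3) ∨ (a = 2 ∧ b = 4) ∨ (a = 0 ∧ b = 3) ∨
    (a = 1 ∧ b = 4) ∨ (a = 0 ∧ b = 4) := by omega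
  rcases hcases with ⟨rfl, rfl⟩ | ⟨rfl, rfl⟩ | ⟨rfl, rfl⟩ | ⟨rfl, rfl⟩ | ⟨rfl, rfl⟩ | ⟨rfl, rfl⟩
  · rw [h02]
    refine orderOf_toPSL_eq_two (i := 0) (j := 2) (by decide) ?_ 1 (one_pow 3) ?_ <;>
      rw [sl1_mul_sl2]
    · simpa using hk0
    · ext i j
      fin_cases i <;> fin_cases j <;> simp [Matrix.mul_apply, Fin.sum_univ_three]
  · rw [h13]
    refine orderOf_toPSL_eq_two (i := 1) (j := 2) (by decide) ?_ 1 (one_pow 3) ?_ <;>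
      rw [sl2_mul_sl3]
    · simpa using hw0
    · ext i j
      fin_cases i <;> fin_cases j <;> simp [Matrix.mul_apply, Fin.sum_univ_three] <;> grind
  · rw [h24]
    refine orderOf_toPSL_eq_two (i := 0) (j := 1) (by decide) ?_ 1 (one_pow 3) ?_ <;>
      rw [sl3_mul_sl4]
    · simp
    · ext i j
      fin_cases i <;> fin_cases j <;> simp [Matrix.mul_apply, Fin.sum_univ_three]
  · rw [h03]
    refine orderOf_toPSL_eq_two (i := 1) (j := 2) (by decide) ?_ 1 (one_pow 3) ?_ <;>
      rw [sl1_mul_sl2_mul_sl3]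
    · simp
    · ext i j
      fin_cases i <;> fin_cases j <;> simp [Matrix.mul_apply, Fin.sum_univ_three]
  · rw [h14]
    -- The square of σ₂σ₃σ₄ is the scalar w², so this is an involution only after passing to PSL.
    refine orderOf_toPSL_eq_two (i := 0) (j := 1) (by decide) ?_ (w ^ 2) (by grind) ?_ <;>
      rw [sl2_mul_sl3_mul_sl4]
    · simp
    · ext i j
      fin_cases i <;> fin_cases j <;> simp [Matrix.mul_apply, Fin.sum_univ_three] <;> grind
  · rw [h04]
    refine orderOf_toPSL_eq_two (i := 0) (j := 1) (by decide) ?_ 1 (one_pow 3) ?_ <;>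
      rw [sl1_mul_sl2_mul_sl3_mul_sl4]
    · simp
    · ext i j
      fin_cases i <;> fin_cases j <;> simp [Matrix.mul_apply, Fin.sum_univ_three]

/-! ### Orders of the generators. -/

theorem orderOf_eq_six {G : Type*} [Group G] {g : G} (h6 : g ^ 6 = 1) (h2 : g ^ 2 ≠ 1)
    (h3 : g ^ 3 ≠ 1) : orderOf g = 6 := by
  refine orderOf_eq_of_pow_and_pow_div_prime (by norm_num) h6 fun p hp hdvd => ?_
  have : p ∣ 2 * 3 := hdvd
  rcases hp.dvd_mul.1 this with h | h
  · rw [(Nat.prime_dvd_prime_iff_eq hp Nat.prime_two).1 h]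
    exact h3
  · rw [(Nat.prime_dvd_prime_iff_eq hp Nat.prime_three).1 h]
    exact h2

theorem coe_sl2_sq (hw1 : w ^ 2 + w + 1 = 0) :
    (sl2 w hw k 1 ^ 2 : Matrix.SpecialLinearGroup (Fin 3) F) =
    (!![1, 0, k * (1 - w); 0, w, k * (w - 1); 0, 0, w ^ 2] : Matrix (Fin 3) (Fin 3) F) := by
  rw [sq, Matrix.SpecialLinearGroup.coe_mul, coe_sl2]
  ext i j
  fin_cases i <;> fin_cases j <;> simp [Matrix.mul_apply, Fin.sum_univ_three] <;> grind

theorem coe_sl2_cube (hw1 : w ^ 2 + w + 1 = 0) :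
    (sl2 w hw k 1 ^ 3 : Matrix.SpecialLinearGroup (Fin 3) F) =
    (!![-1, 0, 2 * k * w; 0, -1, 2 * k * w ^ 2; 0, 0, 1] : Matrix (Fin 3) (Fin 3) F) := by
  rw [pow_succ, Matrix.SpecialLinearGroup.coe_mul, coe_sl2_sq hw hw1, coe_sl2]
  ext i j
  fin_cases i <;> fin_cases j <;> simp [Matrix.mul_apply, Fin.sum_univ_three] <;> grind

theorem sl2_pow_six (hw1 : w ^ 2 + w + 1 = 0) : sl2 w hw k 1 ^ 6 = 1 := by
  rw [show 6 = 3 * 2 from rfl, pow_mul, sq]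
  refine Subtype.ext ?_
  rw [Matrix.SpecialLinearGroup.coe_mul, coe_sl2_cube hw hw1]
  ext i j
  fin_cases i <;> fin_cases j <;> simp [Matrix.mul_apply, Fin.sum_univ_three]

theorem orderOf_sigma_zero (hw1 : w ≠ 1) : orderOf (sigma w hw k 1 0) = 3 := by
  have : Fact (Nat.Prime 3) := ⟨Nat.prime_three⟩
  rw [sigma_zero]
  refine orderOf_eq_prime ?_ fun h => ?_
  · rw [← map_pow]
    refine toPSL_eq_one 1 (one_pow 3) ?_
    rw [Matrix.SpecialLinearGroup.coe_pow, coe_sl1, pow_succ, sq]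
    ext i j
    fin_cases i <;> fin_cases j <;> simp [Matrix.mul_apply, Fin.sum_univ_three] <;> grind
  · rw [← map_one toPSL] at h
    obtain ⟨z, _, hz⟩ := exists_of_toPSL_eq h
    have h0 := hz 0 0
    have h1 := hz 1 1
    simp only [coe_sl1] at h0 h1
    simp at h0 h1
    exact hw1 (h1.trans h0.symm)

theorem orderOf_sigma_one (hw1 : w ^ 2 + w + 1 = 0) (h3 : (3 : F) ≠ 0) (h2 : (2 : F) ≠ 0)
    (hk : k ^ 2 = 1) : orderOf (sigma w hw k 1 1) = 6 := by
  have hk0 : k ≠ 0 := by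
    rintro rfl
    simp at hk
  have hw0 : w ≠ 0 := by
    rintro rfl
    simp at hw
  rw [sigma_one]
  refine orderOf_eq_six ?_ ?_ ?_
  · rw [← map_pow, sl2_pow_six hw hw1, map_one]
  · rw [← map_pow]
    refine toPSL_ne_one (i := 0) (j := 2) (by decide) ?_
    rw [coe_sl2_sq hw hw1]
    simp only [of_apply, cons_val', cons_val_zero, cons_val, ne_eq, mul_eq_zero, hk0, false_or]
    intro h
    apply h3
    grind
  · rw [← map_pow]
    refine toPSL_ne_one (i := 0) (j := 2) (by decide) ?_
    rw [coe_sl2_cube hw hw1]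
    simp [hk0, hw0, h2]

theorem orderOf_sigma_three : orderOf (sigma w hw k 1 3) = 3 := by
  have : Fact (Nat.Prime 3) := ⟨Nat.prime_three⟩
  rw [sigma_three]
  refine orderOf_eq_prime ?_ (toPSL_ne_one (i := 0) (j := 1) (by decide) (by simp [coe_sl4]))
  rw [← map_pow]
  refine toPSL_eq_one 1 (one_pow 3) ?_
  rw [Matrix.SpecialLinearGroup.coe_pow, coe_sl4, pow_succ, sq]
  ext i j
  fin_cases i <;> fin_cases j <;> simp [Matrix.mul_apply, Fin.sum_univ_three]

theorem orderOf_sigma_two_of_one (h2 : (2 : F) ≠ 0) : orderOf (sigma w hw 1 1 2) = 6 := by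
  rw [sigma_two]
  have hsq : ((sl3 1 ^ 2 : Matrix.SpecialLinearGroup (Fin 3) F) : Matrix (Fin 3) (Fin 3) F) =
      !![1, 2, 1; 0, 0, 1; 0, -1, -1] := by
    rw [Matrix.SpecialLinearGroup.coe_pow, coe_sl3, sq]
    ext i j
    fin_cases i <;> fin_cases j <;> simp [Matrix.mul_apply, Fin.sum_univ_three] <;> norm_num
  have hcube : ((sl3 1 ^ 3 : Matrix.SpecialLinearGroup (Fin 3) F) : Matrix (Fin 3) (Fin 3) F) =
      !![1, 2, 2; 0, -1, 0; 0, 0, -1] := by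
    rw [pow_succ, Matrix.SpecialLinearGroup.coe_mul, hsq, coe_sl3]
    ext i j
    fin_cases i <;> fin_cases j <;> simp [Matrix.mul_apply, Fin.sum_univ_three]
  refine orderOf_eq_six ?_ ?_ ?_
  · rw [← map_pow, show 6 = 3 * 2 from rfl, pow_mul, sq]
    refine toPSL_eq_one 1 (one_pow 3) ?_
    rw [Matrix.SpecialLinearGroup.coe_mul, hcube]
    ext i j
    fin_cases i <;> fin_cases j <;> simp [Matrix.mul_apply, Fin.sum_univ_three]
  · rw [← map_pow]
    exact toPSL_ne_one (i := 1) (j := 2) (by decide) (by simp [hsq])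
  · rw [← map_pow]
    exact toPSL_ne_one (i := 0) (j := 1) (by decide) (by simp [hcube, h2])

theorem orderOf_sigma_two_of_neg_one : orderOf (sigma w hw (-1) 1 2) = 3 := by
  have : Fact (Nat.Prime 3) := ⟨Nat.prime_three⟩
  rw [sigma_two]
  refine orderOf_eq_prime ?_ (toPSL_ne_one (i := 1) (j := 2) (by decide) (by simp [coe_sl3]))
  rw [← map_pow]
  refine toPSL_eq_one 1 (one_pow 3) ?_
  rw [Matrix.SpecialLinearGroup.coe_pow, coe_sl3, pow_succ, sq]
  ext i j
  fin_cases i <;> fin_cases j <;> simp [Matrix.mul_apply, Fin.sum_univ_three]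

/-! ### Generation -/

/-- The monomial Weyl element n(a) of the SL₂ on coordinates i, j. It serves to obtain the diagonal
matrices as n(a) n(-1), so that transvections alone generate. -/
theorem transvection_triple {i j : Fin 3} (hij : i ≠ j) {a : F} (ha : a ≠ 0) :
    Matrix.transvection i j a * Matrix.transvection j i (-a⁻¹) * Matrix.transvection i j a =
      Matrix.of fun s t => if s = i then (if t = j then a else 0) else
        if s = j then (if t = i then -a⁻¹ else 0) else if s = t then 1 else 0 := by
  simp only [Matrix.transvection]
  ext s t
  fin_cases i <;> fin_cases j <;> first | exact absurd rfl hij | skip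
  all_goals
    fin_cases s <;> fin_cases t <;>
    simp [Matrix.mul_apply, Fin.sum_univ_three, Matrix.single_apply, Matrix.one_apply, ha]

theorem diag2n_mem {H : Subgroup (Matrix.SpecialLinearGroup (Fin 3) F)}
    (hH : ∀ (i j : Fin 3) (hij : i ≠ j) (x : F), Matrix.SpecialLinearGroup.transvection hij x ∈ H)
    {i j : Fin 3} (hij : i ≠ j) {a : F} (ha : a ≠ 0) :
    Matrix.SpecialLinearGroup.diag2n hij a ha ∈ H := by
  let n (a : F) : Matrix.SpecialLinearGroup (Fin 3) F :=
    Matrix.SpecialLinearGroup.transvection hij a *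
      Matrix.SpecialLinearGroup.transvection hij.symm (-a⁻¹) *
      Matrix.SpecialLinearGroup.transvection hij a
  have hn : ∀ a : F, n a ∈ H := fun a => mul_mem (mul_mem (hH _ _ _ _) (hH _ _ _ _)) (hH _ _ _ _)
  have : Matrix.SpecialLinearGroup.diag2n hij a ha = n a * n (-1) := by
    refine Subtype.ext ?_
    have h1 := transvection_triple hij ha
    have h2 := transvection_triple hij (a := (-1 : F)) (by simp)
    refine Eq.trans ?_ (congrArg₂ (· * ·) h1 h2).symm
    rw [Matrix.SpecialLinearGroup.diag2n_coe]
    ext s t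
    fin_cases i <;> fin_cases j <;> first | exact absurd rfl hij | skip
    all_goals
      fin_cases s <;> fin_cases t <;> simp [Matrix.mul_apply, Fin.sum_univ_three]
  rw [this]
  exact mul_mem (hn _) (hn _)

theorem eq_top_of_transvection_mem {H : Subgroup (Matrix.SpecialLinearGroup (Fin 3) F)}
    (hH : ∀ (i j : Fin 3) (hij : i ≠ j) (x : F),
      Matrix.SpecialLinearGroup.transvection hij x ∈ H) : H = ⊤ :=
  eq_top_iff.2 fun A _ => Matrix.SpecialLinearGroup.diagonal_transvection_induction' (· ∈ H) A
    (fun _ _ hij _ hc => diag2n_mem hH hij hc) hH fun _ _ => mul_mem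

/-- A unipotent matrix. -/
def unip (x y : F) : SpecialLinearGroup (Fin 3) F :=
  ⟨!![1, 0, x; 0, 1, y; 0, 0, 1], by simp [det_fin_three]⟩

theorem coe_unip (x y : F) : (unip x y : Matrix (Fin 3) (Fin 3) F) =
    !![1, 0, x; 0, 1, y; 0, 0, 1] := rfl

theorem unip_add (x y x' y' : F) : unip (x + x') (y + y') = unip x y * unip x' y' := by
  refine Subtype.ext ?_
  rw [Matrix.SpecialLinearGroup.coe_mul]
  simp only [coe_unip]
  ext i j
  fin_cases i <;> fin_cases j <;> simp [Matrix.mul_apply, Fin.sum_univ_three] <;> ring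

theorem sl1_mul_unip (x y : F) :
    sl1 w hw 1 * unip x y = unip (w * x) (w ^ 2 * y) * sl1 w hw 1 := by
  refine Subtype.ext ?_
  rw [Matrix.SpecialLinearGroup.coe_mul, Matrix.SpecialLinearGroup.coe_mul]
  simp only [coe_unip, coe_sl1]
  ext i j
  fin_cases i <;> fin_cases j <;> simp [Matrix.mul_apply, Fin.sum_univ_three] <;> grind

/-- The commutator of σ₁ with the involution σ₁σ₂ is unipotent; this is the source of all
transvections in the generation argument. -/
theorem sl1_mul_sl1_mul_sl2 :
    sl1 w hw 1 * (sl1 w hw 1 * sl2 w hw k 1) =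
      unip (k * (1 - w)) (k * (1 - w ^ 2)) * (sl1 w hw 1 * sl2 w hw k 1) * sl1 w hw 1 := by
  refine Subtype.ext ?_
  rw [Matrix.SpecialLinearGroup.coe_mul, Matrix.SpecialLinearGroup.coe_mul _ (sl1 w hw 1),
    Matrix.SpecialLinearGroup.coe_mul (unip _ _)]
  simp only [coe_unip, coe_sl1, sl1_mul_sl2]
  ext i j
  fin_cases i <;> fin_cases j <;> simp [Matrix.mul_apply, Fin.sum_univ_three] <;> grind

theorem sl4_mul_transvection {i j : Fin 3} (hij : i ≠ j) (x : F) :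
    sl4 F * Matrix.SpecialLinearGroup.transvection hij x =
      Matrix.SpecialLinearGroup.transvection (show i + 2 ≠ j + 2 by simpa using hij) x * sl4 F := by
  refine Subtype.ext ?_
  rw [Matrix.SpecialLinearGroup.coe_mul, Matrix.SpecialLinearGroup.coe_mul]
  simp only [Matrix.SpecialLinearGroup.transvection_coe, coe_sl4]
  ext s t
  fin_cases i <;> fin_cases j <;> first | exact absurd rfl hij | skip
  all_goals
    fin_cases s <;> fin_cases t <;>
    simp [Matrix.mul_apply, Fin.sum_univ_three, Matrix.single_apply, Matrix.one_apply]

/-- Conjugation by σ₁ acts on `unip x y` with the distinct eigenvalues w and w², so the subgroup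
generated by the conjugates of one element with both coordinates nonzero contains each coordinate
line. Conjugation by σ₄ carries these two root groups to the remaining four. -/
theorem sl_generate (hF : ∀ x y : F, x ≠ 0 → ∃ n : ℕ, y = n * x) (hw1 : w ^ 2 + w + 1 = 0)
    (h3 : (3 : F) ≠ 0) (hk : k ^ 2 = 1) {H : Subgroup (Matrix.SpecialLinearGroup (Fin 3) F)}
    (m1 : sl1 w hw 1 ∈ H) (m2 : sl2 w hw k 1 ∈ H) (m4 : sl4 F ∈ H) : H = ⊤ := by
  have hk0 : k ≠ 0 := by
    rintro rfl
    simp at hk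
  have hw0 : w ≠ 0 := by
    rintro rfl
    simp at hw
  have hone : w - 1 ≠ 0 := fun h => h3 (by grind)
  have hneg : w + 1 ≠ 0 := fun h => hw0 (by grind)
  have hadd : ∀ {x y x' y'}, unip x y ∈ H → unip x' y' ∈ H → unip (x + x') (y + y') ∈ H :=
    fun h h' => by
      rw [unip_add]
      exact mul_mem h h'
  have hzero : unip (0 : F) 0 ∈ H := by
    have : unip (0 : F) 0 = 1 := by
      refine Subtype.ext ?_
      rw [coe_unip]
      ext i j
      fin_cases i <;> fin_cases j <;> simp
    rw [this]
    exact one_mem H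
  have hmul : ∀ {x y} (n : ℕ), unip x y ∈ H → unip (n * x) (n * y) ∈ H := fun {x y} n h => by
    induction n with
    | zero => simpa using hzero
    | succ n ih =>
      have := hadd ih h
      convert this using 2 <;> push_cast <;> ring
  have hneg' : ∀ {x y}, unip x y ∈ H → unip (-x) (-y) ∈ H := fun {x y} h => by
    obtain ⟨n, hn⟩ := hF 1 (-1) one_ne_zero
    have := hmul n h
    rw [mul_one] at hn
    rw [← hn] at this
    simpa using this
  have hconj : ∀ {x y}, unip x y ∈ H → unip (w * x) (w ^ 2 * y) ∈ H := fun {x y} h => by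
    rw [eq_mul_inv_of_mul_eq (sl1_mul_unip hw x y).symm]
    exact mul_mem (mul_mem m1 h) (inv_mem m1)
  have hbase : unip (k * (1 - w)) (k * (1 - w ^ 2)) ∈ H := by
    have h := sl1_mul_sl1_mul_sl2 (k := k) hw
    rw [mul_assoc] at h
    rw [eq_mul_inv_of_mul_eq h.symm]
    have := mul_mem m1 m2
    exact mul_mem (mul_mem m1 this) (inv_mem (mul_mem this m1))
  have hy : ∀ y, unip 0 y ∈ H := by
    obtain ⟨n, hn⟩ := hF 1 (-w) one_ne_zero
    rw [mul_one] at hn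
    -- The natural number `n` represents -w, so the first coordinates cancel while the second
    -- retains the factor w² - w ≠ 0.
    have h := hadd (hmul n hbase) (hconj hbase)
    rw [← hn] at h
    intro y
    obtain ⟨m, hm⟩ := hF ((w ^ 2 - w) * (k * (1 - w ^ 2))) y (mul_ne_zero
      (by rw [show w ^ 2 - w = w * (w - 1) by ring]; exact mul_ne_zero hw0 hone)
      (mul_ne_zero hk0 (by
        rw [show 1 - w ^ 2 = -((w - 1) * (w + 1)) by ring]
        exact neg_ne_zero.2 (mul_ne_zero hone hneg))))
    have h' := hmul m h
    convert h' using 2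
    · ring
    · rw [hm]
      ring
  have hx : ∀ x, unip x 0 ∈ H := by
    intro x
    obtain ⟨m, hm⟩ := hF (k * (1 - w)) x (mul_ne_zero hk0 (by rwa [← neg_ne_zero, neg_sub]))
    have h := hmul m (hadd hbase (hy (-(k * (1 - w ^ 2)))))
    convert h using 2
    · rw [hm]
      ring
    · ring
  have hrot : ∀ {i j : Fin 3} (hij : i ≠ j) (x : F),
      Matrix.SpecialLinearGroup.transvection hij x ∈ H →
      Matrix.SpecialLinearGroup.transvection (show i + 2 ≠ j + 2 by simpa using hij) x ∈ H :=
    fun hij x h => by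
      rw [eq_mul_inv_of_mul_eq (sl4_mul_transvection hij x).symm]
      exact mul_mem (mul_mem m4 h) (inv_mem m4)
  have h02 : ∀ x : F, Matrix.SpecialLinearGroup.transvection (show (0 : Fin 3) ≠ 2 by decide) x ∈
      H := fun x => by
    convert hx x
    refine Subtype.ext ?_
    rw [Matrix.SpecialLinearGroup.transvection_coe, coe_unip]
    ext i j
    fin_cases i <;> fin_cases j <;> simp
  have h12 : ∀ x : F, Matrix.SpecialLinearGroup.transvection (show (1 : Fin 3) ≠ 2 by decide) x ∈
      H := fun x => by
    convert hy x
    refine Subtype.ext ?_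
    rw [Matrix.SpecialLinearGroup.transvection_coe, coe_unip]
    ext i j
    fin_cases i <;> fin_cases j <;> simp
  refine eq_top_of_transvection_mem fun i j hij x => ?_
  fin_cases i <;> fin_cases j <;> first | exact absurd rfl hij | skip
  · exact hrot _ x (h12 x)
  · exact h02 x
  · exact hrot _ x (hrot _ x (h02 x))
  · exact h12 x
  · exact hrot _ x (hrot _ x (h12 x))
  · exact hrot _ x (h02 x)

theorem sigma_generate (hF : ∀ x y : F, x ≠ 0 → ∃ n : ℕ, y = n * x) (hw1 : w ^ 2 + w + 1 = 0)
    (h3 : (3 : F) ≠ 0) (hk : k ^ 2 = 1) :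
    Subgroup.closure (Set.range (sigma w hw k 1)) = ⊤ := by
  have h := sl_generate hw hF hw1 h3 hk
    (H := (Subgroup.closure (Set.range (sigma w hw k 1))).comap toPSL)
    (Subgroup.subset_closure ⟨0, rfl⟩) (Subgroup.subset_closure ⟨1, rfl⟩)
    (Subgroup.subset_closure ⟨3, rfl⟩)
  rw [eq_top_iff]
  intro g _
  obtain ⟨A, rfl⟩ := toPSL_surjective g
  have : A ∈ (⊤ : Subgroup (Matrix.SpecialLinearGroup (Fin 3) F)) := trivial
  rw [← h] at this
  exact this

end matrices

end ChiralPolytopes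

namespace ChiralPolytopes

/-! ### Stabilizers -/

/-! ### Auxiliary facts on abstract groups. -/

section groups

variable {G : Type*} [Group G]

theorem zpowers_inf_eq_bot {g : G} (hg : g ^ 3 = 1) {H : Subgroup G} (h : g ∉ H) :
    H ⊓ Subgroup.zpowers g = ⊥ := by
  rw [eq_bot_iff]
  rintro u ⟨hu, n, rfl⟩
  rw [SetLike.mem_coe] at hu
  have hn : g ^ n = g ^ (n % 3) := by
    conv_lhs => rw [← Int.emod_add_mul_ediv n 3, zpow_add, zpow_mul]
    norm_cast
    simp [hg]
  dsimp only at hu ⊢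
  rw [Subgroup.mem_bot]
  rw [hn] at hu ⊢
  have : n % 3 = 0 ∨ n % 3 = 1 ∨ n % 3 = 2 := by omega
  rcases this with e | e | e <;> rw [e] at hu ⊢
  · simp
  · exact absurd (by simpa using hu) h
  · refine absurd ?_ h
    have h4 : g ^ (2 : ℤ) * g ^ (2 : ℤ) = g := by
      have : g ^ (4 : ℕ) = g := by rw [pow_succ, hg, one_mul]
      rw [← zpow_add]
      exact_mod_cast this
    rw [← h4]
    exact mul_mem hu hu

/-- A common element is a power of `g` that commutes with `h`. Every nontrivial power of `g` has g²
or g³ among its own powers, which the hypotheses exclude. -/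
theorem zpowers_inf_zpowers_eq_bot {g h : G} (hg : g ^ 6 = 1) (h2 : ¬ Commute (g ^ 2) h)
    (h3 : ¬ Commute (g ^ 3) h) : Subgroup.zpowers g ⊓ Subgroup.zpowers h = ⊥ := by
  rw [eq_bot_iff]
  rintro u ⟨⟨n, rfl⟩, ⟨m, hm⟩⟩
  dsimp only at hm
  have hc : Commute (g ^ n) h := by
    rw [← hm]
    exact (Commute.refl h).zpow_left m
  have hmod : g ^ n = g ^ (n % 6) := by
    conv_lhs => rw [← Int.emod_add_mul_ediv n 6, zpow_add, zpow_mul]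
    norm_cast
    simp [hg]
  have key : ∀ (r s : ℕ), g ^ n = g ^ r → Commute (g ^ (r * s)) h := fun r s e => by
    rw [pow_mul, ← e]
    exact hc.pow_left s
  have hred : ∀ r s : ℕ, r % 6 = s % 6 → g ^ r = g ^ s := fun r s e => by
    rw [pow_eq_pow_mod r hg, pow_eq_pow_mod s hg, e]
  obtain ⟨r, hr, hr6⟩ : ∃ r : ℕ, n % 6 = r ∧ r < 6 := ⟨(n % 6).toNat, by omega, by omega⟩
  rw [hr, zpow_natCast] at hmod
  dsimp only
  rw [Subgroup.mem_bot, hmod]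
  interval_cases r
  · simp
  · exact absurd (key 1 2 hmod) h2
  · exact absurd (key 2 1 hmod) h2
  · exact absurd (key 3 1 hmod) h3
  · refine absurd ?_ h2
    rw [hred 2 (4 * 2) rfl]
    exact key 4 2 hmod
  · refine absurd ?_ h2
    rw [hred 2 (5 * 4) rfl]
    exact key 5 4 hmod

/-- The elements of a group generated by `a`, `b` with `a³ = b³ = (ab)² = 1`. -/
theorem exists_of_mem_closure_pair {a b u : G} (ha : a ^ 3 = 1) (hb : b ^ 3 = 1)
    (hab : a * b * (a * b) = 1) (hu : u ∈ Subgroup.closure {a, b}) :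
    ∃ j : ℕ, u = a ^ j ∨ u = b * a ^ j ∨ u = b ^ 2 * a ^ j ∨ u = a * b ^ 2 * a ^ j := by
  have hainv : a⁻¹ = a ^ 2 := inv_eq_of_mul_eq_one_right (by rw [← pow_succ', ha])
  have hbinv : b⁻¹ = b ^ 2 := inv_eq_of_mul_eq_one_right (by rw [← pow_succ', hb])
  have e1 : a * b = b ^ 2 * a ^ 2 := by
    rw [← hainv, ← hbinv, ← mul_inv_rev]
    exact eq_inv_of_mul_eq_one_left hab
  have e2 : b * a = a ^ 2 * b ^ 2 := by
    rw [← hainv, ← hbinv, ← mul_inv_rev]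
    refine eq_inv_of_mul_eq_one_left ?_
    have h := congrArg (fun x => a⁻¹ * x * a) hab
    simpa [mul_assoc] using h
  -- The four forms are the cosets of ⟨a⟩ with representatives 1, b, b², ab². It is enough that left
  -- multiplication by a and by b permutes the list.
  have hA : ∀ u : G,
      (∃ j : ℕ, u = a ^ j ∨ u = b * a ^ j ∨ u = b ^ 2 * a ^ j ∨ u = a * b ^ 2 * a ^ j) →
      ∃ j : ℕ, a * u = a ^ j ∨ a * u = b * a ^ j ∨ a * u = b ^ 2 * a ^ j ∨
        a * u = a * b ^ 2 * a ^ j := by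
    rintro _ ⟨j, rfl | rfl | rfl | rfl⟩
    · exact ⟨j + 1, Or.inl (pow_succ' a j).symm⟩
    · refine ⟨2 + j, Or.inr (Or.inr (Or.inl ?_))⟩
      rw [← mul_assoc, e1, pow_add, mul_assoc]
    · exact ⟨j, Or.inr (Or.inr (Or.inr (mul_assoc _ _ _).symm))⟩
    · refine ⟨j + 1, Or.inr (Or.inl ?_)⟩
      rw [← mul_assoc, ← mul_assoc, ← sq, ← e2, pow_succ', mul_assoc]
  have hB : ∀ u : G,
      (∃ j : ℕ, u = a ^ j ∨ u = b * a ^ j ∨ u = b ^ 2 * a ^ j ∨ u = a * b ^ 2 * a ^ j) →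
      ∃ j : ℕ, b * u = a ^ j ∨ b * u = b * a ^ j ∨ b * u = b ^ 2 * a ^ j ∨
        b * u = a * b ^ 2 * a ^ j := by
    rintro _ ⟨j, rfl | rfl | rfl | rfl⟩
    · exact ⟨j, Or.inr (Or.inl rfl)⟩
    · refine ⟨j, Or.inr (Or.inr (Or.inl ?_))⟩
      rw [← mul_assoc, sq]
    · refine ⟨j, Or.inl ?_⟩
      rw [← mul_assoc, ← pow_succ', hb, one_mul]
    · refine ⟨2 + j, Or.inr (Or.inr (Or.inr ?_))⟩
      calc b * (a * b ^ 2 * a ^ j) = b * a * b ^ 2 * a ^ j := by simp only [mul_assoc]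
        _ = a ^ 2 * (b ^ 3 * b) * a ^ j := by
          rw [e2]
          simp only [mul_assoc, pow_succ, pow_zero, one_mul]
        _ = a * (a * b) * a ^ j := by
          rw [hb, one_mul, sq, mul_assoc a a b]
        _ = a * b ^ 2 * a ^ (2 + j) := by
          rw [e1, pow_add]
          simp only [mul_assoc]
  induction hu using Subgroup.closure_induction_left with
  | one => exact ⟨0, Or.inl (pow_zero a).symm⟩
  | mul_left x hx y _ ih =>
    rcases hx with rfl | rfl
    · exact hA _ ih
    · exact hB _ ih
  | inv_mul_cancel x hx y _ ih =>
    rcases hx with e | e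
    · rw [e, hainv, show a ^ 2 * y = a * (a * y) by rw [sq, mul_assoc]]
      exact hA _ (hA _ ih)
    · rw [e, hbinv, show b ^ 2 * y = b * (b * y) by rw [sq, mul_assoc]]
      exact hB _ (hB _ ih)

/-- If conjugation by `a` has the same effect `x ↦ xᴺ` on a word in `a`, `b` and on the
corresponding word in the inverses, and this effect is not involutory, then no automorphism inverts
`a` and `b`. -/
theorem no_inverting_hom {a b u u' : G} {N : ℕ} (W : FreeGroup Bool)
    (hu : FreeGroup.lift (fun e => bif e then a else b) W = u)
    (hu' : FreeGroup.lift (fun e => bif e then a⁻¹ else b⁻¹) W = u')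
    (h1 : a * u * a⁻¹ = u ^ N) (h2 : a * u' * a⁻¹ = u' ^ N) (h3 : u' ^ (N * N) ≠ u')
    (ψ : G →* G) (ha : ψ a = a⁻¹) (hb : ψ b = b⁻¹) : False := by
  have hψ : ψ u = u' := by
    rw [← hu, ← hu', ← MonoidHom.comp_apply]
    congr 1
    ext e
    cases e <;> simp [ha, hb]
  have h4 := congrArg ψ h1
  rw [map_mul, map_mul, map_inv, map_pow, hψ, ha, inv_inv] at h4
  apply h3
  -- Applying ψ to `h1` gives a⁻¹u'a = u'^N, so conjugation by a undoes the N-th power map on u',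
  -- while by `h2` it equals that map.
  calc u' ^ (N * N) = (u' ^ N) ^ N := pow_mul _ _ _
    _ = a * (u' ^ N) * a⁻¹ := by rw [← h2, conj_pow, h2]
    _ = u' := by
      rw [← h4]
      group

/-- An automorphism that violates the chirality condition gives one that inverts `σ₂` and `σ₃`. -/
theorem exists_inverting_hom {σ : Fin 4 → G} (hσ : StringRel σ) (φ : G ≃* G)
    (h1 : φ (rot σ 0 1) = (rot σ 0 1)⁻¹)
    (h2 : ∀ b : ℕ, 2 ≤ b → b ≤ 4 → φ (rot σ 0 b) = rot σ 0 b) :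
    ∃ ψ : G →* G, ψ (σ 1) = (σ 1)⁻¹ ∧ ψ (σ 2) = (σ 2)⁻¹ := by
  have e1 : (rot σ 0 1)⁻¹ * rot σ 0 2 = σ 1 := rot_step σ 1
  have e2 : (rot σ 0 2)⁻¹ * rot σ 0 3 = σ 2 := rot_step σ 2
  have i2 := hσ.inv_eq (b := 2) (by norm_num) (by norm_num)
  have i3 := hσ.inv_eq (b := 3) (by norm_num) (by norm_num)
  -- With t_j = `rot σ 0 j` and t₂, t₃ involutions, φ sends σ₂ = t₁⁻¹t₂ to t₁t₂ and fixes σ₃ = t₂t₃.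
  -- Conjugation by t₂ turns these into t₂t₁ = σ₂⁻¹ and t₃t₂ = σ₃⁻¹.
  refine ⟨((MulAut.conj (rot σ 0 2)).toMonoidHom).comp φ.toMonoidHom, ?_, ?_⟩
  · change rot σ 0 2 * φ (σ 1) * (rot σ 0 2)⁻¹ = _
    rw [← e1, map_mul, map_inv, h1, h2 2 le_rfl (by norm_num), inv_inv, mul_inv_rev, inv_inv, i2]
    have : rot σ 0 2 * rot σ 0 2 = 1 := by
      nth_rw 1 [← i2]
      exact inv_mul_cancel _
    simp only [mul_assoc, this, mul_one]
  · change rot σ 0 2 * φ (σ 2) * (rot σ 0 2)⁻¹ = _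
    rw [← e2, map_mul, map_inv, h2 2 le_rfl (by norm_num), h2 3 (by norm_num) (by norm_num),
      mul_inv_rev, inv_inv, i2, i3, ← mul_assoc]
    nth_rw 1 [← i2]
    rw [inv_mul_cancel, one_mul]

end groups

open Matrix

/-! ### Subgroups defined by eigenvectors and by a quadratic form. -/

section stabilizers

variable {F : Type*} [Field F]

theorem sl_smul_apply (A : SpecialLinearGroup (Fin 3) F) (v : Fin 3 → F) (i : Fin 3) :
    (A • v) i = A i 0 * v 0 + A i 1 * v 1 + A i 2 * v 2 := by
  simp [Matrix.SpecialLinearGroup.smul_def, mulVec, dotProduct, Fin.sum_univ_three]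

theorem sl_smul_comm (A : SpecialLinearGroup (Fin 3) F) (a : F) (v : Fin 3 → F) :
    A • (a • v) = a • (A • v) := by
  ext i
  simp only [sl_smul_apply, Pi.smul_apply, smul_eq_mul]
  ring

theorem scalarSL_smul {z : F} (hz : z ^ 3 = 1) (v : Fin 3 → F) : scalarSL z hz • v = z • v := by
  ext i
  rw [sl_smul_apply]
  fin_cases i <;> simp [coe_scalarSL]

theorem sl_det (A : SpecialLinearGroup (Fin 3) F) :
    A 0 0 * A 1 1 * A 2 2 - A 0 0 * A 1 2 * A 2 1 - A 0 1 * A 1 0 * A 2 2 +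
      A 0 1 * A 1 2 * A 2 0 + A 0 2 * A 1 0 * A 2 1 - A 0 2 * A 1 1 * A 2 0 = 1 := by
  rw [← det_fin_three]
  exact A.2

theorem sl_pow_smul {A : SpecialLinearGroup (Fin 3) F} {v : Fin 3 → F} {a : F}
    (h : A • v = a • v) (n : ℕ) : A ^ n • v = a ^ n • v := by
  induction n with
  | zero => simp
  | succ n ih => rw [pow_succ, mul_smul, h, sl_smul_comm, ih, smul_smul, pow_succ']

theorem sl_inv_smul {A : SpecialLinearGroup (Fin 3) F} {v : Fin 3 → F} {a : F} (ha : a ≠ 0)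
    (h : A • v = a • v) : A⁻¹ • v = a⁻¹ • v := by
  rw [inv_smul_eq_iff, sl_smul_comm, h, smul_smul, inv_mul_cancel₀ ha, one_smul]

/-- The matrices with eigenvector `v` and eigenvalue a sixth root of unity. -/
def sixthStab (v : Fin 3 → F) : Subgroup (Matrix.SpecialLinearGroup (Fin 3) F) where
  carrier := {A | ∃ a : F, a ^ 6 = 1 ∧ A • v = a • v}
  one_mem' := ⟨1, one_pow 6, by simp⟩
  mul_mem' := by
    rintro A B ⟨a, ha, hA⟩ ⟨b, hb, hB⟩
    refine ⟨a * b, by rw [mul_pow, ha, hb, one_mul], ?_⟩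
    rw [mul_smul, hB, sl_smul_comm, hA, smul_smul, mul_comm]
  inv_mem' := by
    rintro A ⟨a, ha, hA⟩
    refine ⟨a⁻¹, by rw [inv_pow, ha, inv_one], sl_inv_smul ?_ hA⟩
    rintro rfl
    simp at ha

/-- The matrices with eigenvectors `u` and `v`, such that the pair of eigenvalues is up to a third
root of unity a power of `(a, b)`. -/
def pairStab (u v : Fin 3 → F) (a b : F) (ha : a ^ 6 = 1) (hb : b ^ 6 = 1) :
    Subgroup (Matrix.SpecialLinearGroup (Fin 3) F) where
  carrier := {A | ∃ (z : F) (n : ℕ), z ^ 3 = 1 ∧ A • u = (z * a ^ n) • u ∧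
    A • v = (z * b ^ n) • v}
  one_mem' := ⟨1, 0, one_pow 3, by simp, by simp⟩
  mul_mem' := by
    rintro A B ⟨z, n, hz, hA, hA'⟩ ⟨y, m, hy, hB, hB'⟩
    refine ⟨z * y, n + m, by rw [mul_pow, hz, hy, one_mul], ?_, ?_⟩
    · rw [mul_smul, hB, sl_smul_comm, hA, smul_smul]
      congr 1
      ring
    · rw [mul_smul, hB', sl_smul_comm, hA', smul_smul]
      congr 1
      ring
  inv_mem' := by
    have key : ∀ {A : Matrix.SpecialLinearGroup (Fin 3) F} {w : Fin 3 → F} {c z : F} {n : ℕ},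
        c ^ 6 = 1 → z ^ 3 = 1 → A • w = (z * c ^ n) • w → A⁻¹ • w = (z⁻¹ * c ^ (5 * n)) • w := by
      intro A w c z n hc hz h
      have hc0 : c ≠ 0 := by
        rintro rfl
        simp at hc
      have hz0 : z ≠ 0 := by
        rintro rfl
        simp at hz
      have h1 : c ^ (5 * n) * c ^ n = 1 := by
        rw [← pow_add, show 5 * n + n = 6 * n by ring, pow_mul, hc, one_pow]
      rw [sl_inv_smul (mul_ne_zero hz0 (pow_ne_zero n hc0)) h, mul_inv,
        eq_inv_of_mul_eq_one_left h1]
    rintro A ⟨z, n, hz, hA, hA'⟩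
    exact ⟨z⁻¹, 5 * n, by rw [inv_pow, hz, inv_one], key ha hz hA, key hb hz hA'⟩

/-- Membership in a subgroup of `SL(3, F)` that contains the scalar matrices can be tested
in `PSL(3, F)`. -/
theorem mem_of_toPSL_mem {K : Subgroup (Matrix.SpecialLinearGroup (Fin 3) F)}
    (hK : ∀ z hz, scalarSL z hz ∈ K) {H : Subgroup (ProjectiveSpecialLinearGroup (Fin 3) F)}
    (hH : H ≤ K.map toPSL) {A : SpecialLinearGroup (Fin 3) F} (hA : toPSL A ∈ H) : A ∈ K := by
  obtain ⟨B, hB, hBA⟩ := hH hA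
  obtain ⟨z, hz, rfl⟩ := toPSL_eq_iff.1 hBA.symm
  exact mul_mem (hK z hz) hB

theorem scalarSL_mem_sixthStab (v : Fin 3 → F) (z : F) (hz : z ^ 3 = 1) :
    scalarSL z hz ∈ sixthStab v :=
  ⟨z, by rw [show 6 = 3 * 2 from rfl, pow_mul, hz, one_pow], scalarSL_smul hz v⟩

/-- An element of `pairStab` becomes unipotent after multiplication by a scalar and a power
of a given element with eigenvalues `a` and `b`. -/
theorem exists_of_mem_pairStab {u v : Fin 3 → F} {a b : F} {ha : a ^ 6 = 1} {hb : b ^ 6 = 1}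
    {A C : SpecialLinearGroup (Fin 3) F} (hA : A ∈ pairStab u v a b ha hb)
    (hu : C • u = a • u) (hv : C • v = b • v) :
    ∃ (z : F) (hz : z ^ 3 = 1) (n : ℕ), (scalarSL z hz * C ^ n * A) • u = u ∧
      (scalarSL z hz * C ^ n * A) • v = v := by
  obtain ⟨z, n, hz, h1, h2⟩ := hA
  have key : ∀ c : F, c ^ 6 = 1 → z ^ 2 * c ^ (5 * n) * (z * c ^ n) = 1 := fun c hc => by
    calc z ^ 2 * c ^ (5 * n) * (z * c ^ n) = z ^ 3 * (c ^ 6) ^ n := by ring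
      _ = 1 := by rw [hz, hc, one_pow, one_mul]
  refine ⟨z ^ 2, by rw [← pow_mul, mul_comm, pow_mul, hz, one_pow], 5 * n, ?_, ?_⟩
  · rw [mul_smul, mul_smul, h1, sl_smul_comm, sl_pow_smul hu, scalarSL_smul, smul_smul, smul_smul,
      show z ^ 2 * (z * a ^ n) * a ^ (5 * n) = 1 by rw [← key a ha]; ring, one_smul]
  · rw [mul_smul, mul_smul, h2, sl_smul_comm, sl_pow_smul hv, scalarSL_smul, smul_smul, smul_smul,
      show z ^ 2 * (z * b ^ n) * b ^ (5 * n) = 1 by rw [← key b hb]; ring, one_smul]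

theorem exists_of_pow_six_eq_one {a : F} (ha : a ^ 6 = 1) :
    ∃ (n : ℕ) (z : F), z ^ 3 = 1 ∧ a = (-1) ^ n * z := by
  have h : (a ^ 3 - 1) * (a ^ 3 + 1) = 0 := by linear_combination ha
  rcases mul_eq_zero.1 h with h | h
  · exact ⟨0, a, sub_eq_zero.1 h, by simp⟩
  · exact ⟨1, -a, by linear_combination -h, by simp⟩

/-- The quadratic form `xy + ω yz + ω² xz`. -/
def quad (w : F) (v : Fin 3 → F) : F := v 0 * v 1 + w * (v 1 * v 2) + w ^ 2 * (v 0 * v 2)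

theorem quad_smul (w a : F) (v : Fin 3 → F) : quad w (a • v) = a ^ 2 * quad w v := by
  simp only [quad, Pi.smul_apply, smul_eq_mul]
  ring

/-- The matrices that preserve `quad w` up to third roots of unity. -/
def quadStab (w : F) : Subgroup (Matrix.SpecialLinearGroup (Fin 3) F) where
  carrier := {A | ∃ c : F, c ^ 3 = 1 ∧ ∀ v : Fin 3 → F, quad w (A • v) = c * quad w v}
  one_mem' := ⟨1, one_pow 3, by simp⟩
  mul_mem' := by
    rintro A B ⟨a, ha, hA⟩ ⟨b, hb, hB⟩
    refine ⟨a * b, by rw [mul_pow, ha, hb, one_mul], fun v => ?_⟩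
    rw [mul_smul, hA, hB, mul_assoc]
  inv_mem' := by
    rintro A ⟨a, ha, hA⟩
    have ha0 : a ≠ 0 := by
      rintro rfl
      simp at ha
    refine ⟨a⁻¹, by rw [inv_pow, ha, inv_one], fun v => ?_⟩
    rw [eq_inv_mul_iff_mul_eq₀ ha0, ← hA, smul_inv_smul]

theorem scalarSL_mem_quadStab (w z : F) (hz : z ^ 3 = 1) : scalarSL z hz ∈ quadStab w :=
  ⟨z ^ 2, by rw [← pow_mul, mul_comm, pow_mul, hz, one_pow], fun v => by
    rw [scalarSL_smul, quad_smul]⟩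

end stabilizers

/-! ### Common eigenvectors of the first generators and consequences for both signs of `k`. -/

section sigma

variable {F : Type*} [Field F] {w : F} (hw : w ^ 3 = 1) {k : F}

theorem sl1_smul_e1 : sl1 w hw 1 • ![(1 : F), 0, 0] = (1 : F) • ![(1 : F), 0, 0] := by
  ext i
  rw [sl_smul_apply, coe_sl1]
  fin_cases i <;> simp

theorem sl2_smul_e1 : sl2 w hw k 1 • ![(1 : F), 0, 0] = (-1 : F) • ![(1 : F), 0, 0] := by
  ext i
  rw [sl_smul_apply, coe_sl2]
  fin_cases i <;> simp

theorem sl3_smul_e1 : sl3 k • ![(1 : F), 0, 0] = (1 : F) • ![(1 : F), 0, 0] := by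
  ext i
  rw [sl_smul_apply, coe_sl3]
  fin_cases i <;> simp

theorem sl1_smul_e2 : sl1 w hw 1 • ![(0 : F), 1, 0] = w • ![(0 : F), 1, 0] := by
  ext i
  rw [sl_smul_apply, coe_sl1]
  fin_cases i <;> simp

theorem sl2_smul_e2 : sl2 w hw k 1 • ![(0 : F), 1, 0] = (-w ^ 2) • ![(0 : F), 1, 0] := by
  ext i
  rw [sl_smul_apply, coe_sl2]
  fin_cases i <;> simp

theorem segment_zero_four_le :
    segment (sigma w hw k 1) 0 4 ≤ (sixthStab ![(1 : F), 0, 0]).map toPSL := by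
  refine segment_le fun i _ hi => ?_
  fin_cases i
  · exact ⟨_, ⟨1, one_pow 6, sl1_smul_e1 hw⟩, rfl⟩
  · exact ⟨_, ⟨-1, by norm_num, sl2_smul_e1 hw⟩, rfl⟩
  · exact ⟨_, ⟨1, one_pow 6, sl3_smul_e1⟩, rfl⟩
  · simp at hi

theorem neg_one_pow_six : (-1 : F) ^ 6 = 1 := by norm_num

theorem neg_pow_six {z : F} (hz : z ^ 3 = 1) : (-z) ^ 6 = 1 := by
  rw [show 6 = 3 * 2 from rfl, pow_mul, Odd.neg_pow (by decide), hz]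
  norm_num

theorem sq_cube {z : F} (hz : z ^ 3 = 1) : (z ^ 2) ^ 3 = 1 := by
  rw [← pow_mul, mul_comm, pow_mul, hz, one_pow]

/-- The eigenvalue pair (1, w) of σ₁ is the square of the pair (-1, -w²) of σ₂. Hence any element of
⟨σ₁, σ₂⟩ can be made to fix both vectors by a scalar and a power of σ₂ alone. -/
theorem segment_zero_three_le :
    segment (sigma w hw k 1) 0 3 ≤ (pairStab ![1, 0, 0] ![0, 1, 0] (-1) (-w ^ 2)
      neg_one_pow_six (neg_pow_six (sq_cube hw))).map toPSL := by
  refine segment_le fun i _ hi => ?_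
  fin_cases i
  · refine ⟨_, ⟨1, 2, one_pow 3, ?_, ?_⟩, rfl⟩
    · rw [sl1_smul_e1]
      norm_num
    · rw [sl1_smul_e2, show 1 * (-w ^ 2) ^ 2 = w by linear_combination w * hw]
  · exact ⟨_, ⟨1, 1, one_pow 3, by rw [sl2_smul_e1]; norm_num, by rw [sl2_smul_e2]; norm_num⟩, rfl⟩
  · simp at hi
  · simp at hi

theorem sl4_notMem_sixthStab : sl4 F ∉ sixthStab ![(1 : F), 0, 0] := by
  rintro ⟨a, _, h⟩
  have := congrFun h 2
  rw [sl_smul_apply, coe_sl4] at this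
  simp at this

theorem scalar_mem_pairStab {u v : Fin 3 → F} {a b : F} (ha : a ^ 6 = 1) (hb : b ^ 6 = 1) (z : F)
    (hz : z ^ 3 = 1) : scalarSL z hz ∈ pairStab u v a b ha hb :=
  ⟨z, 0, hz, by simp [scalarSL_smul], by simp [scalarSL_smul]⟩

theorem sigma_three_notMem : sigma w hw k 1 3 ∉ segment (sigma w hw k 1) 0 4 := fun h =>
  sl4_notMem_sixthStab (mem_of_toPSL_mem (scalarSL_mem_sixthStab _) (segment_zero_four_le hw) h)

theorem segment_three_inf : segment (sigma w hw k 1) 3 5 ⊓ segment (sigma w hw k 1) 0 4 = ⊥ := by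
  rw [inf_comm, show segment (sigma w hw k 1) 3 5 = Subgroup.zpowers (sigma w hw k 1 3) from
    segment_eq_zpowers 3]
  refine zpowers_inf_eq_bot ?_ (sigma_three_notMem hw)
  exact orderOf_dvd_iff_pow_eq_one.1 (orderOf_sigma_three hw).dvd

theorem segment_one_inf_segment_two (hw1 : w ^ 2 + w + 1 = 0) (h3 : (3 : F) ≠ 0)
    (h2 : (2 : F) ≠ 0) (hk : k ^ 2 = 1) :
    segment (sigma w hw k 1) 1 3 ⊓ segment (sigma w hw k 1) 2 4 = ⊥ := by
  rw [show segment (sigma w hw k 1) 1 3 = Subgroup.zpowers (sigma w hw k 1 1) from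
    segment_eq_zpowers 1, show segment (sigma w hw k 1) 2 4 =
    Subgroup.zpowers (sigma w hw k 1 2) from segment_eq_zpowers 2]
  rw [sigma_one, sigma_two]
  have hw0 : w ≠ 0 := by
    rintro rfl
    simp at hw
  refine zpowers_inf_zpowers_eq_bot ?_ ?_ ?_
  · rw [← map_pow, sl2_pow_six hw hw1, map_one]
  · intro h
    rw [← map_pow] at h
    have h := h.eq
    rw [← map_mul, ← map_mul] at h
    obtain ⟨z, _, hz⟩ := exists_of_toPSL_eq h
    have e1 := hz 0 0
    have e2 := hz 1 2
    rw [Matrix.SpecialLinearGroup.coe_mul, Matrix.SpecialLinearGroup.coe_mul, coe_sl2_sq hw hw1,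
      coe_sl3] at e1 e2
    simp [Matrix.mul_apply, Fin.sum_univ_three] at e1 e2
    apply h3
    grind
  · intro h
    rw [← map_pow] at h
    have h := h.eq
    rw [← map_mul, ← map_mul] at h
    obtain ⟨z, _, hz⟩ := exists_of_toPSL_eq h
    have e1 := hz 0 0
    have e2 := hz 1 2
    rw [Matrix.SpecialLinearGroup.coe_mul, Matrix.SpecialLinearGroup.coe_mul, coe_sl2_cube hw hw1,
      coe_sl3] at e1 e2
    simp [Matrix.mul_apply, Fin.sum_univ_three] at e1 e2
    refine mul_ne_zero h2 hw0 ?_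
    grind

theorem sigma_stringRel (hk : k ^ 2 = 1) : StringRel (sigma w hw k 1) := by
  intro a b hab hb
  have := sigma_string hw hk a b hab hb
  rw [← rot_eq _ (by omega), ← sq, ← this, pow_orderOf_eq_one]

theorem sigma_ne_one (hw1 : w ^ 2 + w + 1 = 0) (h3 : (3 : F) ≠ 0) (h2 : (2 : F) ≠ 0)
    (hk : k ^ 2 = 1) (i : Fin 4) : sigma w hw k 1 i ≠ 1 := by
  have hne : w ≠ 1 := by
    rintro rfl
    exact h3 (by linear_combination hw1)
  intro h
  fin_cases i
  · have := orderOf_sigma_zero hw (k := k) hne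
    simp [show sigma w hw k 1 0 = 1 from h] at this
  · have := orderOf_sigma_one hw hw1 h3 h2 hk
    simp [show sigma w hw k 1 1 = 1 from h] at this
  · refine toPSL_ne_one (i := 1) (j := 2) (by decide) ?_ (show toPSL (sl3 k) = 1 from h)
    simp [coe_sl3]
  · have := orderOf_sigma_three hw (k := k)
    simp [show sigma w hw k 1 3 = 1 from h] at this

end sigma

end ChiralPolytopes

namespace ChiralPolytopes

/-! ### Intersections for `k = 1` -/

open Matrix

section segments

variable {F : Type*} [Field F] {w : F}

theorem sl2_mem_segment {hw : w ^ 3 = 1} {k : F} {l j : ℕ} (hl : l ≤ 1) (hj : 3 ≤ j) :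
    sl2 w hw k 1 ∈ (segment (sigma w hw k 1) l j).comap toPSL :=
  mem_segment (sigma w hw k 1) (i := 1) (by simpa using hl) (by simp; omega)

theorem sl3_mem_segment {hw : w ^ 3 = 1} {k : F} {l j : ℕ} (hl : l ≤ 2) (hj : 4 ≤ j) :
    sl3 k ∈ (segment (sigma w hw k 1) l j).comap toPSL :=
  mem_segment (sigma w hw k 1) (i := 2) (by simpa using hl) (by simp; omega)

theorem scalarSL_mem_comap (H : Subgroup (ProjectiveSpecialLinearGroup (Fin 3) F)) (z : F)
    (hz : z ^ 3 = 1) : scalarSL z hz ∈ H.comap toPSL := by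
  rw [Subgroup.mem_comap, toPSL_scalarSL]
  exact one_mem H

theorem scalarSL_mul_pow_mul_mem_iff {H : Subgroup (ProjectiveSpecialLinearGroup (Fin 3) F)} {z : F}
    {hz : z ^ 3 = 1} {n : ℕ} {C A : SpecialLinearGroup (Fin 3) F} (hC : C ∈ H.comap toPSL) :
    scalarSL z hz * C ^ n * A ∈ H.comap toPSL ↔ A ∈ H.comap toPSL :=
  Subgroup.mul_mem_cancel_left _ (mul_mem (scalarSL_mem_comap H z hz) (pow_mem hC n))

theorem col_zero_of_smul {B : SpecialLinearGroup (Fin 3) F} {a : F}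
    (h : B • ![(1 : F), 0, 0] = a • ![(1 : F), 0, 0]) : B 0 0 = a ∧ B 1 0 = 0 ∧ B 2 0 = 0 := by
  have h0 := congrFun h 0
  have h1 := congrFun h 1
  have h2 := congrFun h 2
  rw [sl_smul_apply] at h0 h1 h2
  simp at h0 h1 h2
  exact ⟨h0, h1, h2⟩

theorem col_one_of_smul {B : SpecialLinearGroup (Fin 3) F} {a : F}
    (h : B • ![(0 : F), 1, 0] = a • ![(0 : F), 1, 0]) : B 0 1 = 0 ∧ B 1 1 = a ∧ B 2 1 = 0 := by
  have h0 := congrFun h 0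
  have h1 := congrFun h 1
  have h2 := congrFun h 2
  rw [sl_smul_apply] at h0 h1 h2
  simp at h0 h1 h2
  exact ⟨h0, h1, h2⟩

theorem rows_of_smul {B : SpecialLinearGroup (Fin 3) F} {a x y z : F}
    (h : B • ![x, y, z] = a • ![x, y, z]) : B 0 0 * x + B 0 1 * y + B 0 2 * z = a * x ∧
      B 1 0 * x + B 1 1 * y + B 1 2 * z = a * y ∧ B 2 0 * x + B 2 1 * y + B 2 2 * z = a * z := by
  have h0 := congrFun h 0
  have h1 := congrFun h 1
  have h2 := congrFun h 2
  rw [sl_smul_apply] at h0 h1 h2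
  exact ⟨h0, h1, h2⟩

end segments

/-! ### Common eigenvectors for `k = 1`. -/

section plus

variable {F : Type*} [Field F] {w : F}

theorem sl2_smul_f (hw : w ^ 3 = 1) (hw1 : w ^ 2 + w + 1 = 0) :
    sl2 w hw 1 1 • ![(1 : F), w, w ^ 2] = w • ![(1 : F), w, w ^ 2] := by
  ext i
  rw [sl_smul_apply, coe_sl2]
  fin_cases i <;> simp <;> grind

theorem sl3_smul_f (hw1 : w ^ 2 + w + 1 = 0) :
    sl3 (1 : F) • ![(1 : F), w, w ^ 2] = (-w ^ 2) • ![(1 : F), w, w ^ 2] := by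
  ext i
  rw [sl_smul_apply, coe_sl3]
  fin_cases i <;> simp <;> grind

theorem sl3_smul_f' (hw1 : w ^ 2 + w + 1 = 0) :
    sl3 (1 : F) • ![(1 : F), w ^ 2, w] = (-w) • ![(1 : F), w ^ 2, w] := by
  ext i
  rw [sl_smul_apply, coe_sl3]
  fin_cases i <;> simp <;> grind

theorem sl4_smul_f (hw : w ^ 3 = 1) :
    sl4 F • ![(1 : F), w, w ^ 2] = w • ![(1 : F), w, w ^ 2] := by
  ext i
  rw [sl_smul_apply, coe_sl4]
  fin_cases i <;> simp <;> grind

theorem sl4_smul_f' (hw : w ^ 3 = 1) :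
    sl4 F • ![(1 : F), w ^ 2, w] = w ^ 2 • ![(1 : F), w ^ 2, w] := by
  ext i
  rw [sl_smul_apply, coe_sl4]
  fin_cases i <;> simp <;> grind

theorem segment_one_five_le_sixthStab (hw : w ^ 3 = 1) (hw1 : w ^ 2 + w + 1 = 0) :
    segment (sigma w hw 1 1) 1 5 ≤ (sixthStab ![(1 : F), w, w ^ 2]).map toPSL := by
  have hw6 : w ^ 6 = 1 := by rw [show 6 = 3 * 2 from rfl, pow_mul, hw, one_pow]
  refine segment_le fun i hi _ => ?_
  fin_cases i
  · simp at hi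
  · exact ⟨_, ⟨w, hw6, sl2_smul_f hw hw1⟩, rfl⟩
  · exact ⟨_, ⟨-w ^ 2, neg_pow_six (sq_cube hw), sl3_smul_f hw1⟩, rfl⟩
  · exact ⟨_, ⟨w, hw6, sl4_smul_f hw⟩, rfl⟩

/-- The eigenvalue pair (w, w²) of σ₄ is the square of the pair (-w², -w) of σ₃, so powers of σ₃
suffice for normalization. -/
theorem segment_two_five_le_pairStab (hw : w ^ 3 = 1) (hw1 : w ^ 2 + w + 1 = 0) :
    segment (sigma w hw 1 1) 2 5 ≤ (pairStab ![1, w, w ^ 2] ![1, w ^ 2, w] (-w ^ 2) (-w)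
      (neg_pow_six (sq_cube hw)) (neg_pow_six hw)).map toPSL := by
  refine segment_le fun i hi _ => ?_
  fin_cases i
  · simp at hi
  · simp at hi
  · exact ⟨_, ⟨1, 1, one_pow 3, by simpa using sl3_smul_f hw1,
      by simpa using sl3_smul_f' hw1⟩, rfl⟩
  · refine ⟨_, ⟨1, 2, one_pow 3, ?_, ?_⟩, rfl⟩
    · rw [sl4_smul_f hw, show 1 * (-w ^ 2) ^ 2 = w by linear_combination w * hw]
    · rw [sl4_smul_f' hw, show 1 * (-w) ^ 2 = w ^ 2 by ring]

theorem segment_one_inf_zero_of_one (hw : w ^ 3 = 1) (hw1 : w ^ 2 + w + 1 = 0) (hne : w ≠ 1) :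
    segment (sigma w hw 1 1) 1 5 ⊓ segment (sigma w hw 1 1) 0 2 = ⊥ := by
  rw [show segment (sigma w hw 1 1) 0 2 = Subgroup.zpowers (sigma w hw 1 1 0) from
    segment_eq_zpowers 0]
  refine zpowers_inf_eq_bot
    (orderOf_dvd_iff_pow_eq_one.1 (orderOf_sigma_zero hw hne).dvd) fun h => ?_
  obtain ⟨a, -, ha⟩ := mem_of_toPSL_mem (scalarSL_mem_sixthStab _)
    (segment_one_five_le_sixthStab hw hw1) h
  obtain ⟨h1, h2, -⟩ := rows_of_smul ha
  simp [coe_sl1] at h1 h2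
  grind

/-- After normalization by a power of σ₂ the matrix fixes e₁ and e₂ and has (1, w, w²) as an
eigenvector. The determinant gives the last diagonal entry 1, the third row then gives eigenvalue 1,
and three independent vectors are fixed. -/
theorem segment_one_inf_zero_three_of_one (hw : w ^ 3 = 1) (hw1 : w ^ 2 + w + 1 = 0) :
    segment (sigma w hw 1 1) 1 5 ⊓ segment (sigma w hw 1 1) 0 3 ≤
      segment (sigma w hw 1 1) 1 3 := by
  rintro g ⟨hg1, hg2⟩
  obtain ⟨A, rfl⟩ := toPSL_surjective g
  have hA1 := mem_of_toPSL_mem (scalarSL_mem_sixthStab _)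
    (segment_one_five_le_sixthStab hw hw1) hg1
  have hA2 := mem_of_toPSL_mem (scalar_mem_pairStab _ _) (segment_zero_three_le hw) hg2
  obtain ⟨z, hz, n, h1, h2⟩ := exists_of_mem_pairStab hA2 (sl2_smul_e1 (k := 1) hw)
    (sl2_smul_e2 hw)
  have hC : sl2 w hw 1 1 ∈ sixthStab ![(1 : F), w, w ^ 2] :=
    ⟨w, by rw [show 6 = 3 * 2 from rfl, pow_mul, hw, one_pow], sl2_smul_f hw hw1⟩
  obtain ⟨b, -, h3⟩ := mul_mem (mul_mem (scalarSL_mem_sixthStab _ z hz) (pow_mem hC n)) hA1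
  refine (scalarSL_mul_pow_mul_mem_iff (sl2_mem_segment le_rfl le_rfl)).1
    (show scalarSL z hz * sl2 w hw 1 1 ^ n * A ∈ _ from ?_)
  generalize scalarSL z hz * sl2 w hw 1 1 ^ n * A = B at *
  suffices B = 1 by
    rw [this]
    exact one_mem _
  obtain ⟨e1, e2, e3⟩ := col_zero_of_smul (h1.trans (one_smul F _).symm)
  obtain ⟨e4, e5, e6⟩ := col_one_of_smul (h2.trans (one_smul F _).symm)
  obtain ⟨e7, e8, e9⟩ := rows_of_smul h3
  have e10 := sl_det B
  simp only [e1, e2, e3, e4, e5, e6] at e7 e8 e9 e10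
  have hr : B 2 2 = 1 := by linear_combination e10
  ext i j
  fin_cases i <;> fin_cases j <;> simp <;> first | assumption | grind only

/-- After normalization by a power of σ₃ the matrix fixes (1, w, w²) and (1, w², w) and has
eigenvector e₁. These form a basis as 3 ≠ 0, and determinant one makes the last eigenvalue 1. -/
theorem segment_two_inf_zero_four_of_one (hw : w ^ 3 = 1) (hw1 : w ^ 2 + w + 1 = 0)
    (h3 : (3 : F) ≠ 0) :
    segment (sigma w hw 1 1) 2 5 ⊓ segment (sigma w hw 1 1) 0 4 ≤
      segment (sigma w hw 1 1) 2 4 := by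
  rintro g ⟨hg1, hg2⟩
  obtain ⟨A, rfl⟩ := toPSL_surjective g
  have hA1 := mem_of_toPSL_mem (scalar_mem_pairStab _ _) (segment_two_five_le_pairStab hw hw1) hg1
  have hA2 := mem_of_toPSL_mem (scalarSL_mem_sixthStab _) (segment_zero_four_le hw) hg2
  obtain ⟨z, hz, n, h1, h2⟩ := exists_of_mem_pairStab hA1 (sl3_smul_f hw1) (sl3_smul_f' hw1)
  have hC : sl3 (1 : F) ∈ sixthStab ![(1 : F), 0, 0] := ⟨1, one_pow 6, sl3_smul_e1⟩
  obtain ⟨b, -, hb⟩ := mul_mem (mul_mem (scalarSL_mem_sixthStab _ z hz) (pow_mem hC n)) hA2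
  refine (scalarSL_mul_pow_mul_mem_iff (sl3_mem_segment le_rfl le_rfl)).1
    (show scalarSL z hz * sl3 1 ^ n * A ∈ _ from ?_)
  generalize scalarSL z hz * sl3 1 ^ n * A = B at *
  suffices B = 1 by
    rw [this]
    exact one_mem _
  obtain ⟨e1, e2, e3⟩ := col_zero_of_smul hb
  obtain ⟨e4, e5, e6⟩ := rows_of_smul (h1.trans (one_smul F _).symm)
  obtain ⟨e7, e8, e9⟩ := rows_of_smul (h2.trans (one_smul F _).symm)
  have e10 := sl_det B
  simp only [e1, e2, e3] at e4 e5 e6 e7 e8 e9 e10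
  have k1 : B 2 1 = 0 := by grind
  have k2 : B 2 2 = 1 := by grind
  have k3 : B 1 2 = 0 := by grind
  have k4 : B 1 1 = 1 := by grind
  have k5 : b = 1 := by grind
  have k6 : B 0 1 = 0 := by grind
  have k7 : B 0 2 = 0 := by grind
  ext i j
  fin_cases i <;> fin_cases j <;> simp <;> first | assumption | exact e1.trans k5

end plus

end ChiralPolytopes

namespace ChiralPolytopes

/-! ### The group generated by `σ₂` and `σ₃` for `k = 1` -/

open Matrix

section plus

variable {F : Type*} [Field F] {w : F}

theorem exists_pow_eq_of_cube_eq_one (hw1 : w ^ 2 + w + 1 = 0) {z : F} (hz : z ^ 3 = 1) :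
    ∃ j : ℕ, z = w ^ j := by
  have h : (z - 1) * (z - w) * (z - w ^ 2) = 0 := by
    linear_combination hz + (-z ^ 2 + w * z - (w - 1)) * hw1
  rcases mul_eq_zero.1 h with h | h
  · rcases mul_eq_zero.1 h with h | h
    · exact ⟨0, by linear_combination h⟩
    · exact ⟨1, by linear_combination h⟩
  · exact ⟨2, by linear_combination h⟩

/-- The element -w² has order six: its cube -1 corrects the sign, and its fourth power w² inverts w.
It is the eigenvalue of σ₃ at (1, w, w²). -/
theorem exists_neg_pow_mul_eq_one (hw : w ^ 3 = 1) (hw1 : w ^ 2 + w + 1 = 0) {b : F}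
    (hb : b ^ 6 = 1) : ∃ j : ℕ, (-w ^ 2) ^ j * b = 1 := by
  obtain ⟨n, z, hz, rfl⟩ := exists_of_pow_six_eq_one hb
  obtain ⟨j, rfl⟩ := exists_pow_eq_of_cube_eq_one hw1 hz
  refine ⟨3 * n + 4 * j, ?_⟩
  have h3 : (-w ^ 2) ^ 3 = -1 := by linear_combination (-w ^ 3 - 1) * hw
  have h4 : (-w ^ 2) ^ 4 = w ^ 2 := by linear_combination (w ^ 5 + w ^ 2) * hw
  rw [pow_add, pow_mul, pow_mul, h3, h4]
  rw [mul_mul_mul_comm, ← mul_pow, ← mul_pow, ← pow_succ, hw]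
  simp

theorem exists_of_mem_sixthStab (hw : w ^ 3 = 1) {k : F} {A : SpecialLinearGroup (Fin 3) F}
    (hA : A ∈ sixthStab ![(1 : F), 0, 0]) : ∃ (z : F) (hz : z ^ 3 = 1) (n : ℕ),
      (scalarSL z hz * sl2 w hw k 1 ^ n * A) • ![(1 : F), 0, 0] = ![(1 : F), 0, 0] := by
  obtain ⟨a, ha, ha'⟩ := hA
  obtain ⟨n, z, hz, rfl⟩ := exists_of_pow_six_eq_one ha
  refine ⟨z ^ 2, sq_cube hz, n, ?_⟩
  rw [mul_smul, mul_smul, ha', sl_smul_comm, sl_pow_smul (sl2_smul_e1 hw), scalarSL_smul,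
    smul_smul, smul_smul,
    show z ^ 2 * ((-1) ^ n * z) * (-1) ^ n = ((-1) ^ n * (-1) ^ n) * z ^ 3 by ring, ← mul_pow, hz]
  simp

/-- The transvections that fix the vectors `(1, 0, 0)` and `(1, w, w²)`. -/
def slTrans (w : F) (hw : w ^ 3 = 1) (x y : F) : Matrix.SpecialLinearGroup (Fin 3) F :=
  ⟨!![1, (x + y) * w, -(x + y); 0, 1 + y * w ^ 2, -(y * w); 0, y, 1 - y * w ^ 2], by
    simp [det_fin_three]
    linear_combination (-y ^ 2 * w) * hw⟩

theorem coe_slTrans (hw : w ^ 3 = 1) (x y : F) : (slTrans w hw x y : Matrix (Fin 3) (Fin 3) F) =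
    !![1, (x + y) * w, -(x + y); 0, 1 + y * w ^ 2, -(y * w); 0, y, 1 - y * w ^ 2] := rfl

theorem slTrans_mul (hw : w ^ 3 = 1) (x y x' y' : F) :
    slTrans w hw x y * slTrans w hw x' y' = slTrans w hw (x + x') (y + y') := by
  refine Subtype.ext ?_
  rw [Matrix.SpecialLinearGroup.coe_mul]
  simp only [coe_slTrans]
  ext i j
  fin_cases i <;> fin_cases j <;> simp [Matrix.mul_apply, Fin.sum_univ_three] <;> grind

theorem slTrans_zero (hw : w ^ 3 = 1) : slTrans w hw 0 0 = 1 := by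
  refine Subtype.ext ?_
  rw [coe_slTrans, Matrix.SpecialLinearGroup.coe_one]
  ext i j
  fin_cases i <;> fin_cases j <;> simp

theorem slTrans_pow (hw : w ^ 3 = 1) (x y : F) (n : ℕ) :
    slTrans w hw x y ^ n = slTrans w hw (n * x) (n * y) := by
  induction n with
  | zero => simp [slTrans_zero]
  | succ n ih =>
    rw [pow_succ, ih, slTrans_mul]
    push_cast
    ring_nf

theorem slTrans_inv (hw : w ^ 3 = 1) (x y : F) :
    (slTrans w hw x y)⁻¹ = slTrans w hw (-x) (-y) := by
  rw [inv_eq_iff_mul_eq_one, slTrans_mul, add_neg_cancel, add_neg_cancel, slTrans_zero]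

theorem sl2_mul_slTrans (hw : w ^ 3 = 1) (hw1 : w ^ 2 + w + 1 = 0) (x y : F) :
    sl2 w hw 1 1 * slTrans w hw x y =
      slTrans w hw (w * x) (-w ^ 2 * y) * sl2 w hw 1 1 := by
  refine Subtype.ext ?_
  rw [Matrix.SpecialLinearGroup.coe_mul, Matrix.SpecialLinearGroup.coe_mul]
  simp only [coe_slTrans, coe_sl2]
  ext i j
  fin_cases i <;> fin_cases j <;> simp [Matrix.mul_apply, Fin.sum_univ_three] <;> grind

theorem sl2_mul_sl3_eq_slTrans_mul (hw : w ^ 3 = 1) (hw1 : w ^ 2 + w + 1 = 0) :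
    sl2 w hw 1 1 * sl3 1 = slTrans w hw (w - 1) 1 * (sl3 1 * sl2 w hw 1 1) := by
  refine Subtype.ext ?_
  rw [Matrix.SpecialLinearGroup.coe_mul, Matrix.SpecialLinearGroup.coe_mul,
    Matrix.SpecialLinearGroup.coe_mul]
  simp only [coe_slTrans, coe_sl2, coe_sl3]
  ext i j
  fin_cases i <;> fin_cases j <;> simp [Matrix.mul_apply, Fin.sum_univ_three] <;> grind

theorem sl2_mul_sl3_eq_mul_slTrans (hw : w ^ 3 = 1) (hw1 : w ^ 2 + w + 1 = 0) :
    sl2 w hw 1 1 * sl3 1 = sl3 1 * sl2 w hw 1 1 * slTrans w hw (1 - w) (-1) := by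
  refine Subtype.ext ?_
  rw [Matrix.SpecialLinearGroup.coe_mul, Matrix.SpecialLinearGroup.coe_mul,
    Matrix.SpecialLinearGroup.coe_mul]
  simp only [coe_slTrans, coe_sl2, coe_sl3]
  ext i j
  fin_cases i <;> fin_cases j <;> simp [Matrix.mul_apply, Fin.sum_univ_three] <;> grind

theorem sl2_cube_mul_slTrans (hw : w ^ 3 = 1) (hw1 : w ^ 2 + w + 1 = 0) (x y : F) :
    sl2 w hw 1 1 ^ 3 * slTrans w hw x y = slTrans w hw x (-y) * sl2 w hw 1 1 ^ 3 := by
  rw [pow_succ, pow_succ, pow_one, mul_assoc, sl2_mul_slTrans hw hw1, mul_assoc,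
    ← mul_assoc _ _ (sl2 w hw 1 1), sl2_mul_slTrans hw hw1, ← mul_assoc, ← mul_assoc,
    sl2_mul_slTrans hw hw1, mul_assoc, mul_assoc, ← mul_assoc (sl2 w hw 1 1)]
  congr 2
  · linear_combination x * hw
  · linear_combination (-y * (w ^ 3 + 1)) * hw

/-- The commutator of σ₂ and σ₃ is `slTrans` with parameters (w - 1, 1). Conjugation by σ₂³ negates
only the second parameter, so sum and difference isolate the two parameters, and multiples of each
fill the prime field. -/
theorem slTrans_mem (hw : w ^ 3 = 1) (hw1 : w ^ 2 + w + 1 = 0) (h3 : (3 : F) ≠ 0)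
    (h2 : (2 : F) ≠ 0) (hF : ∀ x y : F, x ≠ 0 → ∃ n : ℕ, y = n * x)
    {H : Subgroup (Matrix.SpecialLinearGroup (Fin 3) F)} (hA2 : sl2 w hw 1 1 ∈ H)
    (hA3 : sl3 1 ∈ H) (x y : F) : slTrans w hw x y ∈ H := by
  have hne : w - 1 ≠ 0 := fun h => h3 (by
    rw [sub_eq_zero] at h
    rw [h] at hw1
    linear_combination hw1)
  have h1 : slTrans w hw (w - 1) 1 ∈ H :=
    (Subgroup.mul_mem_cancel_right _ (mul_mem hA3 hA2)).1
      (sl2_mul_sl3_eq_slTrans_mul hw hw1 ▸ mul_mem hA2 hA3)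
  have h4 : slTrans w hw (w - 1) (-1) ∈ H :=
    (Subgroup.mul_mem_cancel_right _ (pow_mem hA2 3)).1
      (sl2_cube_mul_slTrans hw hw1 _ _ ▸ mul_mem (pow_mem hA2 3) h1)
  have h5 : slTrans w hw (2 * (w - 1)) 0 ∈ H := by
    have := mul_mem h1 h4
    rwa [slTrans_mul, add_neg_cancel, ← two_mul] at this
  have h6 : slTrans w hw 0 2 ∈ H := by
    have := mul_mem h1 (inv_mem h4)
    rwa [slTrans_inv, slTrans_mul, add_neg_cancel, neg_neg, one_add_one_eq_two] at this
  obtain ⟨n, rfl⟩ := hF _ x (mul_ne_zero h2 hne)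
  obtain ⟨m, rfl⟩ := hF _ y h2
  have := mul_mem (pow_mem h5 n) (pow_mem h6 m)
  rwa [slTrans_pow, slTrans_pow, slTrans_mul, mul_zero, mul_zero, add_zero, zero_add] at this

theorem eq_slTrans_of_smul (hw : w ^ 3 = 1) {B : SpecialLinearGroup (Fin 3) F}
    (h1 : B • ![(1 : F), 0, 0] = ![(1 : F), 0, 0])
    (h2 : B • ![(1 : F), w, w ^ 2] = ![(1 : F), w, w ^ 2]) :
    B = slTrans w hw (-B 0 2 - B 2 1) (B 2 1) := by
  obtain ⟨e1, e2, e3⟩ := col_zero_of_smul (h1.trans (one_smul F _).symm)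
  obtain ⟨e4, e5, e6⟩ := rows_of_smul (h2.trans (one_smul F _).symm)
  have e7 := sl_det B
  simp only [e1, e2, e3] at e4 e5 e6 e7
  have k1 : B 2 2 = 1 - B 2 1 * w ^ 2 := by grind
  have k2 : B 1 1 = 1 - B 1 2 * w := by grind
  have k3 : B 0 1 = - (B 0 2 * w) := by grind
  have k4 : B 1 2 = - (B 2 1 * w) := by grind
  refine Subtype.ext ?_
  rw [coe_slTrans]
  ext i j
  fin_cases i <;> fin_cases j <;> simp [e1, e2, e3] <;> grind

/-- A scalar and a power of σ₂ make e₁ fixed; a power of σ₃, which itself fixes e₁, then makes (1,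
w, w²) fixed. What remains is an `slTrans`, and these lie in ⟨σ₂, σ₃⟩. -/
theorem segment_one_inf_zero_four_of_one (hw : w ^ 3 = 1) (hw1 : w ^ 2 + w + 1 = 0)
    (h3 : (3 : F) ≠ 0) (h2 : (2 : F) ≠ 0) (hF : ∀ x y : F, x ≠ 0 → ∃ n : ℕ, y = n * x) :
    segment (sigma w hw 1 1) 1 5 ⊓ segment (sigma w hw 1 1) 0 4 ≤
      segment (sigma w hw 1 1) 1 4 := by
  rintro g ⟨hg1, hg2⟩
  obtain ⟨A, rfl⟩ := toPSL_surjective g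
  have hA1 := mem_of_toPSL_mem (scalarSL_mem_sixthStab _)
    (segment_one_five_le_sixthStab hw hw1) hg1
  have hA2 := mem_of_toPSL_mem (scalarSL_mem_sixthStab _) (segment_zero_four_le hw) hg2
  have hC : sl2 w hw 1 1 ∈ sixthStab ![(1 : F), w, w ^ 2] :=
    ⟨w, by rw [show 6 = 3 * 2 from rfl, pow_mul, hw, one_pow], sl2_smul_f hw hw1⟩
  have mA2 : sl2 w hw 1 1 ∈ (segment (sigma w hw 1 1) 1 4).comap toPSL :=
    sl2_mem_segment le_rfl (by norm_num)
  have mA3 : sl3 1 ∈ (segment (sigma w hw 1 1) 1 4).comap toPSL :=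
    sl3_mem_segment (by norm_num) le_rfl
  obtain ⟨z, hz, n, h1⟩ := exists_of_mem_sixthStab (k := 1) hw hA2
  obtain ⟨b, hb, hb'⟩ := mul_mem (mul_mem (scalarSL_mem_sixthStab _ z hz) (pow_mem hC n)) hA1
  refine (scalarSL_mul_pow_mul_mem_iff mA2).1
    (show scalarSL z hz * sl2 w hw 1 1 ^ n * A ∈ _ from ?_)
  generalize scalarSL z hz * sl2 w hw 1 1 ^ n * A = B at *
  obtain ⟨j, hj⟩ := exists_neg_pow_mul_eq_one hw hw1 hb
  refine (Subgroup.mul_mem_cancel_left _ (pow_mem mA3 j)).1 ?_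
  rw [eq_slTrans_of_smul hw (B := sl3 1 ^ j * B)]
  · exact slTrans_mem hw hw1 h3 h2 hF mA2 mA3 _ _
  · rw [mul_smul, h1, sl_pow_smul sl3_smul_e1, one_pow, one_smul]
  · rw [mul_smul, hb', sl_smul_comm, sl_pow_smul (sl3_smul_f hw1), smul_smul, mul_comm, hj,
      one_smul]

theorem no_inverting_hom_of_one (hw : w ^ 3 = 1) (hw1 : w ^ 2 + w + 1 = 0)
    (h3 : (3 : F) ≠ 0) (h2 : (2 : F) ≠ 0) (hF : ∀ x y : F, x ≠ 0 → ∃ n : ℕ, y = n * x)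
    (ψ : ProjectiveSpecialLinearGroup (Fin 3) F →* ProjectiveSpecialLinearGroup (Fin 3) F)
    (h1 : ψ (sigma w hw 1 1 1) = (sigma w hw 1 1 1)⁻¹)
    (h4 : ψ (sigma w hw 1 1 2) = (sigma w hw 1 1 2)⁻¹) : False := by
  obtain ⟨N, hN⟩ := hF 1 w one_ne_zero
  rw [mul_one] at hN
  have hw0 : w ≠ 0 := by
    rintro rfl
    simp at hw
  have hne : w ≠ 1 := fun h => h3 (by
    rw [h] at hw1
    linear_combination hw1)
  have hne2 : w ^ 2 ≠ 1 := fun h => hne (by linear_combination hw - w * h)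
  have e1 : sl2 w hw 1 1 * sl3 1 * (sl2 w hw 1 1)⁻¹ * (sl3 1)⁻¹ = slTrans w hw (w - 1) 1 := by
    rw [sl2_mul_sl3_eq_slTrans_mul hw hw1]
    group
  have e2 : (sl2 w hw 1 1)⁻¹ * (sl3 1)⁻¹ * sl2 w hw 1 1 * sl3 1 =
      slTrans w hw (1 - w) (-1) := by
    rw [mul_assoc, sl2_mul_sl3_eq_mul_slTrans hw hw1]
    group
  have e3 : sl2 w hw 1 1 ^ 3 * slTrans w hw (w - 1) 1 * (sl2 w hw 1 1 ^ 3)⁻¹ *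
      slTrans w hw (w - 1) 1 = slTrans w hw (2 * (w - 1)) 0 := by
    rw [sl2_cube_mul_slTrans hw hw1, mul_inv_cancel_right, slTrans_mul, ← two_mul, neg_add_cancel]
  have e4 : (sl2 w hw 1 1 ^ 3)⁻¹ * slTrans w hw (1 - w) (-1) * sl2 w hw 1 1 ^ 3 *
      slTrans w hw (1 - w) (-1) = slTrans w hw (2 * (1 - w)) 0 := by
    have := sl2_cube_mul_slTrans hw hw1 (1 - w) 1
    rw [mul_assoc _ _ (sl2 w hw 1 1 ^ 3), ← this, inv_mul_cancel_left, slTrans_mul, ← two_mul,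
      add_neg_cancel]
  have e5 : ∀ x, sl2 w hw 1 1 * slTrans w hw x 0 * (sl2 w hw 1 1)⁻¹ = slTrans w hw x 0 ^ N := by
    intro x
    rw [sl2_mul_slTrans hw hw1, mul_inv_cancel_right, slTrans_pow, ← hN, mul_zero, mul_zero]
  -- The commutator c of σ₂ and σ₃ has both parameters nonzero. Multiplying it by its conjugate
  -- under σ₂³ kills the second one, leaving an element that conjugation by σ₂ scales by w, that is,
  -- raises to the power `N`.
  let c : FreeGroup Bool := FreeGroup.of true * FreeGroup.of false * (FreeGroup.of true)⁻¹ *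
    (FreeGroup.of false)⁻¹
  refine no_inverting_hom (u := toPSL (slTrans w hw (2 * (w - 1)) 0))
    (u' := toPSL (slTrans w hw (2 * (1 - w)) 0)) (N := N)
    (FreeGroup.of true ^ 3 * c * (FreeGroup.of true ^ 3)⁻¹ * c) ?_ ?_ ?_ ?_ ?_ ψ h1 h4
  · rw [← e3, ← e1]
    simp only [c, map_mul, map_inv, map_pow, FreeGroup.lift_apply_of, cond_true, cond_false]
    rfl
  · rw [← e4, ← e2]
    simp only [c, map_mul, map_inv, map_pow, FreeGroup.lift_apply_of, cond_true, cond_false,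
      inv_inv, inv_pow]
    rfl
  · rw [sigma_one, ← map_inv, ← map_mul, ← map_mul, e5, map_pow]
  · rw [sigma_one, ← map_inv, ← map_mul, ← map_mul, e5, map_pow]
  · intro h
    rw [← map_pow, slTrans_pow] at h
    obtain ⟨z, _, hz⟩ := exists_of_toPSL_eq h
    have k1 := hz 0 0
    have k2 := hz 0 2
    rw [coe_slTrans, coe_slTrans] at k1 k2
    push_cast at k2
    rw [← hN] at k2
    change 1 = z * 1 at k1
    change -(w * w * (2 * (1 - w)) + w * w * 0) = z * -(2 * (1 - w) + 0) at k2
    have : (2 * (1 - w)) * (w ^ 2 - 1) = 0 := by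
      linear_combination -k2 - 2 * (1 - w) * k1
    exact mul_ne_zero (mul_ne_zero h2 (sub_ne_zero.2 hne.symm)) (sub_ne_zero.2 hne2) this

end plus

end ChiralPolytopes

namespace ChiralPolytopes

/-! ### The case `k = -1` -/

open Matrix

section minus

variable {F : Type*} [Field F] {w : F}

theorem quad_pow_smul {A : SpecialLinearGroup (Fin 3) F} {c : F}
    (h : ∀ v, quad w (A • v) = c * quad w v) (n : ℕ) (v : Fin 3 → F) :
    quad w (A ^ n • v) = c ^ n * quad w v := by
  induction n with
  | zero => simp
  | succ n ih => rw [pow_succ', mul_smul, h, ih, pow_succ', mul_assoc]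

theorem quad_sl2_smul (hw : w ^ 3 = 1) (hw1 : w ^ 2 + w + 1 = 0) (v : Fin 3 → F) :
    quad w (sl2 w hw (-1) 1 • v) = w ^ 2 * quad w v := by
  simp only [quad, sl_smul_apply, coe_sl2]
  simp
  grind

theorem quad_sl3_smul (hw1 : w ^ 2 + w + 1 = 0) (v : Fin 3 → F) :
    quad w (sl3 (-1 : F) • v) = w * quad w v := by
  simp only [quad, sl_smul_apply, coe_sl3]
  simp
  grind

theorem quad_sl4_smul (hw : w ^ 3 = 1) (v : Fin 3 → F) :
    quad w (sl4 F • v) = w ^ 2 * quad w v := by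
  simp only [quad, sl_smul_apply, coe_sl4]
  simp
  grind

theorem segment_one_five_le_quadStab (hw : w ^ 3 = 1) (hw1 : w ^ 2 + w + 1 = 0) :
    segment (sigma w hw (-1) 1) 1 5 ≤ (quadStab w).map toPSL := by
  refine segment_le fun i hi _ => ?_
  fin_cases i
  · simp at hi
  · exact ⟨_, ⟨_, sq_cube hw, quad_sl2_smul hw hw1⟩, rfl⟩
  · exact ⟨_, ⟨_, hw, quad_sl3_smul hw1⟩, rfl⟩
  · exact ⟨_, ⟨_, sq_cube hw, quad_sl4_smul hw⟩, rfl⟩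

/-- σ₁ multiplies the coefficients of xy and yz in the form by different factors, w and 1. -/
theorem segment_one_inf_zero_of_neg_one (hw : w ^ 3 = 1) (hw1 : w ^ 2 + w + 1 = 0) (hne : w ≠ 1) :
    segment (sigma w hw (-1) 1) 1 5 ⊓ segment (sigma w hw (-1) 1) 0 2 = ⊥ := by
  rw [show segment (sigma w hw (-1) 1) 0 2 = Subgroup.zpowers (sigma w hw (-1) 1 0) from
    segment_eq_zpowers 0]
  refine zpowers_inf_eq_bot
    (orderOf_dvd_iff_pow_eq_one.1 (orderOf_sigma_zero hw hne).dvd) fun h => ?_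
  obtain ⟨c, -, hc⟩ := mem_of_toPSL_mem (scalarSL_mem_quadStab w)
    (segment_one_five_le_quadStab hw hw1) h
  have h1 := hc ![1, 1, 0]
  have h2 := hc ![0, 1, 1]
  simp [quad, sl_smul_apply, coe_sl1] at h1 h2
  grind

/-! ### Isometries of the form that fix an isotropic vector. -/

/-- The unipotent isometries of `quad w` that fix `(1, 0, 0)`. -/
def slIsom (w : F) (hw : w ^ 3 = 1) (t : F) : Matrix.SpecialLinearGroup (Fin 3) F :=
  ⟨!![1, t ^ 2 - w * t, t + w ^ 2 * t ^ 2; 0, 1 - w ^ 2 * t, -(w * t); 0, t, 1 + w ^ 2 * t], by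
    simp [det_fin_three]
    linear_combination (-t ^ 2 * w) * hw⟩

theorem coe_slIsom (hw : w ^ 3 = 1) (t : F) : (slIsom w hw t : Matrix (Fin 3) (Fin 3) F) =
    !![1, t ^ 2 - w * t, t + w ^ 2 * t ^ 2; 0, 1 - w ^ 2 * t, -(w * t); 0, t, 1 + w ^ 2 * t] :=
  rfl

theorem slIsom_mul (hw : w ^ 3 = 1) (hw1 : w ^ 2 + w + 1 = 0) (s t : F) :
    slIsom w hw s * slIsom w hw t = slIsom w hw (s + t) := by
  refine Subtype.ext ?_
  rw [Matrix.SpecialLinearGroup.coe_mul]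
  simp only [coe_slIsom]
  ext i j
  fin_cases i <;> fin_cases j <;> simp [Matrix.mul_apply, Fin.sum_univ_three] <;> grind

theorem slIsom_zero (hw : w ^ 3 = 1) : slIsom w hw 0 = 1 := by
  refine Subtype.ext ?_
  rw [coe_slIsom, Matrix.SpecialLinearGroup.coe_one]
  ext i j
  fin_cases i <;> fin_cases j <;> simp

theorem slIsom_pow (hw : w ^ 3 = 1) (hw1 : w ^ 2 + w + 1 = 0) (t : F) (n : ℕ) :
    slIsom w hw t ^ n = slIsom w hw (n * t) := by
  induction n with
  | zero => simp [slIsom_zero]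
  | succ n ih =>
    rw [pow_succ, ih, slIsom_mul hw hw1]
    push_cast
    ring_nf

theorem sl2_mul_slIsom (hw : w ^ 3 = 1) (hw1 : w ^ 2 + w + 1 = 0) (t : F) :
    sl2 w hw (-1) 1 * slIsom w hw t = slIsom w hw (-w ^ 2 * t) * sl2 w hw (-1) 1 := by
  refine Subtype.ext ?_
  rw [Matrix.SpecialLinearGroup.coe_mul, Matrix.SpecialLinearGroup.coe_mul]
  simp only [coe_slIsom, coe_sl2]
  ext i j
  fin_cases i <;> fin_cases j <;> simp [Matrix.mul_apply, Fin.sum_univ_three] <;> grind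

theorem sl2_mul_sl3_eq_slIsom_mul (hw : w ^ 3 = 1) (hw1 : w ^ 2 + w + 1 = 0) :
    sl2 w hw (-1) 1 * sl3 (-1) = slIsom w hw (-1) * (sl3 (-1) * sl2 w hw (-1) 1) := by
  refine Subtype.ext ?_
  rw [Matrix.SpecialLinearGroup.coe_mul, Matrix.SpecialLinearGroup.coe_mul,
    Matrix.SpecialLinearGroup.coe_mul]
  simp only [coe_slIsom, coe_sl2, coe_sl3]
  ext i j
  fin_cases i <;> fin_cases j <;> simp [Matrix.mul_apply, Fin.sum_univ_three] <;> grind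

theorem sl2_mul_sl3_eq_mul_slIsom (hw : w ^ 3 = 1) (hw1 : w ^ 2 + w + 1 = 0) :
    sl2 w hw (-1) 1 * sl3 (-1) = sl3 (-1) * sl2 w hw (-1) 1 * slIsom w hw 1 := by
  refine Subtype.ext ?_
  rw [Matrix.SpecialLinearGroup.coe_mul, Matrix.SpecialLinearGroup.coe_mul,
    Matrix.SpecialLinearGroup.coe_mul]
  simp only [coe_slIsom, coe_sl2, coe_sl3]
  ext i j
  fin_cases i <;> fin_cases j <;> simp [Matrix.mul_apply, Fin.sum_univ_three] <;> grind

/-- The commutator of σ₂ and σ₃ is the element with parameter -1, which generates the whole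
one-parameter group over a prime field. -/
theorem slIsom_mem (hw : w ^ 3 = 1) (hw1 : w ^ 2 + w + 1 = 0)
    (hF : ∀ x y : F, x ≠ 0 → ∃ n : ℕ, y = n * x)
    {H : Subgroup (Matrix.SpecialLinearGroup (Fin 3) F)} (hA2 : sl2 w hw (-1) 1 ∈ H)
    (hA3 : sl3 (-1) ∈ H) (t : F) : slIsom w hw t ∈ H := by
  have h1 : slIsom w hw (-1) ∈ H :=
    (Subgroup.mul_mem_cancel_right _ (mul_mem hA3 hA2)).1
      (sl2_mul_sl3_eq_slIsom_mul hw hw1 ▸ mul_mem hA2 hA3)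
  obtain ⟨n, rfl⟩ := hF (-1) t (neg_ne_zero.2 one_ne_zero)
  rw [← slIsom_pow hw hw1]
  exact pow_mem h1 n

/-- The vector e₁ is isotropic. Comparing the form on e₂, e₁ + e₂, e₃ and e₁ + e₃ expresses the
remaining entries through `B 2 1`, with the determinant supplying the last equation. -/
theorem eq_slIsom_of_quad_smul (hw : w ^ 3 = 1) {B : SpecialLinearGroup (Fin 3) F}
    (h1 : B • ![(1 : F), 0, 0] = ![(1 : F), 0, 0]) (h2 : ∀ v, quad w (B • v) = quad w v) :
    B = slIsom w hw (B 2 1) := by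
  obtain ⟨e1, e2, e3⟩ := col_zero_of_smul (h1.trans (one_smul F _).symm)
  have e4 := h2 ![0, 1, 0]
  have e5 := h2 ![1, 1, 0]
  have e6 := h2 ![0, 0, 1]
  have e7 := h2 ![1, 0, 1]
  simp [quad, sl_smul_apply, e1, e2, e3] at e4 e5 e6 e7
  have e8 := sl_det B
  simp only [e1, e2, e3] at e8
  have k1 : B 1 1 = 1 - w ^ 2 * B 2 1 := by grind
  have k2 : B 1 2 = w ^ 2 - w ^ 2 * B 2 2 := by grind
  have k3 : B 2 2 = 1 + w ^ 2 * B 2 1 := by grind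
  have k4 : B 1 2 = -(w * B 2 1) := by grind
  have k5 : B 0 1 = -(w * B 1 1 * B 2 1) := by grind
  have k6 : B 0 2 = -(w ^ 2 * B 1 2 * B 2 2) := by grind
  refine Subtype.ext ?_
  rw [coe_slIsom]
  ext i j
  fin_cases i <;> fin_cases j <;> simp [e1, e2, e3] <;> grind

theorem segment_one_inf_zero_three_of_neg_one (hw : w ^ 3 = 1) (hw1 : w ^ 2 + w + 1 = 0) :
    segment (sigma w hw (-1) 1) 1 5 ⊓ segment (sigma w hw (-1) 1) 0 3 ≤
      segment (sigma w hw (-1) 1) 1 3 := by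
  rintro g ⟨hg1, hg2⟩
  obtain ⟨A, rfl⟩ := toPSL_surjective g
  have hA1 := mem_of_toPSL_mem (scalarSL_mem_quadStab w) (segment_one_five_le_quadStab hw hw1) hg1
  have hA2 := mem_of_toPSL_mem (scalar_mem_pairStab _ _) (segment_zero_three_le hw) hg2
  obtain ⟨z, hz, n, h1, h2⟩ := exists_of_mem_pairStab hA2 (sl2_smul_e1 (k := -1) hw)
    (sl2_smul_e2 hw)
  have hC : sl2 w hw (-1) 1 ∈ quadStab w := ⟨_, sq_cube hw, quad_sl2_smul hw hw1⟩
  obtain ⟨c, -, hc⟩ := mul_mem (mul_mem (scalarSL_mem_quadStab w z hz) (pow_mem hC n)) hA1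
  refine (scalarSL_mul_pow_mul_mem_iff (sl2_mem_segment le_rfl le_rfl)).1
    (show scalarSL z hz * sl2 w hw (-1) 1 ^ n * A ∈ _ from ?_)
  generalize scalarSL z hz * sl2 w hw (-1) 1 ^ n * A = B at *
  obtain ⟨e1, e2, e3⟩ := col_zero_of_smul (h1.trans (one_smul F _).symm)
  obtain ⟨e4, e5, e6⟩ := col_one_of_smul (h2.trans (one_smul F _).symm)
  -- This vector is fixed by `B` and has form value 1, so the multiplier `c` is 1 and `B` is an
  -- isometry.
  have e7 := hc ![1, 1, 0]
  simp [quad, sl_smul_apply, e1, e2, e3, e4, e5, e6] at e7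
  rw [eq_slIsom_of_quad_smul hw h1 fun v => by rw [hc, ← e7, one_mul], e6, slIsom_zero]
  exact one_mem _

theorem segment_one_inf_zero_four_of_neg_one (hw : w ^ 3 = 1) (hw1 : w ^ 2 + w + 1 = 0)
    (hF : ∀ x y : F, x ≠ 0 → ∃ n : ℕ, y = n * x) :
    segment (sigma w hw (-1) 1) 1 5 ⊓ segment (sigma w hw (-1) 1) 0 4 ≤
      segment (sigma w hw (-1) 1) 1 4 := by
  rintro g ⟨hg1, hg2⟩
  obtain ⟨A, rfl⟩ := toPSL_surjective g
  have hA1 := mem_of_toPSL_mem (scalarSL_mem_quadStab w) (segment_one_five_le_quadStab hw hw1) hg1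
  have hA2 := mem_of_toPSL_mem (scalarSL_mem_sixthStab _) (segment_zero_four_le hw) hg2
  have hC : sl2 w hw (-1) 1 ∈ quadStab w := ⟨_, sq_cube hw, quad_sl2_smul hw hw1⟩
  have mA2 : sl2 w hw (-1) 1 ∈ (segment (sigma w hw (-1) 1) 1 4).comap toPSL :=
    sl2_mem_segment le_rfl (by norm_num)
  have mA3 : sl3 (-1) ∈ (segment (sigma w hw (-1) 1) 1 4).comap toPSL :=
    sl3_mem_segment (by norm_num) le_rfl
  obtain ⟨z, hz, n, h1⟩ := exists_of_mem_sixthStab (k := -1) hw hA2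
  obtain ⟨c, hc3, hc⟩ := mul_mem (mul_mem (scalarSL_mem_quadStab w z hz) (pow_mem hC n)) hA1
  refine (scalarSL_mul_pow_mul_mem_iff mA2).1
    (show scalarSL z hz * sl2 w hw (-1) 1 ^ n * A ∈ _ from ?_)
  generalize scalarSL z hz * sl2 w hw (-1) 1 ^ n * A = B at *
  obtain ⟨j, rfl⟩ := exists_pow_eq_of_cube_eq_one hw1 hc3
  -- σ₃ multiplies the form by w and fixes e₁, so its power 2j cancels the multiplier w^j without
  -- losing the fixed vector.
  refine (Subgroup.mul_mem_cancel_left _ (pow_mem mA3 (2 * j))).1 ?_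
  rw [eq_slIsom_of_quad_smul hw (B := sl3 (-1) ^ (2 * j) * B)]
  · exact slIsom_mem hw hw1 hF mA2 mA3 _
  · rw [mul_smul, h1, sl_pow_smul sl3_smul_e1, one_pow, one_smul]
  · intro v
    rw [mul_smul, quad_pow_smul (quad_sl3_smul hw1), hc, ← mul_assoc, ← pow_add,
      show 2 * j + j = 3 * j by ring, pow_mul, hw, one_pow, one_mul]

/-- Each element of ⟨σ₃, σ₄⟩ is one of 1, σ₄, σ₄², σ₃σ₄² times a power of σ₃. As σ₃ lies in ⟨σ₁, σ₂,
σ₃⟩ but σ₄ and σ₄² do not, only the first coset meets that subgroup. -/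
theorem segment_two_inf_zero_four_of_neg_one (hw : w ^ 3 = 1) :
    segment (sigma w hw (-1) 1) 2 5 ⊓ segment (sigma w hw (-1) 1) 0 4 ≤
      segment (sigma w hw (-1) 1) 2 4 := by
  rintro g ⟨hg1, hg2⟩
  have m2 : sigma w hw (-1) 1 2 ∈ segment (sigma w hw (-1) 1) 0 4 :=
    mem_segment _ (by norm_num) (by norm_num)
  have m2' : sigma w hw (-1) 1 2 ∈ segment (sigma w hw (-1) 1) 2 4 :=
    mem_segment _ le_rfl (by norm_num)
  have h3 := sigma_three_notMem (k := -1) hw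
  have ha : sigma w hw (-1) 1 2 ^ 3 = 1 :=
    orderOf_dvd_iff_pow_eq_one.1 (orderOf_sigma_two_of_neg_one hw).dvd
  have hb : sigma w hw (-1) 1 3 ^ 3 = 1 :=
    orderOf_dvd_iff_pow_eq_one.1 (orderOf_sigma_three hw).dvd
  have hb2 : sigma w hw (-1) 1 3 ^ 2 ∉ segment (sigma w hw (-1) 1) 0 4 := fun h => h3 (by
    have := mul_mem h h
    rwa [← pow_add, pow_succ, hb, one_mul] at this)
  have hab : sigma w hw (-1) 1 2 * sigma w hw (-1) 1 3 *
      (sigma w hw (-1) 1 2 * sigma w hw (-1) 1 3) = 1 := by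
    have := pow_orderOf_eq_one (rot (sigma w hw (-1) 1) 2 4)
    rw [sigma_string hw (k := -1) (by norm_num) 2 4 (by norm_num) le_rfl, sq] at this
    simpa [rot, List.ofFn_succ] using this
  have hu : g ∈ Subgroup.closure {sigma w hw (-1) 1 2, sigma w hw (-1) 1 3} := by
    refine (segment_le fun i hi _ => ?_ : segment (sigma w hw (-1) 1) 2 5 ≤ _) hg1
    fin_cases i
    · simp at hi
    · simp at hi
    · exact Subgroup.subset_closure (Or.inl rfl)
    · exact Subgroup.subset_closure (Or.inr rfl)
  obtain ⟨j, rfl | rfl | rfl | rfl⟩ := exists_of_mem_closure_pair ha hb hab hu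
  · exact pow_mem m2' j
  · exact absurd ((Subgroup.mul_mem_cancel_right _ (pow_mem m2 j)).1 hg2) h3
  · exact absurd ((Subgroup.mul_mem_cancel_right _ (pow_mem m2 j)).1 hg2) hb2
  · exact absurd ((Subgroup.mul_mem_cancel_left _ m2).1
      ((Subgroup.mul_mem_cancel_right _ (pow_mem m2 j)).1 hg2)) hb2

/-- The commutator of σ₂ and σ₃ and the same word in the inverses have parameters -1 and 1.
Conjugation by σ₂ scales parameters by -w², whose square is w ≠ 1. -/
theorem no_inverting_hom_of_neg_one (hw : w ^ 3 = 1) (hw1 : w ^ 2 + w + 1 = 0) (hne : w ≠ 1)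
    (hF : ∀ x y : F, x ≠ 0 → ∃ n : ℕ, y = n * x)
    (ψ : ProjectiveSpecialLinearGroup (Fin 3) F →* ProjectiveSpecialLinearGroup (Fin 3) F)
    (h1 : ψ (sigma w hw (-1) 1 1) = (sigma w hw (-1) 1 1)⁻¹)
    (h4 : ψ (sigma w hw (-1) 1 2) = (sigma w hw (-1) 1 2)⁻¹) : False := by
  obtain ⟨N, hN⟩ := hF 1 (-w ^ 2) one_ne_zero
  rw [mul_one] at hN
  have e1 : sl2 w hw (-1) 1 * sl3 (-1) * (sl2 w hw (-1) 1)⁻¹ * (sl3 (-1))⁻¹ =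
      slIsom w hw (-1) := by
    rw [sl2_mul_sl3_eq_slIsom_mul hw hw1]
    group
  have e2 : (sl2 w hw (-1) 1)⁻¹ * (sl3 (-1))⁻¹ * sl2 w hw (-1) 1 * sl3 (-1) = slIsom w hw 1 := by
    rw [mul_assoc, sl2_mul_sl3_eq_mul_slIsom hw hw1]
    group
  have e3 : ∀ t, sl2 w hw (-1) 1 * slIsom w hw t * (sl2 w hw (-1) 1)⁻¹ = slIsom w hw t ^ N := by
    intro t
    rw [sl2_mul_slIsom hw hw1, mul_inv_cancel_right, slIsom_pow hw hw1, ← hN]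
  refine no_inverting_hom (u := toPSL (slIsom w hw (-1))) (u' := toPSL (slIsom w hw 1)) (N := N)
    (FreeGroup.of true * FreeGroup.of false * (FreeGroup.of true)⁻¹ * (FreeGroup.of false)⁻¹)
    ?_ ?_ ?_ ?_ ?_ ψ h1 h4
  · rw [← e1]
    simp only [map_mul, map_inv, FreeGroup.lift_apply_of, cond_true, cond_false]
    rfl
  · rw [← e2]
    simp only [map_mul, map_inv, FreeGroup.lift_apply_of, cond_true, cond_false, inv_inv]
    rfl
  · rw [sigma_one, ← map_inv, ← map_mul, ← map_mul, e3, map_pow]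
  · rw [sigma_one, ← map_inv, ← map_mul, ← map_mul, e3, map_pow]
  · intro h
    rw [← map_pow, slIsom_pow hw hw1] at h
    obtain ⟨z, _, hz⟩ := exists_of_toPSL_eq h
    have k1 := hz 0 0
    have k2 := hz 2 1
    rw [coe_slIsom, coe_slIsom] at k1 k2
    push_cast at k2
    rw [← hN] at k2
    change 1 = z * 1 at k1
    change -w ^ 2 * -w ^ 2 * 1 = z * 1 at k2
    exact hne (by linear_combination k2 - k1 - w * hw)

end minus

end ChiralPolytopes

namespace ChiralPolytopes

/-! ### The theorem -/

open Matrix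

section main

variable {F : Type} [Field F] {w : F}

theorem sigma_chainIntersection (hw : w ^ 3 = 1) (hw1 : w ^ 2 + w + 1 = 0) (h3 : (3 : F) ≠ 0)
    (h2 : (2 : F) ≠ 0) (hF : ∀ x y : F, x ≠ 0 → ∃ n : ℕ, y = n * x) {k : F}
    (hk : k = 1 ∨ k = -1) (hσ : StringRel (sigma w hw k 1)) :
    (groupFlags hσ).ChainIntersection := by
  have hne : w ≠ 1 := fun h => h3 (by
    rw [h] at hw1
    linear_combination hw1)
  have hk2 : k ^ 2 = 1 := by rcases hk with rfl | rfl <;> norm_num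
  refine chainIntersection_of_rank_five hσ (sigma_ne_one hw hw1 h3 h2 hk2) ?_ ?_ ?_ ?_
    (segment_three_inf hw) (segment_one_inf_segment_two hw hw1 h3 h2 hk2)
  · rcases hk with rfl | rfl
    · exact segment_one_inf_zero_of_one hw hw1 hne
    · exact segment_one_inf_zero_of_neg_one hw hw1 hne
  · rcases hk with rfl | rfl
    · exact segment_one_inf_zero_three_of_one hw hw1
    · exact segment_one_inf_zero_three_of_neg_one hw hw1
  · rcases hk with rfl | rfl
    · exact segment_one_inf_zero_four_of_one hw hw1 h3 h2 hF
    · exact segment_one_inf_zero_four_of_neg_one hw hw1 hF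
  · rcases hk with rfl | rfl
    · exact segment_two_inf_zero_four_of_one hw hw1 h3
    · exact segment_two_inf_zero_four_of_neg_one hw

theorem sigma_chiral (hw : w ^ 3 = 1) (hw1 : w ^ 2 + w + 1 = 0) (h3 : (3 : F) ≠ 0)
    (h2 : (2 : F) ≠ 0) (hF : ∀ x y : F, x ≠ 0 → ∃ n : ℕ, y = n * x) {k : F}
    (hk : k = 1 ∨ k = -1) (hσ : StringRel (sigma w hw k 1)) :
    ¬ ∃ φ : ProjectiveSpecialLinearGroup (Fin 3) F ≃* ProjectiveSpecialLinearGroup (Fin 3) F,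
      φ (rot (sigma w hw k 1) 0 1) = (rot (sigma w hw k 1) 0 1)⁻¹ ∧
      ∀ b : ℕ, 2 ≤ b → b ≤ 4 →
        φ (rot (sigma w hw k 1) 0 b) = rot (sigma w hw k 1) 0 b := by
  rintro ⟨φ, h1, h4⟩
  have hne : w ≠ 1 := fun h => h3 (by
    rw [h] at hw1
    linear_combination hw1)
  obtain ⟨ψ, e1, e2⟩ := exists_inverting_hom hσ φ h1 h4
  rcases hk with rfl | rfl
  · exact no_inverting_hom_of_one hw hw1 h3 h2 hF ψ e1 e2
  · exact no_inverting_hom_of_neg_one hw hw1 hne hF ψ e1 e2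

end main

end ChiralPolytopes

theorem theorem1p2 (p : ℕ) [Fact p.Prime] (hp : p % 6 = 1)
    (ω : ZMod p) (hω : IsPrimitiveRoot ω 3)
    (k : ZMod p) (hk : k = 1 ∨ k = -1) (i : ℕ) (hi : i = 1 ∨ i = 2) :
    ChiralPolytopes.IsChiralCPlusGroup (ChiralPolytopes.sigma ω hω.pow_eq_one k i) ∧
    ChiralPolytopes.GeneratesChiralPolytope (ChiralPolytopes.sigma ω hω.pow_eq_one k i) ∧
    (k = 1 →
      ChiralPolytopes.schlafliType (ChiralPolytopes.sigma ω hω.pow_eq_one k i) = ![3, 6, 6, 3]) ∧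
    (k = -1 →
      ChiralPolytopes.schlafliType (ChiralPolytopes.sigma ω hω.pow_eq_one k i) = ![3, 6, 3, 3]) := by
  have hp1 : p ≠ 1 := (Fact.out : p.Prime).ne_one
  have h2 : (2 : ZMod p) ≠ 0 := by
    refine fun h => hp1 ?_
    have : p ∣ 2 := (ZMod.natCast_eq_zero_iff 2 p).1 (by exact_mod_cast h)
    have := Nat.le_of_dvd (by norm_num) this
    omega
  have h3 : (3 : ZMod p) ≠ 0 := by
    refine fun h => hp1 ?_
    have : p ∣ 3 := (ZMod.natCast_eq_zero_iff 3 p).1 (by exact_mod_cast h)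
    have := Nat.le_of_dvd (by norm_num) this
    omega
  -- In the prime field every quotient y / x is the class of a natural number.
  have hF : ∀ x y : ZMod p, x ≠ 0 → ∃ n : ℕ, y = n * x := fun x y hx =>
    ⟨(y / x).val, by rw [ZMod.natCast_zmod_val, div_mul_cancel₀ y hx]⟩
  have hw' : IsPrimitiveRoot (ω ^ i) 3 :=
    hω.pow_of_coprime i (by rcases hi with rfl | rfl <;> decide)
  have hw := hw'.pow_eq_one
  have hne : ω ^ i ≠ 1 := hw'.ne_one (by norm_num)
  have hw1 : (ω ^ i) ^ 2 + ω ^ i + 1 = 0 := by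
    refine (mul_eq_zero.1 (?_ : (ω ^ i - 1) * _ = 0)).resolve_left (sub_ne_zero.2 hne)
    linear_combination hw
  have hk2 : k ^ 2 = 1 := by rcases hk with rfl | rfl <;> norm_num
  -- From here the primitive cube root is ω^i and the exponent in the matrices is 1.
  rw [ChiralPolytopes.sigma_eq ω hω.pow_eq_one k i hw]
  have hσ := ChiralPolytopes.sigma_stringRel hw hk2
  have hM := ChiralPolytopes.sigma_chainIntersection hw hw1 h3 h2 hF hk hσ
  have hgen := ChiralPolytopes.sigma_generate hw hF hw1 h3 hk2
  have hchir := ChiralPolytopes.sigma_chiral hw hw1 h3 h2 hF hk hσ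
  refine ⟨⟨hgen, ChiralPolytopes.sigma_string hw hk2,
    ChiralPolytopes.rotSubgroup_inf hσ hM hgen, hchir⟩,
    ChiralPolytopes.generatesChiralPolytope hσ hM hgen hchir (by norm_num), ?_, ?_⟩
  · rintro rfl
    funext j
    fin_cases j
    · exact ChiralPolytopes.orderOf_sigma_zero hw hne
    · exact ChiralPolytopes.orderOf_sigma_one hw hw1 h3 h2 hk2
    · exact ChiralPolytopes.orderOf_sigma_two_of_one hw h2
    · exact ChiralPolytopes.orderOf_sigma_three hw
  · rintro rfl
    funext j
    fin_cases j
    · exact ChiralPolytopes.orderOf_sigma_zero hw hne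
    · exact ChiralPolytopes.orderOf_sigma_one hw hw1 h3 h2 hk2
    · exact ChiralPolytopes.orderOf_sigma_two_of_neg_one hw
    · exact ChiralPolytopes.orderOf_sigma_three hw
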